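/- **Setting.** Let $d\ge1$, let $\Omega\subseteq\mathbb R^d$ be open with finite Lebesgue measure, and let $H=L_2(\Omega,\mathbb C^n)$ with $\langle u,v\rangle=\int_\Omega u\cdot\overline v\,dx$. Let $p_*=\frac{2d}{d-2}$ if $d\ge3$, and let $p_*\in(2,\infty)$ be arbitrary but fixed if $d\le2$. Let $V\subseteq W^{1,2}(\Omega,\mathbb C^n)$ be a closed subspace which is dense in $H$ and such that there is a continuous embedding $V\subseteq L_{p_*}(\Omega,\mathbb C^n)$. Let $A$ be a Kato operator in $H$ with a form on $V$. That is, $A$ is the operator associated with a sesquilinear form $a\colon V\times V\to\mathbb C$ satisfying $|a(u,v)|\le C\|u\|_V\|v\|_V$ and $\operatorname{Re}a(u,u)\ge c\|u\|_V^2$ with some $c>0$ (so $u\in D(A)$, $Au=w$ means $u\in V$, $w\in H$, and $\langle w,\varphi\rangle=a(u,\varphi)$ for all $\varphi\in V$), and $D(A^{1/2})=V$ with equivalent norms. For $0\le\beta<1$ let $H_\beta=D(A^\beta)$ with the norm $\|u\|_{H_\beta}=\|A^\beta u\|_H$, and for $0\le\gamma<1$ let $H_{-\gamma}$ be the completion of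 $H$ with respect to the norm $\|u\|_{H_{-\gamma}}=\|A^{-\gamma}u\|_H$. A measurable $w\colon\Omega\to\mathbb C^n$ is regarded as an element of $H_{-\gamma}$ by means of the antidual pairing: $w$ corresponds to $g\in H_{-\gamma}$ if for every $\varphi\in D((A^*)^\gamma)$ the function $w\cdot\overline\varphi$ is integrable with $\int_\Omega w\cdot\overline\varphi\,dx=\langle g,\varphi\rangle$, where $\langle\cdot,\varphi\rangle$ denotes the continuous extension of the scalar product from $H$ to $H_{-\gamma}$. Let $\widetilde f\colon[0,\infty)\times\Omega\times\mathbb C^n\to\mathbb C^n$ and $\sigma\ge1$. For exponents $\widetilde p,q\ge1$ we say that $\widetilde f$ satisfies condition $(\mathrm{L}_{\widetilde p,q})$ if the following holds. * For each $t_0\in[0,\infty)$ there are $L_{t_0}\ge0$, $\sigma_{t_0}>0$, and a neighborhood $I\subseteq[0,\infty)$ of $t_0$ such that for each $t\in I$ there are measurable $a_t,b_t\colon\Omega\to[0,\infty)$ with $\int_\Omega a_t^{\widetilde p}\,dx\le1$, $\int_\Omega b_t^{q}\,dx\le1$ such that for each $t\in I$ there holds for almost all $x\in\Omega$, for all $u,v\in\mathbb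 C^n$, $$|\widetilde f(t,x,u)-\widetilde f(t,x,v)|\le L_{t_0}\bigl(a_t(x)+|u|+|v|\bigr)^{\sigma-1}|u-v|,$$ and such that for each $t,s\in I$ there holds for almost all $x\in\Omega$, for all $u\in\mathbb C^n$, $$|\widetilde f(t,x,u)-\widetilde f(s,x,u)|\le L_{t_0}\bigl(b_t(x)+b_s(x)+|u|^\sigma\bigr)|t-s|^{\sigma_{t_0}}.$$ * $\widetilde f(t,\cdot,u)$ is measurable for all $(t,u)\in[0,\infty)\times\mathbb C^n$, and $\widetilde f(0,\cdot,0)\in L_q(\Omega,\mathbb C^n)$. **Proposition 5.6.** Assume one of the following. 1. $\alpha=0$, $\gamma\in[1/2,1)$, and one of the following holds: * $d=1$, $\sigma=2$, the embedding $V\subseteq L_\infty(\Omega,\mathbb C^n)$ is continuous, and $\widetilde f$ satisfies $(\mathrm{L}_{2,q})$ with $q=1$; * $d=2$, $\sigma<2$, the embedding $V\subseteq L_P(\Omega,\mathbb C^n)$ is continuous for some $P\in(2,\infty)$ with $\sigma\le2-\frac2P$ (which is automatic if it is continuous for all $P\in(2,\infty)$), and $\widetilde f$ satisfies $(\mathrm{L}_{2,q})$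 with $q=(1-\frac1{p_*})^{-1}$; * $d\ge3$, $\sigma=2-\frac2{p_*}$, and $\widetilde f$ satisfies $(\mathrm{L}_{2,q})$ with $q=(1-\frac1{p_*})^{-1}$. 2. $\alpha=0$, the embedding $D(A^*)\subseteq L_p(\Omega,\mathbb C^n)$ is continuous for some $p\in(p_*,\infty)$, $\sigma<2-\frac2p$, and thus $\gamma_0:=\frac{(\sigma-2)p_*p-2p_*+4p}{4(p-p_*)}<1$; $\gamma\in[\max\{\gamma_0,1/2\},1)$, and $\widetilde f$ satisfies $(\mathrm{L}_{2,q})$ with $q=\bigl(1-\frac{2\gamma-1}p-\frac{2-2\gamma}{p_*}\bigr)^{-1}$. 3. $\alpha=1/2$, $\sigma<p_*-1$, and thus $\gamma_0:=\frac{2\sigma-p_*}{2p_*-4}<\frac12$; $\gamma\in[\max\{\gamma_0,0\},1/2)$, and $\widetilde f$ satisfies $(\mathrm{L}_{p_*,q})$ with $q=\bigl(\frac12+\gamma-\frac{2\gamma}{p_*}\bigr)^{-1}$. Then the superposition operator $f(t,u)(x):=\widetilde f(t,x,u(x))$ maps $[0,\infty)\times H_\alpha$ into $H_{-\gamma}$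 and has the following properties. * (Right local Hölder–Lipschitz condition.) For each $(t_0,u_0)\in[0,\infty)\times H_\alpha$ there are a relative neighborhood $U_0\subseteq[t_0,\infty)\times H_\alpha$ of $(t_0,u_0)$ and constants $L<\infty$ and $\sigma'>0$ with $$\|f(t,u)-f(s,v)\|_{H_{-\gamma}}\le L\bigl(|t-s|^{\sigma'}+\|u-v\|_{H_\alpha}\bigr)\quad\text{for all }(t,u),(s,v)\in U_0.$$ * (Left-local boundedness.) For each $t_1>0$ and each bounded $M\subseteq H_\alpha$ there is $\varepsilon>0$ such that $\{f(t,u): t\in[t_1-\varepsilon,t_1),\ t\ge0,\ u\in M\}$ is bounded in $H_{-\gamma}$. -/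

import Mathlib

open MeasureTheory Set Filter Topology
open scoped ENNReal NNReal ContDiff LinearPMap

noncomputable section

section AbstractPowers

variable {H : Type*} [NormedAddCommGroup H] [InnerProductSpace ℂ H] [CompleteSpace H]
variable {V : Type*} [NormedAddCommGroup V] [NormedSpace ℂ V]

/-- The operator in `H` associated with a sesquilinear form `a` (linear in the first, antilinear in
the second variable) on a space `V` mapped into `H` by `ι`: `u = ι v` is in the domain, with
`A u = w`, iff `⟨w, ι φ⟩ = a v φ` for all `φ`. (In Mathlib `inner ℂ x y` is linear in `y`.)
For `ι` injective with dense range the graph below is single-valued and hence is the graph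
of the operator. -/
def formOperator (ι : V →ₗ[ℂ] H) (a : V →ₗ[ℂ] V →ₗ⋆[ℂ] ℂ) : H →ₗ.[ℂ] H :=
  Submodule.toLinearPMap
    { carrier := {z : H × H | ∃ v : V, ι v = z.1 ∧ ∀ φ : V, inner ℂ (ι φ) z.2 = a v φ}
      add_mem' := by
        rintro z z' ⟨v, hv, h⟩ ⟨v', hv', h'⟩
        exact ⟨v + v', by simp [hv, hv'], fun φ => by simp [h, h']⟩
      zero_mem' := ⟨0, by simp, fun φ => by simp⟩
      smul_mem' := by
        rintro c z ⟨v, hv, h⟩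
        exact ⟨c • v, by simp [hv], fun φ => by simp [h]⟩ }

/-- `R` is the bounded two-sided inverse of `s + A : D(A) → H`. -/
def IsShiftInverse (A : H →ₗ.[ℂ] H) (s : ℝ) (R : H →L[ℂ] H) : Prop :=
  (∀ x : H, ∃ h : R x ∈ A.domain, A ⟨R x, h⟩ + (s : ℂ) • R x = x) ∧
    ∀ u : A.domain, R (A u + (s : ℂ) • (u : H)) = u

open Classical in
/-- `(s + A)⁻¹` as a bounded operator (`0` if `s + A` is not boundedly invertible). -/
def shiftInverse (A : H →ₗ.[ℂ] H) (s : ℝ) : H →L[ℂ] H :=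
  if h : ∃ R : H →L[ℂ] H, IsShiftInverse A s R then h.choose else 0

/-- The negative fractional power `A ^ (-β)`, `0 ≤ β < 1`, of an operator of positive type, by the
formula `A ^ (-β) = (sin (π β) / π) ∫₀^∞ s ^ (-β) (s + A)⁻¹ ds` for `0 < β < 1`. -/
def negPow (A : H →ₗ.[ℂ] H) (β : ℝ) : H →L[ℂ] H :=
  if β = 0 then ContinuousLinearMap.id ℂ H
  else ((Real.sin (Real.pi * β) / Real.pi : ℝ) : ℂ) •
    ∫ s in Ioi (0 : ℝ), ((s ^ (-β) : ℝ) : ℂ) • shiftInverse A s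

/-- The fractional power `A ^ β = (A ^ (-β))⁻¹`, `0 ≤ β < 1`, an unbounded operator in `H` whose
domain is the range of `A ^ (-β)`. -/
def fracPow (A : H →ₗ.[ℂ] H) (β : ℝ) : H →ₗ.[ℂ] H :=
  ((negPow A β : H →ₗ[ℂ] H).toPMap ⊤).inverse

/-- The space `H_β = D(A ^ β)`, `0 ≤ β < 1`, normed by `‖u‖ = ‖A ^ β u‖`. -/
def PowSpace (A : H →ₗ.[ℂ] H) (β : ℝ) : Type _ := (fracPow A β).domain

instance (A : H →ₗ.[ℂ] H) (β : ℝ) : AddCommGroup (PowSpace A β) :=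
  inferInstanceAs (AddCommGroup (fracPow A β).domain)

instance (A : H →ₗ.[ℂ] H) (β : ℝ) : Module ℂ (PowSpace A β) :=
  inferInstanceAs (Module ℂ (fracPow A β).domain)

/-- `A ^ β : H_β → H`. -/
def PowSpace.pow (A : H →ₗ.[ℂ] H) (β : ℝ) : PowSpace A β →ₗ[ℂ] H := (fracPow A β).toFun

/-- The inclusion `H_β ⊆ H`. -/
def PowSpace.incl (A : H →ₗ.[ℂ] H) (β : ℝ) : PowSpace A β →ₗ[ℂ] H := (fracPow A β).domain.subtype

instance (A : H →ₗ.[ℂ] H) (β : ℝ) : SeminormedAddCommGroup (PowSpace A β) :=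
  SeminormedAddCommGroup.induced _ _ (PowSpace.pow A β)

instance (A : H →ₗ.[ℂ] H) (β : ℝ) : NormedSpace ℂ (PowSpace A β) :=
  NormedSpace.induced ℂ (PowSpace A β) H (PowSpace.pow A β)

/-- A copy of `H`, carrying the norm `‖u‖ = ‖A ^ (-γ) u‖`. -/
def PreExtrap (_A : H →ₗ.[ℂ] H) (_γ : ℝ) : Type _ := H

instance (A : H →ₗ.[ℂ] H) (γ : ℝ) : AddCommGroup (PreExtrap A γ) :=
  inferInstanceAs (AddCommGroup H)

instance (A : H →ₗ.[ℂ] H) (γ : ℝ) : Module ℂ (PreExtrap A γ) :=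
  inferInstanceAs (Module ℂ H)

/-- `A ^ (-γ)` on the copy of `H`. -/
def PreExtrap.pow (A : H →ₗ.[ℂ] H) (γ : ℝ) : PreExtrap A γ →ₗ[ℂ] H :=
  (negPow A γ : H →ₗ[ℂ] H)

instance (A : H →ₗ.[ℂ] H) (γ : ℝ) : SeminormedAddCommGroup (PreExtrap A γ) :=
  SeminormedAddCommGroup.induced _ _ (PreExtrap.pow A γ)

instance (A : H →ₗ.[ℂ] H) (γ : ℝ) : NormedSpace ℂ (PreExtrap A γ) :=
  NormedSpace.induced ℂ (PreExtrap A γ) H (PreExtrap.pow A γ)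

/-- The extrapolation space `H_{-γ}`, `0 ≤ γ < 1`: the completion of `H` with respect to the norm
`‖u‖ = ‖A ^ (-γ) u‖`. -/
abbrev ExtrapSpace (A : H →ₗ.[ℂ] H) (γ : ℝ) : Type _ := UniformSpace.Completion (PreExtrap A γ)

/-- The canonical map `H → H_{-γ}`. -/
def toExtrap (A : H →ₗ.[ℂ] H) (γ : ℝ) (u : H) : ExtrapSpace A γ :=
  ((show PreExtrap A γ from u : PreExtrap A γ) : UniformSpace.Completion (PreExtrap A γ))

/-- `A` is a Kato operator with a form on `V` (where `ι` is the embedding of `V` into `H`): it is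
associated with a continuous, strongly accretive sesquilinear form on `V`, and `H_{1/2} = V` with
equivalent norms. -/
def IsKatoOperator (ι : V →ₗ[ℂ] H) (A : H →ₗ.[ℂ] H) : Prop :=
  (∃ a : V →ₗ[ℂ] V →ₗ⋆[ℂ] ℂ,
    (∃ C : ℝ, 0 ≤ C ∧ ∀ u v : V, ‖a u v‖ ≤ C * ‖u‖ * ‖v‖) ∧
    (∃ c : ℝ, 0 < c ∧ ∀ u : V, c * ‖u‖ ^ 2 ≤ (a u u).re) ∧
    A = formOperator ι a) ∧
  LinearMap.range (PowSpace.incl A (1 / 2)) = LinearMap.range ι ∧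
  ∃ c C : ℝ, 0 < c ∧ 0 < C ∧ ∀ (v : V) (u : PowSpace A (1 / 2)), PowSpace.incl A (1 / 2) u = ι v →
    c * ‖v‖ ≤ ‖u‖ ∧ ‖u‖ ≤ C * ‖v‖

/-- The right local Hölder-Lipschitz condition for `F : [0, ∞) × X → Y`. -/
def RightLocallyHolderLipschitz {X Y : Type*} [SeminormedAddCommGroup X]
    [SeminormedAddCommGroup Y] (F : ℝ → X → Y) : Prop :=
  ∀ t₀ : ℝ, 0 ≤ t₀ → ∀ u₀ : X,
    ∃ U₀ ∈ 𝓝[Ici t₀ ×ˢ (univ : Set X)] (t₀, u₀), U₀ ⊆ Ici t₀ ×ˢ (univ : Set X) ∧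
      ∃ L σ : ℝ, 0 < σ ∧ ∀ z ∈ U₀, ∀ z' ∈ U₀,
        ‖F z.1 z.2 - F z'.1 z'.2‖ ≤ L * (|z.1 - z'.1| ^ σ + ‖z.2 - z'.2‖)

/-- Left-local boundedness for `F : [0, ∞) × X → Y`. -/
def LeftLocallyBounded {X Y : Type*} [SeminormedAddCommGroup X]
    [SeminormedAddCommGroup Y] (F : ℝ → X → Y) : Prop :=
  ∀ t₁ : ℝ, 0 < t₁ → ∀ M : Set X, Bornology.IsBounded M →
    ∃ ε : ℝ, 0 < ε ∧ Bornology.IsBounded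
      {y : Y | ∃ t ∈ Ici (0 : ℝ) ∩ Ico (t₁ - ε) t₁, ∃ u ∈ M, F t u = y}

end AbstractPowers

section Concrete

variable {d : ℕ} (n : ℕ) (Ω : Set (EuclideanSpace ℝ (Fin d)))

/-- `L₂(Ω, ℂⁿ)`. -/
abbrev L2 : Type := Lp (EuclideanSpace ℂ (Fin n)) 2 (volume.restrict Ω)

/-- `g` is the weak partial derivative `∂ᵢ u` in `Ω`. -/
def IsWeakPartial (i : Fin d) (u g : L2 n Ω) : Prop :=
  ∀ φ : EuclideanSpace ℝ (Fin d) → ℝ, ContDiff ℝ ∞ φ → HasCompactSupport φ → tsupport φ ⊆ Ω →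
    ∫ x in Ω, fderiv ℝ φ x (EuclideanSpace.single i 1) • u x = -∫ x in Ω, φ x • g x

variable {n Ω}

theorem integrable_test_smul {φ : EuclideanSpace ℝ (Fin d) → ℝ} (hc : Continuous φ)
    (hs : HasCompactSupport φ) (u : L2 n Ω) :
    Integrable (fun x => φ x • u x) (volume.restrict Ω) := by
  have h1 : MemLp φ 2 (volume.restrict Ω) := hc.memLp_of_hasCompactSupport hs
  exact memLp_one_iff_integrable.mp (MemLp.smul (p := 2) (q := 2) (r := 1) (Lp.memLp u) h1)

theorem continuous_partial {φ : EuclideanSpace ℝ (Fin d) → ℝ} (h : ContDiff ℝ ∞ φ) (i : Fin d) :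
    Continuous fun x => fderiv ℝ φ x (EuclideanSpace.single i 1) :=
  (h.continuous_fderiv (by simp)).clm_apply continuous_const

theorem IsWeakPartial.add {i : Fin d} {u g u' g' : L2 n Ω} (h : IsWeakPartial n Ω i u g)
    (h' : IsWeakPartial n Ω i u' g') : IsWeakPartial n Ω i (u + u') (g + g') := by
  intro φ h1 h2 h3
  have e1 : ∀ ψ : EuclideanSpace ℝ (Fin d) → ℝ, Continuous ψ → HasCompactSupport ψ →
      ∀ v w : L2 n Ω, ∫ x in Ω, ψ x • (v + w : L2 n Ω) x =
        (∫ x in Ω, ψ x • v x) + ∫ x in Ω, ψ x • w x := by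
    intro ψ hψ hψ' v w
    rw [← integral_add (integrable_test_smul hψ hψ' v) (integrable_test_smul hψ hψ' w)]
    refine integral_congr_ae ?_
    filter_upwards [Lp.coeFn_add v w] with x hx
    rw [hx, Pi.add_apply, smul_add]
  rw [e1 _ (continuous_partial h1 i) (h2.fderiv_apply (𝕜 := ℝ) _), e1 _ h1.continuous h2,
    h φ h1 h2 h3, h' φ h1 h2 h3, neg_add]

theorem IsWeakPartial.smul {i : Fin d} {u g : L2 n Ω} (c : ℂ) (h : IsWeakPartial n Ω i u g) :
    IsWeakPartial n Ω i (c • u) (c • g) := by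
  intro φ h1 h2 h3
  have e1 : ∀ (ψ : EuclideanSpace ℝ (Fin d) → ℝ) (v : L2 n Ω),
      ∫ x in Ω, ψ x • (c • v : L2 n Ω) x = c • ∫ x in Ω, ψ x • v x := by
    intro ψ v
    rw [← integral_smul]
    refine integral_congr_ae ?_
    filter_upwards [Lp.coeFn_smul c v] with x hx
    rw [hx, Pi.smul_apply, smul_comm]
  rw [e1, e1, h φ h1 h2 h3, smul_neg]

theorem IsWeakPartial.zero (i : Fin d) : IsWeakPartial n Ω i 0 0 := by
  intro φ _ _ _
  have e1 : ∀ ψ : EuclideanSpace ℝ (Fin d) → ℝ, ∫ x in Ω, ψ x • (0 : L2 n Ω) x = 0 := by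
    intro ψ
    rw [← integral_zero (EuclideanSpace ℝ (Fin d)) (EuclideanSpace ℂ (Fin n))
      (μ := volume.restrict Ω)]
    refine integral_congr_ae ?_
    filter_upwards [Lp.coeFn_zero (EuclideanSpace ℂ (Fin n)) 2 (volume.restrict Ω)] with x hx
    rw [hx, Pi.zero_apply, smul_zero]
  rw [e1, e1, neg_zero]

variable (n Ω)

/-- The pairs consisting of some `u ∈ L₂` and its weak gradient in `L₂`. -/
def weakGraph : Submodule ℂ (WithLp 2 (L2 n Ω × PiLp 2 (fun _ : Fin d => L2 n Ω))) where
  carrier := {z | ∀ i, IsWeakPartial n Ω i z.fst (z.snd i)}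
  add_mem' := fun h h' i => (h i).add (h' i)
  zero_mem' := fun i => IsWeakPartial.zero i
  smul_mem' := fun c _ h i => (h i).smul c

/-- The Sobolev space `W^{1,2}(Ω, ℂⁿ)`, its elements being recorded together with their weak
gradients, with the norm `(‖u‖² + ∑ᵢ ‖∂ᵢ u‖²)^{1/2}`. -/
def W12 : Type := weakGraph n Ω

instance : NormedAddCommGroup (W12 n Ω) := inferInstanceAs (NormedAddCommGroup (weakGraph n Ω))

instance : InnerProductSpace ℂ (W12 n Ω) := inferInstanceAs (InnerProductSpace ℂ (weakGraph n Ω))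

variable {n Ω}

/-- The inclusion of `W^{1,2}(Ω, ℂⁿ)` into `L₂(Ω, ℂⁿ)`. -/
def W12.toL2 : W12 n Ω →ₗ[ℂ] L2 n Ω where
  toFun u := u.1.fst
  map_add' _ _ := rfl
  map_smul' _ _ := rfl

/-- The inclusion of a subspace `V` of `W^{1,2}(Ω, ℂⁿ)` into `L₂(Ω, ℂⁿ)`. -/
def inclL2 (V : Submodule ℂ (W12 n Ω)) : V →ₗ[ℂ] L2 n Ω := W12.toL2 ∘ₗ V.subtype

/-- The continuous embedding `V ⊆ L_p(Ω, ℂⁿ)`. -/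
def EmbedsLp (V : Submodule ℂ (W12 n Ω)) (p : ℝ≥0∞) : Prop :=
  ∃ C : ℝ≥0, ∀ v : V, eLpNorm (inclL2 V v) p (volume.restrict Ω) ≤ C * ‖v‖ₑ

/-- The continuous embedding `D(T) ⊆ L_p(Ω, ℂⁿ)`, with the graph norm on `D(T)`. -/
def DomainEmbedsLp (T : L2 n Ω →ₗ.[ℂ] L2 n Ω) (p : ℝ≥0∞) : Prop :=
  ∃ C : ℝ≥0, ∀ u : T.domain,
    eLpNorm (u : L2 n Ω) p (volume.restrict Ω) ≤ C * (‖(u : L2 n Ω)‖ₑ + ‖T u‖ₑ)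

/-- The measurable function `w : Ω → ℂⁿ` represents the element `g` of `H_{-γ}`. Here `H_{-γ}` is
identified with the antidual of `D((A*) ^ γ)` by means of the unique continuous extension
`ℓ = ⟨·, φ⟩` of the `L₂` pairing from `H` to `H_{-γ}`; the pairing of `w` with `φ` is the
integral of `w(x) · conj φ(x)`. -/
def Represents (A : L2 n Ω →ₗ.[ℂ] L2 n Ω) (γ : ℝ)
    (w : EuclideanSpace ℝ (Fin d) → EuclideanSpace ℂ (Fin n)) (g : ExtrapSpace A γ) : Prop :=
  AEStronglyMeasurable w (volume.restrict Ω) ∧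
  ∀ φ ∈ (fracPow A† γ).domain,
    Integrable (fun x => inner ℂ (φ x) (w x)) (volume.restrict Ω) ∧
    ∃ ℓ : ExtrapSpace A γ →L[ℂ] ℂ, (∀ u : L2 n Ω, ℓ (toExtrap A γ u) = inner ℂ φ u) ∧
      ℓ g = ∫ x in Ω, inner ℂ (φ x) (w x)

/-- The hypotheses on the nonlinearity `f : [0, ∞) × Ω × ℂⁿ → ℂⁿ` (only its values at times
`t ≥ 0` matter): the local Lipschitz growth bound in `u`, the local Hölder bound in `t`,
measurability in `x`, and `f(0, ·, 0) ∈ L_q`; here `a t` and `b t` are bounded by `1` in `L_p`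
and `L_q`, respectively. -/
def LipHolderGrowth (Ω : Set (EuclideanSpace ℝ (Fin d)))
    (f : ℝ → EuclideanSpace ℝ (Fin d) → EuclideanSpace ℂ (Fin n) → EuclideanSpace ℂ (Fin n))
    (p q σ : ℝ) : Prop :=
  (∀ t₀ : ℝ, 0 ≤ t₀ → ∃ L σ₀ : ℝ, 0 ≤ L ∧ 0 < σ₀ ∧
    ∃ I : Set ℝ, I ⊆ Ici 0 ∧ I ∈ 𝓝[Ici 0] t₀ ∧
    ∃ a b : ℝ → EuclideanSpace ℝ (Fin d) → ℝ≥0,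
      (∀ t ∈ I, AEMeasurable (a t) (volume.restrict Ω) ∧ AEMeasurable (b t) (volume.restrict Ω) ∧
        ∫⁻ x in Ω, (a t x : ℝ≥0∞) ^ p ≤ 1 ∧ ∫⁻ x in Ω, (b t x : ℝ≥0∞) ^ q ≤ 1) ∧
      (∀ t ∈ I, ∀ᵐ x ∂(volume.restrict Ω), ∀ u v : EuclideanSpace ℂ (Fin n),
        ‖f t x u - f t x v‖ ≤ L * ((a t x : ℝ) + ‖u‖ + ‖v‖) ^ (σ - 1) * ‖u - v‖) ∧
      (∀ t ∈ I, ∀ s ∈ I, ∀ᵐ x ∂(volume.restrict Ω), ∀ u : EuclideanSpace ℂ (Fin n),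
        ‖f t x u - f s x u‖ ≤ L * ((b t x : ℝ) + (b s x : ℝ) + ‖u‖ ^ σ) * |t - s| ^ σ₀)) ∧
  (∀ t : ℝ, 0 ≤ t → ∀ u : EuclideanSpace ℂ (Fin n),
    AEStronglyMeasurable (fun x => f t x u) (volume.restrict Ω)) ∧
  MemLp (fun x => f 0 x 0) (ENNReal.ofReal q) (volume.restrict Ω)

/-- The superposition operator `F(t, u)(x) = f(t, x, u(x))` maps `[0, ∞) × H_α` into `H_{-γ}`,
satisfies a right local Hölder-Lipschitz condition, and is left-locally bounded. -/
def SuperpositionGood (A : L2 n Ω →ₗ.[ℂ] L2 n Ω)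
    (f : ℝ → EuclideanSpace ℝ (Fin d) → EuclideanSpace ℂ (Fin n) → EuclideanSpace ℂ (Fin n))
    (α γ : ℝ) : Prop :=
  ∃ F : ℝ → PowSpace A α → ExtrapSpace A γ,
    (∀ t : ℝ, 0 ≤ t → ∀ u : PowSpace A α,
      Represents A γ (fun x => f t x (PowSpace.incl A α u x)) (F t u)) ∧
    RightLocallyHolderLipschitz F ∧ LeftLocallyBounded F

end Concrete

end

/-! ### Forms, Lax–Milgram and resolvents -/

section FormTheory

variable {H : Type*} [NormedAddCommGroup H] [InnerProductSpace ℂ H]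
variable {V : Type*} [NormedAddCommGroup V] [InnerProductSpace ℂ V]

/-! Everything is reduced to one embedding of `D((A*)^γ)` into a Lebesgue space. The extension of
`A^(-γ)` is an isometry of `H_{-γ}` into `H`. Hence, if `D((A*)^γ) ⊆ L_{q'}`, the pairing with a
function `w ∈ L_q` is a bounded functional and represents an element of `H_{-γ}` of norm at most `C
‖w‖_q` (`exists_represents`, `Represents.enorm_sub_le`). On the other side, Hölder's inequality and
the growth condition make the superposition operator Lipschitz on bounded sets from `L_p` to
`L_{q₀}` and Hölder in time, provided that `σ q₀ ≤ p` and `q₀ ≤ q` (`LipHolderGrowth.local_bounds`).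
The exponent `α` enters only through `H_α ⊆ L_p`: `p = 2` for `α = 0`, and `p = p_*` for `α = 1/2`,
where `H_{1/2} = V`. `superpositionGood_of_dualBound` combines the two sides. The lower bounds on
`γ` in cases 2 and 3 are exactly what `σ q₀ ≤ p` demands.

The embeddings, stated in dual form as `DualBound`, come from the formula expressing `(A*)^(-γ) x`
as a multiple of `∫ s^(-γ) (s + A*)⁻¹ x ds`. Testing the resolvent equation with its own solution
gives three estimates for `(s + A*)⁻¹`: it is `O(s⁻¹)` from `L₂` to `L₂`, `O(s^(-1/2))` from `L₂` to
`V`, and `O(1)` from `L₂` to `D(A*)`. For `γ > 1/2` the integral converges absolutely in `V`. For `γ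
= 1/2` the Kato property takes over, together with the fact that the square of `A^(-1/2)` is a
multiple of `A⁻¹` (`exists_sq_integral_eq`).

The remaining cases need the exact interpolated exponent, with no loss. Integrating by parts turns
the integrand into `s^(-γ) (s + A*)⁻¹ z(s)` with `z(s) = s A* (s + A*)⁻² x`, and accretivity yields
the square function estimate `∫ ‖z(s)‖² ds/s ≤ ‖x‖²`. In the pairing with a function `g`, one splits
`|g|` at a height `s^m`, uses the resolvent estimate with the better target space on the high part
and the other one on the low part, and applies the Cauchy–Schwarz inequality with respect to `ds/s`.
This is real interpolation carried out by hand (`lintegral_pairing_interpolation`). -/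

/-- Bounded and coercive sesquilinear forms. -/
structure IsCoerciveForm (a : V →ₗ[ℂ] V →ₗ⋆[ℂ] ℂ) (C c : ℝ) : Prop where
  nonneg : 0 ≤ C
  bound : ∀ u v : V, ‖a u v‖ ≤ C * ‖u‖ * ‖v‖
  pos : 0 < c
  coercive : ∀ u : V, c * ‖u‖ ^ 2 ≤ (a u u).re

/-- The adjoint form `(u, v) ↦ conj (a v u)`. -/
noncomputable def adjForm (a : V →ₗ[ℂ] V →ₗ⋆[ℂ] ℂ) : V →ₗ[ℂ] V →ₗ⋆[ℂ] ℂ :=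
  LinearMap.mk₂'ₛₗ (RingHom.id ℂ) (starRingEnd ℂ) (fun u v => starRingEnd ℂ (a v u))
    (by simp) (by simp) (by simp) (by simp)

theorem adjForm_apply (a : V →ₗ[ℂ] V →ₗ⋆[ℂ] ℂ) (u v : V) :
    adjForm a u v = starRingEnd ℂ (a v u) := rfl

theorem IsCoerciveForm.adj {a : V →ₗ[ℂ] V →ₗ⋆[ℂ] ℂ} {C c : ℝ} (h : IsCoerciveForm a C c) :
    IsCoerciveForm (adjForm a) C c where
  nonneg := h.nonneg
  bound u v := by
    rw [adjForm_apply, RCLike.norm_conj]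
    linarith [h.bound v u, mul_right_comm C ‖u‖ ‖v‖]
  pos := h.pos
  coercive u := by rw [adjForm_apply, Complex.conj_re]; exact h.coercive u

/-- The shifted form `a(u, v) + s ⟨u, v⟩`. -/
noncomputable def shiftForm (ι : V →L[ℂ] H) (a : V →ₗ[ℂ] V →ₗ⋆[ℂ] ℂ) (s : ℝ) :
    V →ₗ[ℂ] V →ₗ⋆[ℂ] ℂ :=
  LinearMap.mk₂'ₛₗ (RingHom.id ℂ) (starRingEnd ℂ)
    (fun u v => a u v + (s : ℂ) * inner ℂ (ι v) (ι u))
    (by intros; simp; ring) (by intros; simp; ring) (by intros; simp; ring) (by intros; simp; ring)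

theorem shiftForm_apply (ι : V →L[ℂ] H) (a : V →ₗ[ℂ] V →ₗ⋆[ℂ] ℂ) (s : ℝ) (u v : V) :
    shiftForm ι a s u v = a u v + (s : ℂ) * inner ℂ (ι v) (ι u) := rfl

theorem IsCoerciveForm.shift {a : V →ₗ[ℂ] V →ₗ⋆[ℂ] ℂ} {C c : ℝ} (h : IsCoerciveForm a C c)
    (ι : V →L[ℂ] H) {s : ℝ} (hs : 0 ≤ s) :
    IsCoerciveForm (shiftForm ι a s) (C + s * (‖ι‖ * ‖ι‖)) c where
  nonneg := by have := h.nonneg; positivity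
  bound u v := by
    rw [shiftForm_apply]
    refine (norm_add_le _ _).trans ?_
    rw [norm_mul, Complex.norm_real, Real.norm_of_nonneg hs]
    have h1 := h.bound u v
    have h2 : ‖inner ℂ (ι v) (ι u)‖ ≤ (‖ι‖ * ‖v‖) * (‖ι‖ * ‖u‖) :=
      (norm_inner_le_norm _ _).trans (mul_le_mul (ι.le_opNorm v) (ι.le_opNorm u)
        (norm_nonneg _) (by positivity))
    nlinarith [mul_le_mul_of_nonneg_left h2 hs]
  pos := h.pos
  coercive u := by
    rw [shiftForm_apply, inner_self_eq_norm_sq_to_K, Complex.add_re]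
    have : ((s : ℂ) * ((‖ι u‖ : ℝ) : ℂ) ^ 2).re = s * ‖ι u‖ ^ 2 := by norm_cast
    have h2 := h.coercive u
    have h3 : 0 ≤ s * ‖ι u‖ ^ 2 := by positivity
    simp only [Complex.coe_algebraMap] at *
    linarith

theorem IsCoerciveForm.eq_zero {a : V →ₗ[ℂ] V →ₗ⋆[ℂ] ℂ} {C c : ℝ} (h : IsCoerciveForm a C c)
    {v : V} (hv : a v v = 0) : v = 0 := by
  have h1 := h.coercive v
  rw [hv, Complex.zero_re] at h1
  have h2 : ‖v‖ ^ 2 ≤ 0 := by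
    by_contra hh
    push Not at hh
    have := mul_pos h.pos hh
    linarith
  have : ‖v‖ = 0 := by nlinarith [norm_nonneg v]
  simpa using this

/-- Lax–Milgram: the operator `B` representing the form is bounded below by `c`, so it is injective
with closed range. A vector `w` orthogonal to the range satisfies `a w w = 0`, hence vanishes, and
`B` is onto. -/
theorem IsCoerciveForm.lax_milgram [CompleteSpace V] {a : V →ₗ[ℂ] V →ₗ⋆[ℂ] ℂ} {C c : ℝ}
    (h : IsCoerciveForm a C c) : ∃ T : V →L[ℂ] V, ∀ w φ : V, a (T w) φ = inner ℂ φ w := by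
  classical
  let b : V →L⋆[ℂ] V →L[ℂ] ℂ := a.flip.mkContinuous₂ C (fun u v => by
    rw [LinearMap.flip_apply]; linarith [h.bound v u, mul_right_comm C ‖u‖ ‖v‖])
  let B : V →L[ℂ] V := ContinuousLinearMap.adjoint (InnerProductSpace.continuousLinearMapOfBilin b)
  have hB : ∀ v φ, inner ℂ φ (B v) = a v φ := by
    intro v φ
    rw [ContinuousLinearMap.adjoint_inner_right,
      InnerProductSpace.continuousLinearMapOfBilin_apply]
    rfl
  have hlow : ∀ v, ‖v‖ ≤ c⁻¹ * ‖B v‖ := by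
    intro v
    rw [inv_mul_eq_div, le_div_iff₀ h.pos]
    rcases eq_or_ne v 0 with rfl | hv
    · simp
    have h1 := h.coercive v
    rw [← hB v v] at h1
    have h2 : (inner ℂ v (B v)).re ≤ ‖v‖ * ‖B v‖ :=
      re_inner_le_norm (𝕜 := ℂ) v (B v)
    have h3 : 0 < ‖v‖ := norm_pos_iff.mpr hv
    nlinarith
  have hanti : AntilipschitzWith c⁻¹.toNNReal B :=
    B.antilipschitz_of_bound (by
      intro v; rw [Real.coe_toNNReal _ (inv_nonneg.mpr h.pos.le)]; exact hlow v)
  have hclosed : IsClosed (LinearMap.range (B : V →ₗ[ℂ] V) : Set V) :=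
    hanti.isClosed_range B.uniformContinuous
  have hrange : LinearMap.range (B : V →ₗ[ℂ] V) = ⊤ := by
    have := hclosed.completeSpace_coe
    rw [← Submodule.orthogonal_orthogonal (LinearMap.range (B : V →ₗ[ℂ] V)),
      Submodule.eq_top_iff']
    intro v w hw
    have : w = 0 := by
      apply h.eq_zero
      rw [← hB]
      have := hw (B w) ⟨w, rfl⟩
      rw [← inner_conj_symm, this, map_zero]
    rw [this]; exact inner_zero_left _
  let e := ContinuousLinearEquiv.ofBijective B
    (LinearMap.ker_eq_bot.mpr hanti.injective) hrange
  refine ⟨e.symm, fun w φ => ?_⟩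
  rw [← hB]
  congr 1
  exact e.apply_symm_apply w

/-- The shifted form stays coercive, and the functional `φ ↦ ⟨ι φ, x⟩` is represented in `V` by the
adjoint of `ι` applied to `x`. -/
theorem IsCoerciveForm.exists_resolvent [CompleteSpace V] [CompleteSpace H]
    {a : V →ₗ[ℂ] V →ₗ⋆[ℂ] ℂ} {C c : ℝ}
    (h : IsCoerciveForm a C c) (ι : V →L[ℂ] H) {s : ℝ} (hs : 0 ≤ s) :
    ∃ Q : H →L[ℂ] V, ∀ x φ, a (Q x) φ + (s : ℂ) * inner ℂ (ι φ) (ι (Q x)) = inner ℂ (ι φ) x := by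
  obtain ⟨T, hT⟩ := (h.shift ι hs).lax_milgram
  refine ⟨T ∘L ContinuousLinearMap.adjoint ι, fun x φ => ?_⟩
  have := hT (ContinuousLinearMap.adjoint ι x) φ
  rw [ContinuousLinearMap.adjoint_inner_right] at this
  exact this

open Classical in
/-- The solution operator `H → V` of `a(u, φ) + s ⟨u, φ⟩ = ⟨x, φ⟩`. -/
noncomputable def formSol (ι : V →L[ℂ] H) (a : V →ₗ[ℂ] V →ₗ⋆[ℂ] ℂ) (s : ℝ) : H →L[ℂ] V :=
  if h : ∃ Q : H →L[ℂ] V, ∀ x φ, a (Q x) φ + (s : ℂ) * inner ℂ (ι φ) (ι (Q x)) = inner ℂ (ι φ) x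
  then h.choose else 0

/-- The resolvent `(s + A)⁻¹` of the operator associated with a form. -/
noncomputable def formRes (ι : V →L[ℂ] H) (a : V →ₗ[ℂ] V →ₗ⋆[ℂ] ℂ) (s : ℝ) : H →L[ℂ] H :=
  ι ∘L formSol ι a s

theorem formRes_apply (ι : V →L[ℂ] H) (a : V →ₗ[ℂ] V →ₗ⋆[ℂ] ℂ) (s : ℝ) (x : H) :
    formRes ι a s x = ι (formSol ι a s x) := rfl

namespace IsCoerciveForm

variable {a : V →ₗ[ℂ] V →ₗ⋆[ℂ] ℂ} {C c : ℝ} (h : IsCoerciveForm a C c) (ι : V →L[ℂ] H) {s : ℝ}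
include h

theorem sol_unique (hs : 0 ≤ s) {x : H} {v w : V}
    (hv : ∀ φ, a v φ + (s : ℂ) * inner ℂ (ι φ) (ι v) = inner ℂ (ι φ) x)
    (hw : ∀ φ, a w φ + (s : ℂ) * inner ℂ (ι φ) (ι w) = inner ℂ (ι φ) x) : v = w := by
  have := (h.shift ι hs).eq_zero (v := v - w) (by
    have h1 := hv (v - w)
    have h2 := hw (v - w)
    rw [LinearMap.map_sub₂]
    simp only [shiftForm_apply]
    rw [h1, h2, sub_self])
  exact sub_eq_zero.mp this

variable [CompleteSpace V] [CompleteSpace H]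

theorem formSol_spec (hs : 0 ≤ s) (x : H) (φ : V) :
    a (formSol ι a s x) φ + (s : ℂ) * inner ℂ (ι φ) (formRes ι a s x) = inner ℂ (ι φ) x := by
  have h1 := h.exists_resolvent ι hs
  have h2 : formSol ι a s = h1.choose := dif_pos h1
  rw [formRes_apply, h2]
  exact h1.choose_spec x φ

theorem form_formSol (hs : 0 ≤ s) (x : H) (φ : V) :
    a (formSol ι a s x) φ = inner ℂ (ι φ) (x - (s : ℂ) • formRes ι a s x) := by
  rw [inner_sub_right, inner_smul_right, ← h.formSol_spec ι hs x φ]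
  ring

theorem accretive_formRes (hs : 0 ≤ s) (x : H) :
    c * ‖formSol ι a s x‖ ^ 2 ≤
      (inner ℂ (formRes ι a s x) (x - (s : ℂ) • formRes ι a s x)).re := by
  have h1 := h.form_formSol ι hs x (formSol ι a s x)
  rw [← formRes_apply] at h1
  rw [← h1]
  exact h.coercive _

/-- The energy inequality, obtained by testing the equation with its own solution. It is the source
of the norm bounds of the solution operator. -/
theorem accretive_formRes' (hs : 0 ≤ s) (x : H) :
    c * ‖formSol ι a s x‖ ^ 2 + s * ‖formRes ι a s x‖ ^ 2 ≤ ‖formRes ι a s x‖ * ‖x‖ := by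
  have h1 := h.accretive_formRes ι hs x
  rw [inner_sub_right, inner_smul_right, inner_self_eq_norm_sq_to_K, Complex.sub_re] at h1
  have h2 : ((s : ℂ) * ((‖formRes ι a s x‖ : ℝ) : ℂ) ^ 2).re = s * ‖formRes ι a s x‖ ^ 2 := by
    norm_cast
  simp only [Complex.coe_algebraMap] at h1
  rw [h2] at h1
  have h3 : (inner ℂ (formRes ι a s x) x).re ≤ ‖formRes ι a s x‖ * ‖x‖ :=
    re_inner_le_norm (𝕜 := ℂ) _ _
  linarith

theorem norm_formSol_le (hs : 0 ≤ s) (x : H) : ‖formSol ι a s x‖ ≤ ‖ι‖ / c * ‖x‖ := by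
  have h1 := h.accretive_formRes' ι hs x
  have h2 : ‖formRes ι a s x‖ ≤ ‖ι‖ * ‖formSol ι a s x‖ := ι.le_opNorm _
  have h3 : 0 ≤ s * ‖formRes ι a s x‖ ^ 2 := by positivity
  rw [div_mul_eq_mul_div, le_div_iff₀ h.pos]
  rcases (norm_nonneg (formSol ι a s x)).eq_or_lt with h0 | h0
  · rw [← h0]; simp; positivity
  · have h4 := mul_le_mul_of_nonneg_right h2 (norm_nonneg x)
    nlinarith

/-- Multiply the energy inequality by `s` and complete the square: `s ‖R x‖ ‖x‖ - s² ‖R x‖² ≤ ‖x‖² /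
4`. The decay `s^(-1/2)` in `V` lies halfway between `O(s⁻¹)` in `H` and `O(1)` in the domain. -/
theorem norm_formSol_le_rpow (hs : 0 < s) (x : H) :
    ‖formSol ι a s x‖ ≤ c ^ (-1 / 2 : ℝ) * s ^ (-1 / 2 : ℝ) * ‖x‖ := by
  have h1 := h.accretive_formRes' ι hs.le x
  have h2 : c * ‖formSol ι a s x‖ ^ 2 * s ≤ ‖x‖ ^ 2 := by
    nlinarith [sq_nonneg (s * ‖formRes ι a s x‖ - ‖x‖ / 2), sq_nonneg ‖x‖]
  have hc := h.pos
  have e : ∀ r : ℝ, 0 < r → (r ^ (-1 / 2 : ℝ)) ^ 2 = r⁻¹ := by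
    intro r hr
    rw [← Real.rpow_natCast, ← Real.rpow_mul hr.le]
    norm_num
    rw [Real.rpow_neg_one]
  refine abs_le_of_sq_le_sq' ?_ (by positivity) |>.2
  rw [mul_pow, mul_pow, e c hc, e s hs]
  rw [← mul_inv, inv_mul_eq_div, le_div_iff₀ (by positivity)]
  linarith

/-- Both sides come from solutions of the same shifted equation in `V`, and such solutions are
unique. -/
theorem formRes_identity {t : ℝ} (hs : 0 ≤ s) (ht : 0 ≤ t) :
    formRes ι a s - formRes ι a t = ((t - s : ℝ) : ℂ) • (formRes ι a s ∘L formRes ι a t) := by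
  have key : ∀ x, formSol ι a s x =
      formSol ι a t x + ((t - s : ℝ) : ℂ) • formSol ι a s (formRes ι a t x) := by
    intro x
    refine h.sol_unique ι hs (x := x) (fun φ => h.formSol_spec ι hs x φ) (fun φ => ?_)
    have h1 := h.formSol_spec ι ht x φ
    have h2 := h.formSol_spec ι hs (formRes ι a t x) φ
    rw [formRes_apply ι a s] at h2
    rw [formRes_apply] at h1
    simp only [map_add, map_smul, LinearMap.add_apply, LinearMap.smul_apply, inner_add_right,
      inner_smul_right, smul_eq_mul, Complex.ofReal_sub, formRes_apply ι a t] at h1 h2 ⊢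
    linear_combination h1 + ((t : ℂ) - s) * h2
  ext x
  have := congrArg ι (key x)
  rw [map_add, map_smul] at this
  simp only [_root_.sub_apply, _root_.smul_apply,
    ContinuousLinearMap.comp_apply, formRes_apply] at this ⊢
  rw [this]
  abel

/-- The equation of either form is tested with the solution of the other one. -/
theorem adjoint_formRes (hs : 0 ≤ s) :
    ContinuousLinearMap.adjoint (formRes ι a s) = formRes ι (adjForm a) s := by
  symm
  rw [ContinuousLinearMap.eq_adjoint_iff]
  intro y x
  have h1 := h.formSol_spec ι hs x (formSol ι (adjForm a) s y)
  have h2 := h.adj.formSol_spec ι hs y (formSol ι a s x)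
  rw [← formRes_apply] at h1 h2
  rw [← h1, ← inner_conj_symm y, ← h2, adjForm_apply]
  simp [inner_conj_symm]

end IsCoerciveForm

theorem IsShiftInverse.unique {A : H →ₗ.[ℂ] H} {s : ℝ} {R R' : H →L[ℂ] H}
    (h : IsShiftInverse A s R) (h' : IsShiftInverse A s R') : R = R' := by
  ext x
  obtain ⟨hx, e⟩ := h.1 x
  have := h'.2 ⟨R x, hx⟩
  rw [e] at this
  exact this.symm

theorem shiftInverse_eq {A : H →ₗ.[ℂ] H} {s : ℝ} {R : H →L[ℂ] H}
    (h : IsShiftInverse A s R) : shiftInverse A s = R := by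
  have h1 : ∃ R : H →L[ℂ] H, IsShiftInverse A s R := ⟨R, h⟩
  have h2 : shiftInverse A s = h1.choose := dif_pos h1
  rw [h2]
  exact h1.choose_spec.unique h

namespace IsCoerciveForm

variable {a : V →ₗ[ℂ] V →ₗ⋆[ℂ] ℂ} {C c : ℝ} (h : IsCoerciveForm a C c) {ι : V →L[ℂ] H} {s : ℝ}

theorem mem_formOperator_domain {u : H} : u ∈ (formOperator (ι : V →ₗ[ℂ] H) a).domain ↔
    ∃ v w, ι v = u ∧ ∀ φ : V, inner ℂ (ι φ) w = a v φ := by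
  unfold formOperator
  rw [Submodule.toLinearPMap_domain]
  constructor
  · rintro ⟨⟨u', w⟩, ⟨v, hv, hw⟩, rfl⟩
    exact ⟨v, w, hv, hw⟩
  · rintro ⟨v, w, rfl, hw⟩
    exact ⟨(ι v, w), ⟨v, rfl, hw⟩, rfl⟩

include h

/-- The graph is single-valued: if `ι v = 0` and `w` is a value, then `a v v = ⟨ι v, w⟩ = 0`, so `v
= 0` by coercivity, and then `w` is orthogonal to the dense range of `ι`. Injectivity of `ι` is
therefore not needed. -/
theorem formOperator_apply (hι : DenseRange ι)
    (u : (formOperator (ι : V →ₗ[ℂ] H) a).domain) :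
    ∃ v, ι v = u ∧ ∀ φ : V, inner ℂ (ι φ) (formOperator (ι : V →ₗ[ℂ] H) a u) = a v φ := by
  revert u
  unfold formOperator
  intro u
  refine Submodule.mem_graph_toLinearPMap ?_ u
  rintro ⟨u, w⟩ ⟨v, hv, hw⟩ hu
  have hv0 : v = 0 := by
    apply h.eq_zero
    rw [← hw]
    have : (ι : V →ₗ[ℂ] H) v = 0 := hv.trans hu
    simp only at this ⊢
    rw [this, inner_zero_left]
  subst hv0
  simp only [map_zero, LinearMap.zero_apply] at hw
  change w = 0
  refine hι.induction_on (p := fun z => inner ℂ z w = 0) w ?_ hw |> fun hh => by simpa using hh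
  exact isClosed_eq (by fun_prop) continuous_const

variable [CompleteSpace V] [CompleteSpace H]

theorem isShiftInverse_formRes (hι : DenseRange ι) (hs : 0 ≤ s) :
    IsShiftInverse (formOperator (ι : V →ₗ[ℂ] H) a) s (formRes ι a s) := by
  have ext_inner : ∀ x y : H, (∀ φ, inner ℂ (ι φ) x = inner ℂ (ι φ) y) → x = y := by
    intro x y hxy
    refine ext_inner_left ℂ fun z => ?_
    refine hι.induction_on (p := fun z => inner ℂ z x = inner ℂ z y) z ?_ hxy
    exact isClosed_eq (by fun_prop) (by fun_prop)
  constructor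
  · intro x
    have hx : formRes ι a s x ∈ (formOperator (ι : V →ₗ[ℂ] H) a).domain :=
      mem_formOperator_domain.mpr ⟨formSol ι a s x, x - (s : ℂ) • formRes ι a s x, rfl,
        fun φ => (h.form_formSol ι hs x φ).symm⟩
    refine ⟨hx, ?_⟩
    obtain ⟨v, hv, hφ⟩ := h.formOperator_apply hι ⟨_, hx⟩
    set w := formOperator (ι : V →ₗ[ℂ] H) a ⟨_, hx⟩
    have hv' : v = formSol ι a s x := by
      have : a (v - formSol ι a s x) (v - formSol ι a s x) = 0 := by
        rw [LinearMap.map_sub₂, ← hφ, h.form_formSol ι hs]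
        have e : ι (v - formSol ι a s x) = 0 := by rw [map_sub, hv]; exact sub_self _
        rw [e]; simp
      exact sub_eq_zero.mp (h.eq_zero this)
    apply ext_inner
    intro φ
    rw [inner_add_right, hφ, hv', inner_smul_right, h.formSol_spec ι hs]
  · intro u
    obtain ⟨v, hv, hφ⟩ := h.formOperator_apply hι u
    rw [← hv, formRes_apply]
    congr 1
    refine h.sol_unique ι hs (x := formOperator (ι : V →ₗ[ℂ] H) a u + (s : ℂ) • ι v)
      (fun φ => h.formSol_spec ι hs _ φ) fun φ => ?_
    rw [inner_add_right, hφ, inner_smul_right]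

/-- If `x` is orthogonal to the domain, then it is orthogonal to `A⁻¹ x`, which says that the form
vanishes at the solution belonging to `x`. Coercivity gives `A⁻¹ x = 0`, hence `x = 0`. -/
theorem dense_domain (hι : DenseRange ι) :
    Dense ((formOperator (ι : V →ₗ[ℂ] H) a).domain : Set H) := by
  rw [Submodule.dense_iff_topologicalClosure_eq_top, Submodule.topologicalClosure_eq_top_iff,
    Submodule.eq_bot_iff]
  intro x hx
  obtain ⟨h1, h2⟩ := (h.isShiftInverse_formRes hι le_rfl).1 x
  have h3 := hx _ h1
  have h4 := h.form_formSol ι le_rfl x (formSol ι a 0 x)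
  simp only [Complex.ofReal_zero, zero_smul, sub_zero, ← formRes_apply, h3] at h4
  have h5 := h.eq_zero h4
  have h6 : formRes ι a 0 x = 0 := by rw [formRes_apply, h5, map_zero]
  have h7 : (⟨formRes ι a 0 x, h1⟩ : (formOperator (ι : V →ₗ[ℂ] H) a).domain) = 0 :=
    Subtype.ext h6
  rw [h7, h6] at h2
  simpa using h2.symm

/-- The inverse of `s + A†` is the adjoint of `(s + A)⁻¹`, which in turn is the resolvent of the
adjoint form. This transfers all form estimates to `A†`. -/
theorem isShiftInverse_adjoint (hι : DenseRange ι) (hs : 0 ≤ s) :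
    IsShiftInverse (formOperator (ι : V →ₗ[ℂ] H) a)† s (formRes ι (adjForm a) s) := by
  have hd := h.dense_domain hι
  have hR := h.isShiftInverse_formRes hι hs
  rw [← h.adjoint_formRes ι hs]
  set A := formOperator (ι : V →ₗ[ℂ] H) a
  set R := formRes ι a s
  have key : ∀ x : H, ∀ u : A.domain,
      inner ℂ (x - (s : ℂ) • ContinuousLinearMap.adjoint R x) (u : H) =
        inner ℂ (ContinuousLinearMap.adjoint R x) (A u) := by
    intro x u
    rw [ContinuousLinearMap.adjoint_inner_left, inner_sub_left, inner_smul_left,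
      ContinuousLinearMap.adjoint_inner_left]
    have h1 : R (A u) = u - (s : ℂ) • R u := by
      have := hR.2 u
      rw [map_add, map_smul] at this
      exact eq_sub_of_add_eq this
    rw [h1, inner_sub_right, inner_smul_right, Complex.conj_ofReal]
  constructor
  · intro x
    have hx : ContinuousLinearMap.adjoint R x ∈ A†.domain :=
      LinearPMap.mem_adjoint_domain_of_exists _ ⟨_, key x⟩
    refine ⟨hx, ?_⟩
    rw [LinearPMap.adjoint_apply_eq hd ⟨_, hx⟩ (key x)]
    abel
  · intro y
    refine ext_inner_right ℂ fun x => ?_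
    obtain ⟨h1, h2⟩ := hR.1 x
    rw [ContinuousLinearMap.adjoint_inner_left, inner_add_left]
    have h3 := LinearPMap.adjoint_isFormalAdjoint hd y ⟨R x, h1⟩
    rw [h3]
    conv_rhs => rw [← h2]
    rw [inner_add_right, inner_smul_right, inner_smul_left, Complex.conj_ofReal]

end IsCoerciveForm

end FormTheory

/-! ### Resolvents of accretive operators, the square function estimate -/

section ResolventCalculus

/-- Integrability on `(0, ∞)` from two power bounds. -/
theorem integrableOn_Ioi_of_rpow_bounds {E : Type*} [NormedAddCommGroup E] {f : ℝ → E}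
    (hf : ContinuousOn f (Ioi 0)) {p q K : ℝ} (hp : -1 < p) (hq : q < -1)
    (h0 : ∀ s, 0 < s → ‖f s‖ ≤ K * s ^ p) (h1 : ∀ s, 0 < s → ‖f s‖ ≤ K * s ^ q) :
    IntegrableOn f (Ioi 0) := by
  have hm := hf.aestronglyMeasurable (μ := volume) measurableSet_Ioi
  rw [← Ioc_union_Ioi_eq_Ioi (zero_le_one (α := ℝ))]
  refine IntegrableOn.union ?_ ?_
  · have h2 : IntegrableOn (fun s : ℝ => K * s ^ p) (Ioc 0 1) :=
      ((intervalIntegrable_iff_integrableOn_Ioc_of_le zero_le_one).mp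
        (intervalIntegral.intervalIntegrable_rpow' hp)).const_mul K
    refine Integrable.mono' h2 (hm.mono_set Ioc_subset_Ioi_self) ?_
    exact (ae_restrict_mem measurableSet_Ioc).mono fun s hs => h0 s hs.1
  · have h2 : IntegrableOn (fun s : ℝ => K * s ^ q) (Ioi 1) :=
      (integrableOn_Ioi_rpow_of_lt hq zero_lt_one).const_mul K
    refine Integrable.mono' h2 (hm.mono_set (Ioi_subset_Ioi zero_le_one)) ?_
    exact (ae_restrict_mem measurableSet_Ioi).mono fun s hs => h1 s (zero_lt_one.trans hs)

variable {H : Type*} [NormedAddCommGroup H] [InnerProductSpace ℂ H]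

/-- The resolvents `S s = (s + B)⁻¹`, `s ≥ 0`, of an invertible accretive operator `B`. -/
structure IsAccretiveResolvent (S : ℝ → H →L[ℂ] H) (M : ℝ) : Prop where
  identity : ∀ s t, 0 ≤ s → 0 ≤ t → S s - S t = (t - s) • (S s * S t)
  accretive : ∀ s, 0 ≤ s → ∀ x, 0 ≤ (inner ℂ (S s x) (x - s • S s x)).re
  norm_le : ∀ s, 0 ≤ s → ‖S s‖ ≤ M

namespace IsAccretiveResolvent

variable {S : ℝ → H →L[ℂ] H} {M : ℝ} (h : IsAccretiveResolvent S M)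
include h

theorem const_nonneg : 0 ≤ M := (norm_nonneg _).trans (h.norm_le 0 le_rfl)

theorem norm_apply_le {s : ℝ} (hs : 0 ≤ s) (x : H) : ‖S s x‖ ≤ M * ‖x‖ :=
  (S s).le_of_opNorm_le (h.norm_le s hs) x

theorem mul_norm_apply_le {s : ℝ} (hs : 0 ≤ s) (x : H) : s * ‖S s x‖ ≤ ‖x‖ := by
  have h1 := h.accretive s hs x
  have h2 : (inner ℂ (S s x) (x - s • S s x)).re =
      (inner ℂ (S s x) x).re - s * ‖S s x‖ ^ 2 := by
    rw [inner_sub_right, Complex.sub_re, ← Complex.coe_smul, inner_smul_right,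
      inner_self_eq_norm_sq_to_K]
    simp only [Complex.coe_algebraMap]
    norm_cast
  have h3 : (inner ℂ (S s x) x).re ≤ ‖S s x‖ * ‖x‖ := re_inner_le_norm (𝕜 := ℂ) _ _
  rcases (norm_nonneg (S s x)).eq_or_lt with h0 | h0
  · rw [← h0]; simp
  · nlinarith

theorem norm_sub_smul_le {s : ℝ} (hs : 0 ≤ s) (x : H) : ‖x - s • S s x‖ ≤ 2 * ‖x‖ := by
  refine (norm_sub_le _ _).trans ?_
  rw [norm_smul, Real.norm_of_nonneg hs]
  linarith [h.mul_norm_apply_le hs x]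

theorem norm_le_rpow {s : ℝ} (hs : 0 < s) : ‖S s‖ ≤ s ^ (-1 : ℝ) := by
  refine (S s).opNorm_le_bound (by positivity) fun x => ?_
  rw [Real.rpow_neg_one, inv_mul_eq_div, le_div_iff₀ hs, mul_comm]
  exact h.mul_norm_apply_le hs.le x

theorem continuousOn : ContinuousOn S (Ici 0) := by
  have : LipschitzOnWith (M * M).toNNReal S (Ici 0) := by
    refine LipschitzOnWith.of_dist_le_mul fun s hs t ht => ?_
    rw [dist_eq_norm, h.identity s t hs ht, norm_smul, Real.dist_eq, Real.norm_eq_abs,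
      abs_sub_comm, mul_comm, Real.coe_toNNReal _ (mul_nonneg h.const_nonneg h.const_nonneg)]
    refine mul_le_mul_of_nonneg_right ((norm_mul_le _ _).trans ?_) (abs_nonneg _)
    exact mul_le_mul (h.norm_le s hs) (h.norm_le t ht) (norm_nonneg _) h.const_nonneg
  exact this.continuousOn

theorem continuousOn_Ioi : ContinuousOn S (Ioi 0) := h.continuousOn.mono Ioi_subset_Ici_self

theorem continuousOn_apply (x : H) : ContinuousOn (fun s => S s x) (Ici 0) :=
  h.continuousOn.clm_apply continuousOn_const

theorem hasDerivAt {s : ℝ} (hs : 0 < s) : HasDerivAt S (-(S s * S s)) s := by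
  rw [hasDerivAt_iff_tendsto_slope]
  have h1 : Tendsto (fun t => -(S t * S s)) (𝓝[≠] s) (𝓝 (-(S s * S s))) := by
    have : ContinuousAt S s := h.continuousOn.continuousAt (Ici_mem_nhds hs)
    exact ((this.tendsto.mono_left nhdsWithin_le_nhds).mul_const _).neg
  refine h1.congr' ?_
  have h2 : ∀ᶠ t in 𝓝[≠] s, 0 < t := nhdsWithin_le_nhds (Ioi_mem_nhds hs)
  filter_upwards [h2, self_mem_nhdsWithin] with t ht hts
  rw [slope_def_module, h.identity t s ht.le hs.le, smul_smul]
  have : (t - s)⁻¹ * (s - t) = -1 := by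
    have : t - s ≠ 0 := sub_ne_zero.mpr hts
    field_simp
    ring
  rw [this, neg_one_smul]

theorem integrableOn_rpow_smul {γ : ℝ} (h0 : 0 < γ) (h1 : γ < 1) :
    IntegrableOn (fun s : ℝ => s ^ (-γ) • S s) (Ioi 0) := by
  refine integrableOn_Ioi_of_rpow_bounds (p := -γ) (q := -γ - 1) (K := max M 1) ?_ (by linarith)
    (by linarith) ?_ ?_
  · exact (continuousOn_id.rpow_const fun s hs => Or.inl (ne_of_gt hs)).smul h.continuousOn_Ioi
  · intro s hs
    rw [norm_smul, Real.norm_of_nonneg (by positivity), mul_comm]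
    exact mul_le_mul_of_nonneg_right ((h.norm_le s hs.le).trans (le_max_left _ _)) (by positivity)
  · intro s hs
    rw [norm_smul, Real.norm_of_nonneg (by positivity), Real.rpow_sub hs, Real.rpow_one,
      div_eq_mul_inv, ← Real.rpow_neg_one]
    have := h.norm_le_rpow hs
    calc s ^ (-γ) * ‖S s‖ ≤ s ^ (-γ) * s ^ (-1 : ℝ) :=
          mul_le_mul_of_nonneg_left this (by positivity)
      _ ≤ _ := le_mul_of_one_le_left (by positivity) (le_max_right _ _)

/-- The function `s ↦ s B (s + B)⁻² x`. -/
theorem sq_function_estimate (x : H) :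
    ∫⁻ s in Ioi (0 : ℝ), ‖s • (S s x - s • S s (S s x))‖ₑ ^ 2 * ENNReal.ofReal s⁻¹ ≤
      ‖x‖ₑ ^ 2 := by
  let _ : InnerProductSpace ℝ H := InnerProductSpace.complexToReal
  set m : ℝ → H := fun s => s • S s x with hm
  set N : ℝ → ℝ := fun s => ‖m s‖ ^ 2 with hN
  set N' : ℝ → ℝ := fun s => 2 * inner ℝ (m s) (S s x - s • S s (S s x)) with hN'
  have hmd : ∀ s, 0 < s → HasDerivAt m (S s x - s • S s (S s x)) s := by
    intro s hs
    have h1 : HasDerivAt (fun t => S t x) (-(S s (S s x))) s :=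
      ((ContinuousLinearMap.apply ℂ H x).restrictScalars ℝ).hasFDerivAt.comp_hasDerivAt s
        (h.hasDerivAt hs)
    have h2 := (hasDerivAt_id s).smul h1
    refine h2.congr_deriv ?_
    simp [sub_eq_add_neg, add_comm]
  have hd : ∀ s ∈ Ioi (0 : ℝ), HasDerivAt N (N' s) s := fun s hs => (hmd s hs).norm_sq
  -- The integrand of the square function is dominated by the derivative of `‖s S s x‖²`. That
  -- function vanishes at `0` and is bounded by `‖x‖²`, so the derivative has integral at most
  -- `‖x‖²`.
  have hlow : ∀ s ∈ Ioi (0 : ℝ), ‖s • (S s x - s • S s (S s x))‖ ^ 2 * s⁻¹ ≤ N' s := by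
    intro s hs
    have hs' : (0 : ℝ) < s := hs
    set w := s • (S s x - s • S s (S s x)) with hw
    have h1 := h.accretive s hs'.le (m s)
    have h2 : m s - s • S s (m s) = w := by
      simp only [hm, hw, ContinuousLinearMap.map_smul_of_tower, smul_sub]
    rw [h2] at h1
    have h3 : S s x - s • S s (S s x) = s⁻¹ • w := by
      rw [hw, smul_smul, inv_mul_cancel₀ hs'.ne', one_smul]
    have h4 : m s = w + s • S s (m s) := by rw [← h2]; abel
    -- Here `w = B (s + B)⁻¹ m` and `m = w + s (s + B)⁻¹ m`; the last inner product is nonnegative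
    -- because `B` is accretive.
    have h5 : inner ℝ (m s) w = ‖w‖ ^ 2 + s * (inner ℂ (S s (m s)) w).re := by
      conv_lhs => rw [h4]
      rw [inner_add_left, real_inner_self_eq_norm_sq, inner_smul_left]
      rfl
    simp only [hN', h3, inner_smul_right, h5]
    have h6 : 0 < s⁻¹ := inv_pos.mpr hs'
    have h7 : s⁻¹ * (‖w‖ ^ 2 + s * (inner ℂ (S s (m s)) w).re) =
      ‖w‖ ^ 2 * s⁻¹ + (inner ℂ (S s (m s)) w).re := by field_simp
    rw [h7]
    have : 0 ≤ ‖w‖ ^ 2 * s⁻¹ := by positivity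
    linarith
  have hnn : ∀ s ∈ Ioi (0 : ℝ), 0 ≤ N' s := fun s hs =>
    (mul_nonneg (sq_nonneg _) (inv_nonneg.mpr (le_of_lt hs))).trans (hlow s hs)
  have hcm : ContinuousOn N (Ici 0) := by
    have := h.continuousOn_apply x
    exact ((continuousOn_id.smul this).norm).pow 2
  have hmono : MonotoneOn N (Ici 0) := by
    refine monotoneOn_of_deriv_nonneg (convex_Ici 0) hcm ?_ ?_
    · rw [interior_Ici]
      exact fun s hs => (hd s hs).differentiableAt.differentiableWithinAt
    · rw [interior_Ici]
      intro s hs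
      rw [(hd s hs).deriv]
      exact hnn s hs
  have hle : ∀ s, 0 ≤ s → N s ≤ ‖x‖ ^ 2 := by
    intro s hs
    have := h.mul_norm_apply_le hs x
    simp only [hN, hm, norm_smul, Real.norm_of_nonneg hs]
    gcongr
  obtain ⟨l, hl⟩ : ∃ l, Tendsto N atTop (𝓝 l) := by
    have h1 : Monotone fun s => N (max s 0) := fun s t hst =>
      hmono (mem_Ici.mpr (le_max_right _ _)) (mem_Ici.mpr (le_max_right _ _)) (max_le_max_right 0 hst)
    refine ⟨_, (tendsto_atTop_ciSup h1 ⟨‖x‖ ^ 2, ?_⟩).congr' ?_⟩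
    · rintro _ ⟨s, rfl⟩
      exact hle _ (le_max_right _ _)
    · filter_upwards [eventually_ge_atTop 0] with s hs
      rw [max_eq_left hs]
  have hl' : l ≤ ‖x‖ ^ 2 := le_of_tendsto hl ((eventually_ge_atTop 0).mono hle)
  have hc0 : ContinuousWithinAt N (Ici 0) 0 := hcm 0 self_mem_Ici
  have hint := integrableOn_Ioi_deriv_of_nonneg hc0 hd hnn hl
  have hval := integral_Ioi_of_hasDerivAt_of_nonneg hc0 hd hnn hl
  have hN0 : N 0 = 0 := by simp [hN, hm]
  calc ∫⁻ s in Ioi (0 : ℝ), ‖s • (S s x - s • S s (S s x))‖ₑ ^ 2 * ENNReal.ofReal s⁻¹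
      ≤ ∫⁻ s in Ioi (0 : ℝ), ENNReal.ofReal (N' s) := by
        refine setLIntegral_mono' measurableSet_Ioi fun s hs => ?_
        rw [← ofReal_norm, ← ENNReal.ofReal_pow (norm_nonneg _),
          ← ENNReal.ofReal_mul (by positivity)]
        exact ENNReal.ofReal_le_ofReal (hlow s hs)
    _ = ENNReal.ofReal (∫ s in Ioi (0 : ℝ), N' s) :=
        (ofReal_integral_eq_lintegral_ofReal hint
          ((ae_restrict_mem measurableSet_Ioi).mono hnn)).symm
    _ ≤ ENNReal.ofReal (‖x‖ ^ 2) := by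
        rw [hval, hN0, sub_zero]; exact ENNReal.ofReal_le_ofReal hl'
    _ = ‖x‖ₑ ^ 2 := by rw [ENNReal.ofReal_pow (norm_nonneg _), ofReal_norm]

variable [CompleteSpace H]

/-- Two integrations by parts. The new integrand is `s^(-γ) S s` composed with `s (S s - s S s²) = s
B (s + B)⁻²`, the operator controlled by the square function estimate. The original integrand lacks
such a factor. -/
theorem integral_rpow_smul {γ : ℝ} (h0 : 0 < γ) (h1 : γ < 1) :
    IntegrableOn (fun s : ℝ => s ^ (1 - γ) • (S s * (S s - s • (S s * S s)))) (Ioi 0) ∧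
    ∫ s in Ioi (0 : ℝ), s ^ (-γ) • S s = (2 / (γ * (1 - γ))) •
      ∫ s in Ioi (0 : ℝ), s ^ (1 - γ) • (S s * (S s - s • (S s * S s))) := by
  -- `F` below is a primitive of the difference of the two integrands. The coefficient `α`
  -- reproduces `s^(-γ) S s`, and the relation `α = -γ β` makes the remaining terms in `S²` and `S³`
  -- combine to `2 β s^(1-γ) S (S - s S²)`. `F` vanishes at both ends.
  set β : ℝ := -1 / (γ * (1 - γ)) with hβ
  set α : ℝ := 1 / (1 - γ) with hα
  have hγ1 : 1 - γ ≠ 0 := by linarith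
  set F : ℝ → H →L[ℂ] H := fun s => (α * s ^ (1 - γ)) • S s + (β * s ^ (2 - γ)) • (S s * S s)
  set G : ℝ → H →L[ℂ] H := fun s => s ^ (1 - γ) • (S s * (S s - s • (S s * S s)))
  have hK : 2 / (γ * (1 - γ)) = -(2 * β) := by rw [hβ]; ring
  have hcG : ContinuousOn G (Ioi 0) := by
    have hc := h.continuousOn_Ioi
    exact (continuousOn_id.rpow_const fun s hs => Or.inl (ne_of_gt hs)).smul
      (hc.mul (hc.sub (continuousOn_id.smul (hc.mul hc))))
  have hnb : ∀ s, 0 < s → ‖S s - s • (S s * S s)‖ ≤ 2 * ‖S s‖ := by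
    intro s hs
    refine (norm_sub_le _ _).trans ?_
    rw [norm_smul, Real.norm_of_nonneg hs.le]
    have h2 := norm_mul_le (S s) (S s)
    have h3 := h.norm_le_rpow hs
    rw [Real.rpow_neg_one] at h3
    have h4 : s * ‖S s‖ ≤ 1 := by
      calc s * ‖S s‖ ≤ s * s⁻¹ := mul_le_mul_of_nonneg_left h3 hs.le
        _ = 1 := mul_inv_cancel₀ hs.ne'
    nlinarith [norm_nonneg (S s)]
  have hGn : ∀ s, 0 < s → ‖G s‖ ≤ 2 * (s ^ (1 - γ) * (‖S s‖ * ‖S s‖)) := by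
    intro s hs
    simp only [G]
    rw [norm_smul, Real.norm_of_nonneg (by positivity)]
    have := (norm_mul_le (S s) (S s - s • (S s * S s))).trans
      (mul_le_mul_of_nonneg_left (hnb s hs) (norm_nonneg _))
    calc _ ≤ s ^ (1 - γ) * (‖S s‖ * (2 * ‖S s‖)) :=
          mul_le_mul_of_nonneg_left this (by positivity)
      _ = _ := by ring
  have hG : IntegrableOn G (Ioi 0) := by
    refine integrableOn_Ioi_of_rpow_bounds (p := 1 - γ) (q := 1 - γ - 1 - 1)
      (K := 2 * max (M * M) 1) hcG (by linarith) (by linarith) ?_ ?_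
    · intro s hs
      refine (hGn s hs).trans ?_
      rw [mul_assoc, mul_comm (max _ _)]
      gcongr
      refine le_trans ?_ (le_max_left _ _)
      exact mul_le_mul (h.norm_le s hs.le) (h.norm_le s hs.le) (norm_nonneg _) h.const_nonneg
    · intro s hs
      refine (hGn s hs).trans ?_
      have h2 : s ^ (1 - γ - 1 - 1) = s ^ (1 - γ) * (s ^ (-1 : ℝ) * s ^ (-1 : ℝ)) := by
        rw [← Real.rpow_add hs, ← Real.rpow_add hs]; ring_nf
      rw [mul_assoc, h2]
      have h3 := h.norm_le_rpow hs
      have h4 : s ^ (1 - γ) * (‖S s‖ * ‖S s‖) ≤ s ^ (1 - γ) * (s ^ (-1 : ℝ) * s ^ (-1 : ℝ)) := by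
        gcongr
      have h5 := le_mul_of_one_le_left (by positivity :
        0 ≤ s ^ (1 - γ) * (s ^ (-1 : ℝ) * s ^ (-1 : ℝ))) (le_max_right (M * M) 1)
      linarith
  have hI := h.integrableOn_rpow_smul h0 h1
  refine ⟨hG, ?_⟩
  have hF : ∀ s ∈ Ioi (0 : ℝ), HasDerivAt F (s ^ (-γ) • S s - (2 / (γ * (1 - γ))) • G s) s := by
    intro s hs
    have hs' : (0 : ℝ) < s := hs
    have e1 : HasDerivAt (fun s : ℝ => α * s ^ (1 - γ)) (s ^ (-γ)) s := by
      have := (Real.hasDerivAt_rpow_const (p := 1 - γ) (Or.inl hs'.ne')).const_mul α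
      refine this.congr_deriv ?_
      rw [hα]
      have : 1 - γ - 1 = -γ := by ring
      rw [this]
      field_simp
    have e2 : HasDerivAt (fun s : ℝ => β * s ^ (2 - γ)) (β * (2 - γ) * s ^ (1 - γ)) s := by
      have := (Real.hasDerivAt_rpow_const (p := 2 - γ) (Or.inl hs'.ne')).const_mul β
      refine this.congr_deriv ?_
      have : 2 - γ - 1 = 1 - γ := by ring
      rw [this]
      ring
    have e3 := h.hasDerivAt hs'
    have e4 := (e1.smul e3).add (e2.smul (e3.mul e3))
    refine e4.congr_deriv ?_
    have h6 : s ^ (2 - γ) = s * s ^ (1 - γ) := by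
      rw [show (2 - γ) = 1 + (1 - γ) by ring, Real.rpow_add hs', Real.rpow_one]
    simp only [G, hK]
    rw [h6]
    simp only [mul_sub, smul_sub, mul_smul_comm, neg_mul, mul_neg, smul_neg, smul_add, ← mul_assoc,
      smul_smul]
    have hα' : α = -(γ * β) := by rw [hα, hβ]; field_simp
    rw [hα']
    module
  have hc0 : ContinuousWithinAt F (Ici 0) 0 := by
    have hc := h.continuousOn 0 self_mem_Ici
    have r : ∀ p : ℝ, 0 ≤ p → ContinuousWithinAt (fun s : ℝ => s ^ p) (Ici 0) 0 := fun p hp =>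
      (Real.continuousAt_rpow_const 0 p (Or.inr hp)).continuousWithinAt
    exact ((continuousWithinAt_const.mul (r _ (by linarith))).smul hc).add
      ((continuousWithinAt_const.mul (r _ (by linarith))).smul (hc.mul hc))
  have hlim : Tendsto F atTop (𝓝 0) := by
    have h2 : Tendsto (fun s : ℝ => (|α| + |β|) * s ^ (-γ)) atTop (𝓝 0) := by
      have := (tendsto_rpow_neg_atTop h0).const_mul (|α| + |β|)
      simpa using this
    refine squeeze_zero_norm' ?_ h2
    filter_upwards [eventually_gt_atTop 0] with s hs
    refine (norm_add_le _ _).trans ?_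
    have h3 := h.norm_le_rpow hs
    have h4 : s ^ (1 - γ) * s ^ (-1 : ℝ) = s ^ (-γ) := by rw [← Real.rpow_add hs]; ring_nf
    have h5 : s ^ (2 - γ) * (s ^ (-1 : ℝ) * s ^ (-1 : ℝ)) = s ^ (-γ) := by
      rw [← Real.rpow_add hs, ← Real.rpow_add hs]; ring_nf
    have h6 : ‖S s * S s‖ ≤ s ^ (-1 : ℝ) * s ^ (-1 : ℝ) :=
      (norm_mul_le _ _).trans (by gcongr)
    rw [norm_smul, norm_smul, norm_mul, norm_mul, Real.norm_eq_abs α, Real.norm_eq_abs β,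
      Real.norm_of_nonneg (by positivity : 0 ≤ s ^ (1 - γ)),
      Real.norm_of_nonneg (by positivity : 0 ≤ s ^ (2 - γ)), add_mul, mul_assoc, mul_assoc]
    refine add_le_add ?_ ?_
    · rw [← h4]; gcongr
    · rw [← h5]; gcongr
  have hGs : IntegrableOn (fun s => (2 / (γ * (1 - γ))) • G s) (Ioi 0) :=
    Integrable.smul (2 / (γ * (1 - γ))) hG
  have hfin := integral_Ioi_of_hasDerivAt_of_tendsto hc0 hF (hI.sub hGs) hlim
  have hF0 : F 0 = 0 := by
    simp only [F]
    rw [Real.zero_rpow hγ1, Real.zero_rpow (by linarith)]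
    simp
  rw [hF0, sub_zero, integral_sub hI hGs, integral_smul] at hfin
  exact sub_eq_zero.mp hfin

end IsAccretiveResolvent

end ResolventCalculus

/-! ### The square of `A^(-1/2)` -/

section SquareRoot

variable {H : Type*} [NormedAddCommGroup H] [InnerProductSpace ℂ H] [CompleteSpace H]

namespace IsAccretiveResolvent

variable {S : ℝ → H →L[ℂ] H} {M : ℝ} (h : IsAccretiveResolvent S M)
include h

omit [CompleteSpace H] in
theorem identity_apply {s t : ℝ} (hs : 0 ≤ s) (ht : 0 ≤ t) (x : H) :
    S s x - S t x = (t - s) • S s (S t x) := by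
  have := DFunLike.congr_fun (h.identity s t hs ht) x
  simpa using this

omit [CompleteSpace H] in
theorem smul_apply_zero {s : ℝ} (hs : 0 ≤ s) (x : H) : s • S s (S 0 x) = S 0 x - S s x := by
  have := h.identity_apply hs le_rfl x
  rw [zero_sub, neg_smul] at this
  rw [← neg_sub, this, neg_neg]

omit [CompleteSpace H] in
theorem continuousOn_comp_mul {τ : ℝ} (hτ : 0 < τ) (x : H) :
    ContinuousOn (fun s => S (τ * s) x) (Ioi 0) :=
  (h.continuousOn_apply x).comp (continuousOn_const.mul continuousOn_id)
    fun _ hs => mul_nonneg hτ.le (le_of_lt hs)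

omit [CompleteSpace H] in
theorem integrableOn_mul_dilation {τ : ℝ} (hτ : 0 < τ) (x : H) :
    IntegrableOn (fun s => S s (S (τ * s) x)) (Ioi 0) := by
  refine integrableOn_Ioi_of_rpow_bounds (p := 0) (q := -2) (K := max (M * (M * ‖x‖)) (τ⁻¹ * ‖x‖))
    (h.continuousOn_Ioi.clm_apply (h.continuousOn_comp_mul hτ x)) (by norm_num) (by norm_num) ?_ ?_
  · intro s hs
    rw [Real.rpow_zero, mul_one]
    refine le_trans ?_ (le_max_left _ _)
    exact (h.norm_apply_le hs.le _).trans
      (mul_le_mul_of_nonneg_left (h.norm_apply_le (by positivity) x) h.const_nonneg)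
  · intro s hs
    have h1 := h.mul_norm_apply_le hs.le (S (τ * s) x)
    have h2 := h.mul_norm_apply_le (by positivity : 0 ≤ τ * s) x
    have e : s ^ (-2 : ℝ) = s⁻¹ * s⁻¹ := by
      rw [show (-2 : ℝ) = -1 + -1 by norm_num, Real.rpow_add hs, Real.rpow_neg_one]
    have h3 : ‖S s (S (τ * s) x)‖ ≤ τ⁻¹ * ‖x‖ * s ^ (-2 : ℝ) := by
      calc _ ≤ s⁻¹ * ‖S (τ * s) x‖ := by rwa [inv_mul_eq_div, le_div_iff₀ hs, mul_comm]
        _ ≤ s⁻¹ * ((τ * s)⁻¹ * ‖x‖) := by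
          gcongr
          rwa [inv_mul_eq_div, le_div_iff₀ (by positivity), mul_comm]
        _ = _ := by rw [e, mul_inv]; ring
    exact h3.trans (mul_le_mul_of_nonneg_right (le_max_right _ _) (by positivity))

-- Each of the two terms behaves like `s⁻¹ S 0 x` at infinity and is not integrable there in
-- general. The difference is `O(s⁻²)`, because `s S s (S 0 x) = S 0 x - S s x`.
omit [CompleteSpace H] in
theorem integrableOn_sub_inv (x : H) :
    IntegrableOn (fun s => S s (S 0 x) - (1 + s)⁻¹ • S 0 x) (Ioi 0) := by
  set y := S 0 x with hy
  refine integrableOn_Ioi_of_rpow_bounds (p := 0) (q := -2)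
    (K := max (M * ‖y‖ + ‖y‖) (‖y‖ + ‖x‖)) ?_ (by norm_num) (by norm_num) ?_ ?_
  · have h1 : ContinuousOn (fun s : ℝ => (1 + s)⁻¹) (Ioi 0) := by
      refine ContinuousOn.inv₀ (f := fun s : ℝ => 1 + s) (by fun_prop) fun s hs => ?_
      have : (0 : ℝ) < s := hs
      positivity
    exact ((h.continuousOn_apply y).mono Ioi_subset_Ici_self).sub (h1.smul continuousOn_const)
  · intro s hs
    rw [Real.rpow_zero, mul_one]
    refine ((norm_sub_le _ _).trans (add_le_add (h.norm_apply_le hs.le y) ?_)).trans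
      (le_max_left _ _)
    rw [norm_smul, Real.norm_of_nonneg (by positivity)]
    exact mul_le_of_le_one_left (norm_nonneg _) (inv_le_one_of_one_le₀ (by linarith))
  · intro s hs
    have e : s ^ (-2 : ℝ) = s⁻¹ * s⁻¹ := by
      rw [show (-2 : ℝ) = -1 + -1 by norm_num, Real.rpow_add hs, Real.rpow_neg_one]
    have h1 : S s y = s⁻¹ • (y - S s x) := by
      rw [← h.smul_apply_zero hs.le x, smul_smul, inv_mul_cancel₀ hs.ne', one_smul]
    have h2 : S s y - (1 + s)⁻¹ • y = (s⁻¹ * (1 + s)⁻¹) • y - s⁻¹ • S s x := by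
      rw [h1, smul_sub]
      have : s⁻¹ * (1 + s)⁻¹ = s⁻¹ - (1 + s)⁻¹ := by
        have : 1 + s ≠ 0 := by positivity
        field_simp
        ring
      rw [this, sub_smul]
      abel
    have h3 : ‖S s x‖ ≤ s⁻¹ * ‖x‖ := by
      rw [inv_mul_eq_div, le_div_iff₀ hs, mul_comm]; exact h.mul_norm_apply_le hs.le x
    have h4 : (1 + s)⁻¹ ≤ s⁻¹ := by gcongr; linarith
    rw [h2]
    refine le_trans (b := (‖y‖ + ‖x‖) * s ^ (-2 : ℝ)) ?_
      (mul_le_mul_of_nonneg_right (le_max_right _ _) (by positivity))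
    refine (norm_sub_le _ _).trans ?_
    rw [norm_smul, norm_smul, Real.norm_of_nonneg (by positivity),
      Real.norm_of_nonneg (by positivity), e, add_mul]
    refine add_le_add ?_ ?_
    · rw [mul_comm ‖y‖]; gcongr
    · calc s⁻¹ * ‖S s x‖ ≤ s⁻¹ * (s⁻¹ * ‖x‖) := by gcongr
        _ = _ := by ring

/-- A Frullani integral: `∫₀^∞ (s + B)⁻¹ (τ s + B)⁻¹ ds` is a scalar multiple of `B⁻¹`. -/
theorem exists_integral_mul_dilation {τ : ℝ} (hτ : 0 < τ) (hτ1 : τ ≠ 1) :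
    ∃ k : ℝ, ∀ x, ∫ s in Ioi (0 : ℝ), S s (S (τ * s) x) = k • S 0 x := by
  refine ⟨(τ - 1)⁻¹ * ∫ s in Ioi (0 : ℝ), (τ * (1 + τ * s)⁻¹ - (1 + s)⁻¹), fun x => ?_⟩
  set y := S 0 x with hy
  set N : ℝ → H := fun s => S s y - (1 + s)⁻¹ • y with hN
  have hNi : IntegrableOn N (Ioi 0) := h.integrableOn_sub_inv x
  have hNτ : IntegrableOn (fun s => τ • N (τ * s)) (Ioi 0) := by
    have := (integrableOn_Ioi_comp_mul_left_iff N 0 hτ).mpr (by rwa [mul_zero])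
    exact Integrable.smul τ this
  have hL : IntegrableOn (fun s => (τ - 1) • S s (S (τ * s) x)) (Ioi 0) :=
    Integrable.smul (τ - 1) (h.integrableOn_mul_dilation hτ x)
  have key : ∀ s ∈ Ioi (0 : ℝ), (τ - 1) • S s (S (τ * s) x) =
      (τ • N (τ * s) - N s) + (τ * (1 + τ * s)⁻¹ - (1 + s)⁻¹) • y := by
    intro s hs
    have hs' : (0 : ℝ) < s := hs
    have h1 := h.identity_apply hs'.le (by positivity : 0 ≤ τ * s) x
    have h2 := h.smul_apply_zero hs'.le x
    have h3 := h.smul_apply_zero (by positivity : 0 ≤ τ * s) x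
    rw [← hy] at h2 h3
    -- The resolvent identity turns the product into a difference of resolvents. Expressing both
    -- through `y = S 0 x` makes the factor `s` cancel and leaves `τ S (τ s) y - S s y`, an
    -- integrand of Frullani type.
    have h4 : s • ((τ - 1) • S s (S (τ * s) x)) = s • (τ • S (τ * s) y - S s y) := by
      rw [smul_smul, show s * (τ - 1) = τ * s - s by ring, ← h1, smul_sub, smul_smul,
        mul_comm s τ, h2, h3]
      abel
    have h5 := smul_right_injective H hs'.ne' h4
    refine h5.trans ?_
    simp only [hN]
    module
  have e1 : ∫ s in Ioi (0 : ℝ), (τ - 1) • S s (S (τ * s) x) =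
      ∫ s in Ioi (0 : ℝ), ((τ • N (τ * s) - N s) + (τ * (1 + τ * s)⁻¹ - (1 + s)⁻¹) • y) :=
    setIntegral_congr_fun measurableSet_Ioi key
  have hd : IntegrableOn (fun s => τ • N (τ * s) - N s) (Ioi 0) := hNτ.sub hNi
  -- The scalar remainder is integrable because it is the difference of two integrable functions.
  -- Its integral is never evaluated.
  have hr : IntegrableOn (fun s => (τ * (1 + τ * s)⁻¹ - (1 + s)⁻¹) • y) (Ioi 0) := by
    refine IntegrableOn.congr_fun (hL.sub hd) (fun s hs => ?_) measurableSet_Ioi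
    simp only [Pi.sub_apply]
    rw [key s hs]; abel
  rw [integral_add hd hr, integral_sub hNτ hNi, integral_smul_const, integral_smul,
    integral_smul, integral_comp_mul_left_Ioi N 0 hτ, mul_zero, smul_smul,
    mul_inv_cancel₀ hτ.ne', one_smul, sub_self, zero_add] at e1
  have h6 : τ - 1 ≠ 0 := sub_ne_zero.mpr hτ1
  rw [← smul_smul, ← e1, smul_smul, inv_mul_cancel₀ h6, one_smul]

-- This justifies Fubini's theorem for the square of `∫ s^(-1/2) S s ds` after the substitution `t =
-- τ s` in the inner integral. The `τ`-integral of the norm is at most a constant times `‖s^(-1/2) S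
-- s‖`, which is integrable in `s`.
omit [CompleteSpace H] in
theorem integrable_prod_dilation (x : H) :
    Integrable (fun z : ℝ × ℝ => z.2 ^ (-(1 / 2) : ℝ) • S z.1 (S (z.2 * z.1) x))
      ((volume.restrict (Ioi 0)).prod (volume.restrict (Ioi 0))) := by
  have hI := h.integrableOn_rpow_smul (γ := 1 / 2) (by norm_num) (by norm_num)
  set g : ℝ → H := fun t => t ^ (-(1 / 2) : ℝ) • S t x with hgdef
  have hg : IntegrableOn g (Ioi 0) := Integrable.apply_continuousLinearMap hI x
  set K := ∫ t in Ioi (0 : ℝ), ‖g t‖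
  have hm : AEStronglyMeasurable
      (fun z : ℝ × ℝ => z.2 ^ (-(1 / 2) : ℝ) • S z.1 (S (z.2 * z.1) x))
      ((volume.restrict (Ioi 0)).prod (volume.restrict (Ioi 0))) := by
    rw [Measure.prod_restrict]
    have h1 : ContinuousOn (fun z : ℝ × ℝ => z.2 ^ (-(1 / 2) : ℝ)) (Ioi 0 ×ˢ Ioi 0) :=
      continuousOn_snd.rpow_const fun z hz => Or.inl (ne_of_gt hz.2)
    have h2 : ContinuousOn (fun z : ℝ × ℝ => S z.1) (Ioi 0 ×ˢ Ioi 0) :=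
      h.continuousOn.comp continuousOn_fst fun z hz => mem_Ici.mpr (le_of_lt hz.1)
    have h3 : ContinuousOn (fun z : ℝ × ℝ => S (z.2 * z.1) x) (Ioi 0 ×ˢ Ioi 0) :=
      (h.continuousOn_apply x).comp (by fun_prop)
        fun z hz => mem_Ici.mpr (mul_nonneg (le_of_lt hz.2) (le_of_lt hz.1))
    exact (h1.smul (h2.clm_apply h3)).aestronglyMeasurable
      (measurableSet_Ioi.prod measurableSet_Ioi)
  have key : ∀ s ∈ Ioi (0 : ℝ), ∀ τ ∈ Ioi (0 : ℝ), τ ^ (-(1 / 2) : ℝ) • S s (S (τ * s) x) =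
      s ^ (1 / 2 : ℝ) • S s (g (s * τ)) := by
    intro s hs τ hτ
    have hs' : (0 : ℝ) < s := hs
    have hτ' : (0 : ℝ) < τ := hτ
    rw [hgdef]
    simp only
    rw [ContinuousLinearMap.map_smul_of_tower, smul_smul, Real.mul_rpow hs'.le hτ'.le, ← mul_assoc,
      ← Real.rpow_add hs', mul_comm s τ]
    norm_num
  have hgs : ∀ s ∈ Ioi (0 : ℝ), IntegrableOn (fun τ => g (s * τ)) (Ioi 0) := fun s hs =>
    (integrableOn_Ioi_comp_mul_left_iff g 0 hs).mpr (by rwa [mul_zero])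
  have hgs' : ∀ s ∈ Ioi (0 : ℝ), IntegrableOn (fun τ => s ^ (1 / 2 : ℝ) • S s (g (s * τ)))
      (Ioi 0) := fun s hs =>
    Integrable.smul (s ^ (1 / 2 : ℝ)) ((S s).integrable_comp (hgs s hs))
  rw [integrable_prod_iff hm]
  constructor
  · filter_upwards [ae_restrict_mem measurableSet_Ioi] with s hs
    exact IntegrableOn.congr_fun (hgs' s hs) (fun τ hτ => (key s hs τ hτ).symm) measurableSet_Ioi
  · refine Integrable.mono' (hI.norm.mul_const K) hm.norm.integral_prod_right' ?_
    filter_upwards [ae_restrict_mem measurableSet_Ioi] with s hs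
    have hs' : (0 : ℝ) < s := hs
    rw [Real.norm_of_nonneg (integral_nonneg fun _ => norm_nonneg _)]
    calc ∫ τ in Ioi (0 : ℝ), ‖τ ^ (-(1 / 2) : ℝ) • S s (S (τ * s) x)‖
        = ∫ τ in Ioi (0 : ℝ), ‖s ^ (1 / 2 : ℝ) • S s (g (s * τ))‖ :=
          setIntegral_congr_fun measurableSet_Ioi fun τ hτ =>
            congrArg norm (key s hs τ hτ)
      _ ≤ ∫ τ in Ioi (0 : ℝ), s ^ (1 / 2 : ℝ) * ‖S s‖ * ‖g (s * τ)‖ := by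
          refine integral_mono (hgs' s hs).norm ((hgs s hs).norm.const_mul _) fun τ => ?_
          simp only
          rw [norm_smul, Real.norm_of_nonneg (by positivity), mul_assoc]
          exact mul_le_mul_of_nonneg_left ((S s).le_opNorm _) (by positivity)
      _ = ‖s ^ (-(1 / 2) : ℝ) • S s‖ * K := by
          rw [integral_const_mul, integral_comp_mul_left_Ioi (fun t => ‖g t‖) 0 hs', mul_zero,
            norm_smul, Real.norm_of_nonneg (by positivity), smul_eq_mul,
            show (-(1 / 2) : ℝ) = 1 / 2 + -1 by norm_num, Real.rpow_add hs', Real.rpow_neg_one]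
          ring

/-- The square of `∫₀^∞ s^(-1/2) (s + B)⁻¹ ds` is a multiple of `B⁻¹`. -/
theorem exists_sq_integral_eq : ∃ κ : ℝ, ∀ x,
    (∫ s in Ioi (0 : ℝ), s ^ (-(1 / 2) : ℝ) • S s)
      ((∫ s in Ioi (0 : ℝ), s ^ (-(1 / 2) : ℝ) • S s) x) = κ • S 0 x := by
  have hk : ∀ τ : ℝ, ∃ k : ℝ, 0 < τ → τ ≠ 1 →
      ∀ x, ∫ s in Ioi (0 : ℝ), S s (S (τ * s) x) = k • S 0 x := by
    intro τ
    by_cases h1 : 0 < τ ∧ τ ≠ 1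
    · obtain ⟨k, hk⟩ := h.exists_integral_mul_dilation h1.1 h1.2
      exact ⟨k, fun _ _ => hk⟩
    · exact ⟨0, fun h2 h3 => absurd ⟨h2, h3⟩ h1⟩
  choose k hk using hk
  refine ⟨∫ τ in Ioi (0 : ℝ), τ ^ (-(1 / 2) : ℝ) * k τ, fun x => ?_⟩
  have hI := h.integrableOn_rpow_smul (γ := 1 / 2) (by norm_num) (by norm_num)
  have happ : ∀ y, (∫ s in Ioi (0 : ℝ), s ^ (-(1 / 2) : ℝ) • S s) y =
      ∫ s in Ioi (0 : ℝ), s ^ (-(1 / 2) : ℝ) • S s y := fun y =>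
    ContinuousLinearMap.integral_apply hI y
  have hIx : IntegrableOn (fun t : ℝ => t ^ (-(1 / 2) : ℝ) • S t x) (Ioi 0) :=
    Integrable.apply_continuousLinearMap hI x
  rw [happ, happ x]
  calc ∫ s in Ioi (0 : ℝ), s ^ (-(1 / 2) : ℝ) • S s
        (∫ t in Ioi (0 : ℝ), t ^ (-(1 / 2) : ℝ) • S t x)
      = ∫ s in Ioi (0 : ℝ), ∫ τ in Ioi (0 : ℝ), τ ^ (-(1 / 2) : ℝ) • S s (S (τ * s) x) := by
        refine setIntegral_congr_fun measurableSet_Ioi fun s hs => ?_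
        have hs' : (0 : ℝ) < s := hs
        rw [← ContinuousLinearMap.integral_comp_comm (S s) hIx, ← integral_smul]
        -- Substitution `t = s τ`: the Jacobian `s` cancels the two factors `s^(-1/2)`, so that only
        -- `τ^(-1/2)` survives.
        have e := integral_comp_mul_left_Ioi
          (fun t : ℝ => s ^ (-(1 / 2) : ℝ) • S s (t ^ (-(1 / 2) : ℝ) • S t x)) 0 hs'
        rw [mul_zero] at e
        have e' : ∀ z w : H, z = s⁻¹ • w → w = s • z := by
          intro z w hzw
          rw [hzw, smul_smul, mul_inv_cancel₀ hs'.ne', one_smul]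
        rw [e' _ _ e, ← integral_smul]
        refine setIntegral_congr_fun measurableSet_Ioi fun τ hτ => ?_
        have hτ' : (0 : ℝ) < τ := hτ
        rw [ContinuousLinearMap.map_smul_of_tower, smul_smul, smul_smul,
          Real.mul_rpow hs'.le hτ'.le, mul_comm s τ]
        congr 1
        have : s * (s ^ (-(1 / 2) : ℝ) * s ^ (-(1 / 2) : ℝ)) = 1 := by
          rw [← Real.rpow_add hs']
          norm_num
          rw [Real.rpow_neg_one, mul_inv_cancel₀ hs'.ne']
        linear_combination τ ^ (-(1 / 2) : ℝ) * this
    _ = ∫ τ in Ioi (0 : ℝ), ∫ s in Ioi (0 : ℝ), τ ^ (-(1 / 2) : ℝ) • S s (S (τ * s) x) :=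
        integral_integral_swap (h.integrable_prod_dilation x)
    _ = ∫ τ in Ioi (0 : ℝ), (τ ^ (-(1 / 2) : ℝ) * k τ) • S 0 x := by
        refine integral_congr_ae ?_
        -- The Frullani evaluation excludes `τ = 1`, which is a null set.
        have h1 : ∀ᵐ τ ∂(volume.restrict (Ioi (0 : ℝ))), τ ≠ 1 :=
          ae_restrict_of_ae (Measure.ae_ne volume 1)
        filter_upwards [ae_restrict_mem measurableSet_Ioi, h1] with τ hτ hτ1
        rw [integral_smul, hk τ hτ hτ1, smul_smul]
    _ = _ := integral_smul_const _ _

end IsAccretiveResolvent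

end SquareRoot

/-! ### Negative fractional powers and the Kato property -/

section NegativePowers

variable {H : Type*} [NormedAddCommGroup H] [InnerProductSpace ℂ H] [CompleteSpace H]

namespace IsAccretiveResolvent

variable {S : ℝ → H →L[ℂ] H} {M : ℝ} (h : IsAccretiveResolvent S M)
include h

theorem enorm_inner_integral_le {γ : ℝ} (h0 : 0 < γ) (h1 : γ < 1) (x y : H) :
    ‖inner ℂ y ((∫ s in Ioi (0 : ℝ), s ^ (-γ) • S s) x)‖ₑ ≤
      ∫⁻ s in Ioi (0 : ℝ), ENNReal.ofReal (s ^ (-γ)) * ‖inner ℂ y (S s x)‖ₑ := by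
  have hI := h.integrableOn_rpow_smul h0 h1
  have hIx : IntegrableOn (fun s : ℝ => s ^ (-γ) • S s x) (Ioi 0) :=
    Integrable.apply_continuousLinearMap hI x
  have e : (∫ s in Ioi (0 : ℝ), s ^ (-γ) • S s) x = ∫ s in Ioi (0 : ℝ), s ^ (-γ) • S s x :=
    ContinuousLinearMap.integral_apply hI x
  rw [e, ← integral_inner hIx]
  refine (enorm_integral_le_lintegral_enorm _).trans (setLIntegral_mono' measurableSet_Ioi ?_)
  intro s hs
  have hs' : (0 : ℝ) < s := hs
  rw [← Complex.coe_smul, inner_smul_right, enorm_mul,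
    ← ofReal_norm (((s ^ (-γ) : ℝ)) : ℂ), Complex.norm_real, Real.norm_of_nonneg (by positivity)]

/-- Compared with the previous bound, the resolvent now acts on `s B (s + B)⁻² x` in place of `x`.
This gain of square integrability with respect to `ds/s` is what the interpolation argument
consumes. -/
theorem enorm_inner_integral_le' {γ : ℝ} (h0 : 0 < γ) (h1 : γ < 1) (x y : H) :
    ‖inner ℂ y ((∫ s in Ioi (0 : ℝ), s ^ (-γ) • S s) x)‖ₑ ≤
      ENNReal.ofReal (2 / (γ * (1 - γ))) * ∫⁻ s in Ioi (0 : ℝ), ENNReal.ofReal (s ^ (-γ)) *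
        ‖inner ℂ y (S s (s • (S s x - s • S s (S s x))))‖ₑ := by
  obtain ⟨hG, hrep⟩ := h.integral_rpow_smul h0 h1
  have hc : 0 < 2 / (γ * (1 - γ)) := by
    have : 0 < 1 - γ := by linarith
    positivity
  have e : (∫ s in Ioi (0 : ℝ), s ^ (1 - γ) • (S s * (S s - s • (S s * S s)))) x =
      ∫ s in Ioi (0 : ℝ), (s ^ (1 - γ) • (S s * (S s - s • (S s * S s)))) x :=
    ContinuousLinearMap.integral_apply hG x
  have hGx : IntegrableOn (fun s : ℝ => (s ^ (1 - γ) • (S s * (S s - s • (S s * S s)))) x)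
    (Ioi 0) := Integrable.apply_continuousLinearMap hG x
  rw [hrep, _root_.smul_apply, ← Complex.coe_smul, inner_smul_right, enorm_mul,
    ← ofReal_norm ((2 / (γ * (1 - γ)) : ℝ) : ℂ), Complex.norm_real, Real.norm_of_nonneg hc.le]
  gcongr
  rw [e, ← integral_inner hGx]
  refine (enorm_integral_le_lintegral_enorm _).trans (setLIntegral_mono' measurableSet_Ioi ?_)
  intro s hs
  have hs' : (0 : ℝ) < s := hs
  have e2 : (s ^ (1 - γ) • (S s * (S s - s • (S s * S s)))) x =
      s ^ (-γ) • S s (s • (S s x - s • S s (S s x))) := by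
    simp only [_root_.smul_apply,
      ContinuousLinearMap.map_smul_of_tower, smul_smul]
    congr 1
    rw [show 1 - γ = -γ + 1 by ring, Real.rpow_add hs', Real.rpow_one]
  rw [e2, ← Complex.coe_smul, inner_smul_right, enorm_mul,
    ← ofReal_norm (((s ^ (-γ) : ℝ)) : ℂ), Complex.norm_real, Real.norm_of_nonneg (by positivity)]

end IsAccretiveResolvent

omit [CompleteSpace H] in
theorem negPow_zero (A : H →ₗ.[ℂ] H) : negPow A 0 = ContinuousLinearMap.id ℂ H := if_pos rfl

omit [CompleteSpace H] in
theorem negPow_eq {A : H →ₗ.[ℂ] H} {S : ℝ → H →L[ℂ] H} (hS : ∀ s, 0 < s → shiftInverse A s = S s)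
    {γ : ℝ} (h0 : γ ≠ 0) : negPow A γ = ((Real.sin (Real.pi * γ) / Real.pi : ℝ) : ℂ) •
      ∫ s in Ioi (0 : ℝ), s ^ (-γ) • S s := by
  unfold negPow
  rw [if_neg h0]
  congr 1
  refine setIntegral_congr_fun measurableSet_Ioi fun s hs => ?_
  rw [← hS s hs]
  exact Complex.coe_smul _ _

omit [CompleteSpace H] in
theorem fracPow_domain (A : H →ₗ.[ℂ] H) (γ : ℝ) :
    (fracPow A γ).domain = LinearMap.range (negPow A γ : H →ₗ[ℂ] H) := by
  unfold fracPow
  rw [LinearPMap.inverse_domain]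
  ext y
  constructor
  · rintro ⟨⟨x, hx⟩, rfl⟩
    exact ⟨x, rfl⟩
  · rintro ⟨x, rfl⟩
    exact ⟨⟨x, trivial⟩, rfl⟩

omit [CompleteSpace H] in
theorem fracPow_apply {A : H →ₗ.[ℂ] H} {γ : ℝ} (hinj : ∀ x, negPow A γ x = 0 → x = 0)
    (u : (fracPow A γ).domain) {x : H} (hx : negPow A γ x = u) : fracPow A γ u = x := by
  have hk : LinearMap.ker ((negPow A γ : H →ₗ[ℂ] H).toPMap ⊤).toFun = ⊥ := by
    rw [LinearMap.ker_eq_bot']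
    rintro ⟨z, hz⟩ h
    exact Subtype.ext (hinj z h)
  exact LinearPMap.inverse_apply_eq hk (x := ⟨x, trivial⟩) hx

variable {V : Type*} [NormedAddCommGroup V] [InnerProductSpace ℂ V] [CompleteSpace V]

namespace IsCoerciveForm

variable {a : V →ₗ[ℂ] V →ₗ⋆[ℂ] ℂ} {C c : ℝ} (h : IsCoerciveForm a C c) {ι : V →L[ℂ] H}
include h

theorem isAccretiveResolvent (ι : V →L[ℂ] H) :
    IsAccretiveResolvent (formRes ι a) (‖ι‖ * (‖ι‖ / c)) where
  identity s t hs ht := by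
    rw [h.formRes_identity ι hs ht, Complex.coe_smul]
    rfl
  accretive s hs x := by
    have h1 := h.accretive_formRes ι hs x
    have h2 : 0 ≤ c * ‖formSol ι a s x‖ ^ 2 := mul_nonneg h.pos.le (sq_nonneg _)
    rw [Complex.coe_smul] at h1
    exact h2.trans h1
  norm_le s hs := by
    have hc := h.pos
    refine (formRes ι a s).opNorm_le_bound (by positivity) fun x => ?_
    refine (ι.le_opNorm _).trans ?_
    rw [mul_assoc]
    exact mul_le_mul_of_nonneg_left (h.norm_formSol_le ι hs x) (norm_nonneg _)

theorem negPow_formOperator (hι : DenseRange ι) {γ : ℝ} (h0 : γ ≠ 0) :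
    negPow (formOperator (ι : V →ₗ[ℂ] H) a) γ = ((Real.sin (Real.pi * γ) / Real.pi : ℝ) : ℂ) •
      ∫ s in Ioi (0 : ℝ), s ^ (-γ) • formRes ι a s :=
  negPow_eq (fun _ hs => shiftInverse_eq (h.isShiftInverse_formRes hι hs.le)) h0

theorem negPow_adjoint_formOperator (hι : DenseRange ι) {γ : ℝ} (h0 : γ ≠ 0) :
    negPow (formOperator (ι : V →ₗ[ℂ] H) a)† γ = ((Real.sin (Real.pi * γ) / Real.pi : ℝ) : ℂ) •
      ∫ s in Ioi (0 : ℝ), s ^ (-γ) • formRes ι (adjForm a) s :=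
  negPow_eq (fun _ hs => shiftInverse_eq (h.isShiftInverse_adjoint hι hs.le)) h0

theorem adjoint_negPow (hι : DenseRange ι) (γ : ℝ) :
    ContinuousLinearMap.adjoint (negPow (formOperator (ι : V →ₗ[ℂ] H) a) γ) =
      negPow (formOperator (ι : V →ₗ[ℂ] H) a)† γ := by
  rcases eq_or_ne γ 0 with rfl | h0
  · rw [negPow_zero, negPow_zero]
    symm
    rw [ContinuousLinearMap.eq_adjoint_iff]
    intros; rfl
  · rw [h.negPow_formOperator hι h0, h.negPow_adjoint_formOperator hι h0, map_smulₛₗ,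
      Complex.conj_ofReal]
    congr 1
    -- Taking adjoints is conjugate-linear over `ℂ`, but a continuous linear equivalence over `ℝ`,
    -- and as such it commutes with the integral.
    let L : (H →L[ℂ] H) ≃L[ℝ] (H →L[ℂ] H) :=
      { toFun := ContinuousLinearMap.adjoint
        invFun := ContinuousLinearMap.adjoint
        left_inv := ContinuousLinearMap.adjoint_adjoint
        right_inv := ContinuousLinearMap.adjoint_adjoint
        map_add' := map_add _
        map_smul' := fun r T => by
          rw [← Complex.coe_smul, map_smulₛₗ, Complex.conj_ofReal, Complex.coe_smul]; rfl
        continuous_toFun := ContinuousLinearMap.adjoint.continuous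
        continuous_invFun := ContinuousLinearMap.adjoint.continuous }
    have := L.integral_comp_comm (μ := volume.restrict (Ioi (0 : ℝ)))
      (fun s : ℝ => s ^ (-γ) • formRes ι a s)
    refine this.symm.trans (setIntegral_congr_fun measurableSet_Ioi fun s hs => ?_)
    rw [map_smul]
    congr 1
    exact h.adjoint_formRes ι (le_of_lt hs)

omit [CompleteSpace H] [CompleteSpace V] in
theorem norm_le_of_form_eq {v : V} {x : H} (hv : ∀ φ, a v φ = inner ℂ (ι φ) x) {N : ℝ}
    (hN : 0 ≤ N) (hx : ∀ φ, ‖inner ℂ (ι φ) x‖ ≤ N * ‖φ‖) : ‖v‖ ≤ c⁻¹ * N := by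
  have h1 := h.coercive v
  rw [hv] at h1
  have h2 := (Complex.re_le_norm _).trans (hx v)
  have hc := h.pos
  rw [inv_mul_eq_div, le_div_iff₀ hc]
  rcases (norm_nonneg v).eq_or_lt with h0 | h0
  · rw [← h0, zero_mul]; exact hN
  · nlinarith

/-- For a Kato operator, `A^(-1/2)` is bounded in terms of the norm of the antidual of `V`. -/
theorem norm_negPow_half_le (hι : DenseRange ι) {A : H →ₗ.[ℂ] H}
    (hA : A = formOperator (ι : V →ₗ[ℂ] H) a)
    (hrange : LinearMap.range (PowSpace.incl A (1 / 2)) = LinearMap.range (ι : V →ₗ[ℂ] H))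
    {D : ℝ} (hD : 0 < D) (hnorm : ∀ (v : V) (u : PowSpace A (1 / 2)),
      PowSpace.incl A (1 / 2) u = ι v → ‖u‖ ≤ D * ‖v‖) :
    ∃ K : ℝ, 0 ≤ K ∧ ∀ (x : H) (N : ℝ), 0 ≤ N → (∀ φ, ‖inner ℂ (ι φ) x‖ ≤ N * ‖φ‖) →
      ‖negPow A (1 / 2) x‖ ≤ K * N := by
  subst hA
  set A := formOperator (ι : V →ₗ[ℂ] H) a
  set T := negPow A (1 / 2) with hT
  obtain ⟨κ₀, hκ₀⟩ := (h.isAccretiveResolvent ι).exists_sq_integral_eq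
  -- `T² = κ A⁻¹`. The true value of the constant is immaterial and is not computed.
  obtain ⟨κ, hκ⟩ : ∃ κ : ℂ, ∀ x, T (T x) = κ • formRes ι a 0 x := by
    refine ⟨((Real.sin (Real.pi * (1 / 2)) / Real.pi : ℝ) : ℂ) *
      (((Real.sin (Real.pi * (1 / 2)) / Real.pi : ℝ) : ℂ) * κ₀), fun x => ?_⟩
    rw [hT, h.negPow_formOperator hι (by norm_num)]
    simp only [_root_.smul_apply, map_smul]
    rw [hκ₀ x, smul_smul, ← Complex.coe_smul, smul_smul]
    congr 1
    ring
  have hTr : (LinearMap.range (T : H →ₗ[ℂ] H)) = LinearMap.range (ι : V →ₗ[ℂ] H) := by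
    rw [← hrange, ← fracPow_domain]
    exact (Submodule.range_subtype _).symm
  -- If `κ = 0`, then `T² = 0`, so `T` vanishes on its own range. That range is the range of `ι`,
  -- hence dense, and `T = 0`.
  rcases eq_or_ne κ 0 with rfl | hκ0
  · refine ⟨0, le_rfl, fun x N hN _ => ?_⟩
    have hz : ∀ y, T y = 0 := by
      intro y
      refine hι.induction_on (p := fun y => T y = 0) y
        (isClosed_eq T.continuous continuous_const) fun v => ?_
      have hv : ι v ∈ LinearMap.range (T : H →ₗ[ℂ] H) := by rw [hTr]; exact ⟨v, rfl⟩
      obtain ⟨z, hz⟩ := hv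
      rw [← hz]
      have := hκ z
      rwa [zero_smul] at this
    rw [hz, norm_zero, zero_mul]
  have hinj : ∀ x, T x = 0 → x = 0 := by
    intro x hx
    have h1 := hκ x
    rw [hx, map_zero] at h1
    have h2 := (smul_eq_zero.mp h1.symm).resolve_left hκ0
    obtain ⟨h3, h4⟩ := (h.isShiftInverse_formRes hι le_rfl).1 x
    have h5 : (⟨formRes ι a 0 x, h3⟩ : A.domain) = 0 := Subtype.ext h2
    have h6 : A 0 + ((0 : ℝ) : ℂ) • formRes ι a 0 x = x := by rw [← h5]; exact h4
    rw [← h6]; simp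
  refine ⟨‖κ‖ * D * c⁻¹, by have := h.pos; positivity, fun x N hN hx => ?_⟩
  have hu : formRes ι a 0 x ∈ (fracPow A (1 / 2)).domain := by
    rw [fracPow_domain]
    refine ⟨κ⁻¹ • T x, ?_⟩
    change T (κ⁻¹ • T x) = _
    rw [map_smul, hκ, smul_smul, inv_mul_cancel₀ hκ0, one_smul]
  -- `A^(1/2) A⁻¹ x = κ⁻¹ A^(-1/2) x`, so the Kato norm equivalence bounds `A^(-1/2) x` by the norm
  -- of the form solution in `V`, and coercivity bounds the latter by the antidual norm of `x`.
  have h1 : fracPow A (1 / 2) ⟨formRes ι a 0 x, hu⟩ = κ⁻¹ • T x := by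
    refine fracPow_apply hinj _ ?_
    change T (κ⁻¹ • T x) = _
    rw [map_smul, hκ, smul_smul, inv_mul_cancel₀ hκ0, one_smul]
  have h2 := hnorm (formSol ι a 0 x) ⟨formRes ι a 0 x, hu⟩ rfl
  have h3 : ‖κ⁻¹ • T x‖ ≤ D * ‖formSol ι a 0 x‖ := by rw [← h1]; exact h2
  have h4 : ‖formSol ι a 0 x‖ ≤ c⁻¹ * N := by
    refine h.norm_le_of_form_eq (fun φ => ?_) hN hx
    have := h.form_formSol ι le_rfl x φ
    simpa using this
  rw [norm_smul, norm_inv, inv_mul_eq_div, div_le_iff₀ (norm_pos_iff.mpr hκ0)] at h3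
  calc ‖T x‖ ≤ D * ‖formSol ι a 0 x‖ * ‖κ‖ := h3
    _ ≤ D * (c⁻¹ * N) * ‖κ‖ := by gcongr
    _ = _ := by ring

end IsCoerciveForm

end NegativePowers

/-! ### Lebesgue norms in dual form -/

section Pairing

variable {X : Type*} [MeasurableSpace X] {μ : Measure X}

/-- The dual description of `‖φ‖_{q'} ≤ K`. -/
def PairingLE (μ : Measure X) (q : ℝ) (φ : X → ℝ≥0∞) (K : ℝ≥0∞) : Prop :=
  ∀ w : X → ℝ≥0∞, AEMeasurable w μ → ∫⁻ y, w y ^ q ∂μ ≤ 1 → ∫⁻ y, w y * φ y ∂μ ≤ K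

theorem PairingLE.mono {q : ℝ} {φ : X → ℝ≥0∞} {K K' : ℝ≥0∞} (h : PairingLE μ q φ K)
    (hK : K ≤ K') : PairingLE μ q φ K' := fun w hw h1 => (h w hw h1).trans hK

theorem PairingLE.lintegral_mul_le {q : ℝ} (hq : 0 < q) {φ : X → ℝ≥0∞} {K : ℝ≥0∞}
    (h : PairingLE μ q φ K) {w : X → ℝ≥0∞} (hw : AEMeasurable w μ)
    (hfin : ∫⁻ y, w y ^ q ∂μ ≠ ⊤) :
    ∫⁻ y, w y * φ y ∂μ ≤ K * (∫⁻ y, w y ^ q ∂μ) ^ (1 / q) := by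
  set N := ∫⁻ y, w y ^ q ∂μ with hN
  rcases eq_or_ne N 0 with h0 | h0
  · have h1 : (fun y => w y ^ q) =ᵐ[μ] 0 := (lintegral_eq_zero_iff' (hw.pow_const q)).mp h0
    have h2 : (fun y => w y * φ y) =ᵐ[μ] 0 := by
      filter_upwards [h1] with y hy
      have : w y = 0 := (ENNReal.rpow_eq_zero_iff_of_pos hq).mp hy
      simp [this]
    rw [lintegral_congr_ae h2]
    simp
  · set c := N ^ (1 / q) with hc
    have hc0 : c ≠ 0 := (ENNReal.rpow_pos (pos_iff_ne_zero.mpr h0) hfin).ne'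
    have hct : c ≠ ⊤ := ENNReal.rpow_ne_top_of_nonneg (by positivity) hfin
    have hcq : c ^ q = N := by
      rw [hc, ← ENNReal.rpow_mul, one_div_mul_cancel hq.ne', ENNReal.rpow_one]
    have h1 := h (fun y => c⁻¹ * w y) (hw.const_mul _) (by
      simp_rw [ENNReal.mul_rpow_of_nonneg _ _ hq.le]
      rw [lintegral_const_mul' _ _
        (ENNReal.rpow_ne_top_of_nonneg hq.le (ENNReal.inv_ne_top.mpr hc0)), ← hN,
        ENNReal.inv_rpow, hcq, ENNReal.inv_mul_cancel h0 hfin])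
    simp_rw [mul_assoc] at h1
    rw [lintegral_const_mul' _ _ (ENNReal.inv_ne_top.mpr hc0)] at h1
    calc ∫⁻ y, w y * φ y ∂μ = c * (c⁻¹ * ∫⁻ y, w y * φ y ∂μ) := by
          rw [← mul_assoc, ENNReal.mul_inv_cancel hc0 hct, one_mul]
      _ ≤ c * K := by gcongr
      _ = K * c := mul_comm _ _

/-- A test weight `w` is truncated at height `N` and multiplied by the direction `φ / ‖φ‖`. The
result is bounded, hence in `L₂` as the measure is finite, and its inner product with `φ` is the
integral of `min w N` against `‖φ‖`. Monotone convergence removes `N`. -/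
theorem pairingLE_of_inner {E : Type*} [NormedAddCommGroup E] [InnerProductSpace ℂ E]
    [IsFiniteMeasure μ] {q : ℝ} (hq : 0 < q) (φ : Lp E 2 μ) {K : ℝ≥0∞}
    (h : ∀ g : Lp E 2 μ, ∫⁻ y, ‖g y‖ₑ ^ q ∂μ ≤ 1 → ‖inner ℂ g φ‖ₑ ≤ K) :
    PairingLE μ q (fun y => ‖φ y‖ₑ) K := by
  intro w hw hw1
  have hφm : AEStronglyMeasurable φ μ := Lp.aestronglyMeasurable φ
  have key : ∀ N : ℕ, ∫⁻ y, min (w y) N * ‖φ y‖ₑ ∂μ ≤ K := by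
    intro N
    set r : X → ℝ := fun y => (min (w y) N).toReal with hr
    have hrm : AEMeasurable r μ := (hw.min aemeasurable_const).ennreal_toReal
    have hr0 : ∀ y, 0 ≤ r y := fun y => ENNReal.toReal_nonneg
    have hrN : ∀ y, ENNReal.ofReal (r y) = min (w y) N := fun y =>
      ENNReal.ofReal_toReal (ne_top_of_le_ne_top (ENNReal.natCast_ne_top N) (min_le_right _ _))
    have hrN' : ∀ y, r y ≤ N := fun y => by
      have := ENNReal.toReal_mono (ENNReal.natCast_ne_top N) (min_le_right (w y) N)
      simpa using this
    set g₀ : X → E := fun y => (r y * ‖φ y‖⁻¹) • φ y with hg₀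
    have hg₀m : AEStronglyMeasurable g₀ μ :=
      (hrm.mul hφm.norm.aemeasurable.inv).aestronglyMeasurable.smul hφm
    have hg₀n : ∀ y, ‖g₀ y‖ ≤ r y := by
      intro y
      rw [hg₀]
      simp only
      rw [norm_smul, Real.norm_of_nonneg (mul_nonneg (hr0 y) (by positivity)), mul_assoc]
      refine mul_le_of_le_one_right (hr0 y) ?_
      rcases eq_or_ne ‖φ y‖ 0 with h0 | h0
      · rw [h0]; simp
      · rw [inv_mul_cancel₀ h0]
    have hg₀L : MemLp g₀ 2 μ := MemLp.of_bound hg₀m N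
      (Eventually.of_forall fun y => (hg₀n y).trans (hrN' y))
    have hae : hg₀L.toLp g₀ =ᵐ[μ] g₀ := hg₀L.coeFn_toLp
    have h1 : ∫⁻ y, ‖hg₀L.toLp g₀ y‖ₑ ^ q ∂μ ≤ 1 := by
      refine le_trans (lintegral_mono_ae ?_) hw1
      filter_upwards [hae] with y hy
      rw [hy]
      refine ENNReal.rpow_le_rpow ?_ hq.le
      rw [← ofReal_norm]
      calc ENNReal.ofReal ‖g₀ y‖ ≤ ENNReal.ofReal (r y) := ENNReal.ofReal_le_ofReal (hg₀n y)
        _ = min (w y) N := hrN y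
        _ ≤ w y := min_le_left _ _
    have h2 : inner ℂ (hg₀L.toLp g₀) φ = ((∫ y, r y * ‖φ y‖ ∂μ : ℝ) : ℂ) := by
      rw [L2.inner_def, ← integral_complex_ofReal]
      refine integral_congr_ae ?_
      filter_upwards [hae] with y hy
      rw [hy, hg₀]
      simp only
      rw [← Complex.coe_smul, inner_smul_left, inner_self_eq_norm_sq_to_K, Complex.conj_ofReal]
      simp only [Complex.coe_algebraMap]
      rcases eq_or_ne ‖φ y‖ 0 with h0 | h0
      · rw [h0]; simp
      · norm_cast
        field_simp
    have hi : Integrable (fun y => r y * ‖φ y‖) μ := by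
      have h3 : Integrable φ μ := (Lp.memLp φ).integrable (by norm_num)
      refine h3.norm.bdd_mul (c := N) hrm.aestronglyMeasurable (Eventually.of_forall fun y => ?_)
      rw [Real.norm_of_nonneg (hr0 y)]
      exact hrN' y
    have h3 := h _ h1
    rw [h2, ← ofReal_norm, Complex.norm_real, Real.norm_of_nonneg
      (integral_nonneg fun y => mul_nonneg (hr0 y) (norm_nonneg _)),
      ofReal_integral_eq_lintegral_ofReal hi
        (Eventually.of_forall fun y => mul_nonneg (hr0 y) (norm_nonneg _))] at h3
    refine le_of_eq_of_le (lintegral_congr fun y => ?_) h3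
    rw [ENNReal.ofReal_mul (hr0 y), hrN, ofReal_norm]
  have hsup : ∀ y, w y * ‖φ y‖ₑ = ⨆ N : ℕ, min (w y) N * ‖φ y‖ₑ := by
    intro y
    rw [← ENNReal.iSup_mul]
    congr 1
    refine le_antisymm ?_ (iSup_le fun N => min_le_left _ _)
    rw [← inf_iSup_eq, ENNReal.iSup_natCast]
    simp
  have hm : ∀ N : ℕ, AEMeasurable (fun y => min (w y) N * ‖φ y‖ₑ) μ := fun N =>
    (hw.min aemeasurable_const).mul hφm.enorm
  simp_rw [hsup]
  rw [lintegral_iSup' hm]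
  · exact iSup_le key
  · refine Eventually.of_forall fun y N N' hNN => ?_
    simp only
    gcongr

theorem pairingLE_of_eLpNorm {E : Type*} [NormedAddCommGroup E] {p q : ℝ} (hpq : p.HolderConjugate q)
    {φ : X → E} (hφ : AEStronglyMeasurable φ μ) {K : ℝ≥0∞}
    (h : eLpNorm φ (ENNReal.ofReal p) μ ≤ K) : PairingLE μ q (fun y => ‖φ y‖ₑ) K := by
  intro w hw hw1
  have h1 := ENNReal.lintegral_mul_le_Lp_mul_Lq μ hpq.symm hw hφ.enorm
  rw [eLpNorm_eq_lintegral_rpow_enorm_toReal (by simpa using hpq.pos) ENNReal.ofReal_ne_top,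
    ENNReal.toReal_ofReal hpq.nonneg] at h
  refine h1.trans ?_
  calc _ ≤ 1 ^ (1 / q) * K := by
        have := hpq.symm.nonneg
        refine mul_le_mul' (ENNReal.rpow_le_rpow hw1 (by positivity)) h
    _ = K := by simp

theorem pairingLE_of_eLpNorm_top {E : Type*} [NormedAddCommGroup E] {φ : X → E} {K : ℝ≥0∞}
    (h : eLpNorm φ ⊤ μ ≤ K) : PairingLE μ 1 (fun y => ‖φ y‖ₑ) K := by
  intro w hw hw1
  simp only [ENNReal.rpow_one] at hw1
  rw [eLpNorm_exponent_top] at h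
  calc ∫⁻ y, w y * ‖φ y‖ₑ ∂μ ≤ ∫⁻ y, w y * K ∂μ := by
        refine lintegral_mono_ae ?_
        filter_upwards [ae_le_eLpNormEssSup (f := φ) (μ := μ)] with y hy
        gcongr
        exact hy.trans h
    _ = (∫⁻ y, w y ∂μ) * K := lintegral_mul_const'' _ hw
    _ ≤ 1 * K := by gcongr
    _ = K := one_mul K

end Pairing

/-! ### Real interpolation by truncation -/

section Interpolation

/-- The part of a value above the level `c`. -/
noncomputable def truncAbove (c t : ℝ≥0∞) : ℝ≥0∞ := if c < t then t else 0

/-- The part of a value below the level `c`. -/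
noncomputable def truncBelow (c t : ℝ≥0∞) : ℝ≥0∞ := if c < t then 0 else t

theorem truncAbove_add_truncBelow (c t : ℝ≥0∞) : truncAbove c t + truncBelow c t = t := by
  unfold truncAbove truncBelow
  split_ifs <;> simp

theorem measurable_truncAbove : Measurable (fun z : ℝ≥0∞ × ℝ≥0∞ => truncAbove z.1 z.2) :=
  Measurable.ite (measurableSet_lt measurable_fst measurable_snd) measurable_snd measurable_const

theorem measurable_truncBelow : Measurable (fun z : ℝ≥0∞ × ℝ≥0∞ => truncBelow z.1 z.2) :=
  Measurable.ite (measurableSet_lt measurable_fst measurable_snd) measurable_const measurable_snd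

/-- `s^κ = (s^m)^(r - P)`, and `s^m < t` wherever the truncation does not vanish. For the part below
the level the exponent `r - P` is negative and the same comparison applies. -/
theorem rpow_mul_truncAbove_le {κ m r P : ℝ} (hκ : 0 < κ) (hm : 0 < m) (hP : 0 < P)
    (e : κ = m * (r - P)) {s : ℝ} (hs : 0 < s) {t : ℝ≥0∞} (ht : t ≠ ⊤) :
    ENNReal.ofReal (s ^ κ) * truncAbove (ENNReal.ofReal (s ^ m)) t ^ P ≤ t ^ r := by
  unfold truncAbove
  split_ifs with hlt
  · have hrP : 0 < r - P := by by_contra hh; push Not at hh; nlinarith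
    have h0 : t ≠ 0 := (bot_lt_of_lt hlt).ne'
    rw [e, Real.rpow_mul hs.le, ← ENNReal.ofReal_rpow_of_pos (by positivity)]
    calc _ ≤ t ^ (r - P) * t ^ P := by gcongr
      _ = t ^ r := by rw [← ENNReal.rpow_add _ _ h0 ht]; ring_nf
  · rw [ENNReal.zero_rpow_of_pos hP, mul_zero]; exact zero_le

theorem rpow_mul_truncBelow_le {κ m r P : ℝ} (hκ : κ < 0) (hm : 0 < m) (hP : 0 < P)
    (e : κ = m * (r - P)) {s : ℝ} (hs : 0 < s) {t : ℝ≥0∞} (ht : t ≠ ⊤) :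
    ENNReal.ofReal (s ^ κ) * truncBelow (ENNReal.ofReal (s ^ m)) t ^ P ≤ t ^ r := by
  unfold truncBelow
  split_ifs with hlt
  · rw [ENNReal.zero_rpow_of_pos hP, mul_zero]; exact zero_le
  · rcases eq_or_ne t 0 with rfl | h0
    · rw [ENNReal.zero_rpow_of_pos hP, mul_zero]; exact zero_le
    have hrP : r - P < 0 := by by_contra hh; push Not at hh; nlinarith
    rw [e, Real.rpow_mul hs.le, ← ENNReal.ofReal_rpow_of_pos (by positivity)]
    calc _ ≤ t ^ (r - P) * t ^ P :=
          mul_le_mul_left (by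
            rw [← neg_neg (r - P), ENNReal.rpow_neg, ENNReal.rpow_neg _ (-(r - P))]
            exact ENNReal.inv_le_inv.mpr (ENNReal.rpow_le_rpow (not_lt.mp hlt) (by linarith))) _
      _ = t ^ r := by rw [← ENNReal.rpow_add _ _ h0 ht]; ring_nf

/-- Only `s` up to `T = t^(1/m)` contribute, and `∫₀^T s^(κ-1) ds · t^P = κ⁻¹ t^(r-P) t^P`. The part
below the level lives on `[T, ∞)`, where a negative `κ` gives convergence. -/
theorem lintegral_truncAbove_le {κ m r P : ℝ} (hκ : 0 < κ) (hm : 0 < m) (hP : 0 < P)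
    (e : κ = m * (r - P)) {t : ℝ≥0∞} (ht : t ≠ ⊤) :
    ∫⁻ s in Ioi (0 : ℝ), ENNReal.ofReal s⁻¹ *
      (ENNReal.ofReal (s ^ κ) * truncAbove (ENNReal.ofReal (s ^ m)) t ^ P) ≤
      ENNReal.ofReal κ⁻¹ * t ^ r := by
  rcases eq_or_ne t 0 with rfl | h0
  · have : ∀ c, truncAbove c 0 = 0 := fun c => by simp [truncAbove]
    simp [this, ENNReal.zero_rpow_of_pos hP]
  set τ := t.toReal with hτd
  have hτ : 0 < τ := ENNReal.toReal_pos h0 ht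
  have htτ : t = ENNReal.ofReal τ := (ENNReal.ofReal_toReal ht).symm
  set T := τ ^ (1 / m) with hT
  have hT0 : 0 < T := by positivity
  have hsub : Ioc 0 T ⊆ Ioi (0 : ℝ) := Ioc_subset_Ioi_self
  calc _ ≤ ∫⁻ s in Ioi (0 : ℝ),
          (Ioc 0 T).indicator (fun s => ENNReal.ofReal (s ^ (κ - 1)) * t ^ P) s := by
        refine setLIntegral_mono' measurableSet_Ioi fun s hs => ?_
        have hs' : (0 : ℝ) < s := hs
        unfold truncAbove
        split_ifs with hlt
        · have hsT : s ∈ Ioc 0 T := by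
            refine ⟨hs', ?_⟩
            rw [htτ, ENNReal.ofReal_lt_ofReal_iff hτ] at hlt
            have := Real.rpow_le_rpow (by positivity) hlt.le (by positivity : 0 ≤ 1 / m)
            rwa [← Real.rpow_mul hs'.le, mul_one_div_cancel hm.ne', Real.rpow_one] at this
          rw [indicator_of_mem hsT, ← mul_assoc, ← ENNReal.ofReal_mul (by positivity),
            Real.rpow_sub hs', Real.rpow_one, inv_mul_eq_div]
        · rw [ENNReal.zero_rpow_of_pos hP, mul_zero, mul_zero]; exact zero_le
    _ = (∫⁻ s in Ioc 0 T, ENNReal.ofReal (s ^ (κ - 1))) * t ^ P := by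
        rw [lintegral_indicator measurableSet_Ioc,
          Measure.restrict_restrict_of_subset hsub, lintegral_mul_const']
        exact ENNReal.rpow_ne_top_of_nonneg hP.le ht
    _ = ENNReal.ofReal (T ^ κ / κ) * t ^ P := by
        rw [← ofReal_integral_eq_lintegral_ofReal, ← intervalIntegral.integral_of_le hT0.le,
          integral_rpow (Or.inl (by linarith))]
        · rw [sub_add_cancel, Real.zero_rpow hκ.ne', sub_zero]
        · exact (intervalIntegrable_iff_integrableOn_Ioc_of_le hT0.le).mp
            (intervalIntegral.intervalIntegrable_rpow' (by linarith))
        · exact (ae_restrict_mem measurableSet_Ioc).mono fun s hs => Real.rpow_nonneg hs.1.le _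
    _ = ENNReal.ofReal κ⁻¹ * t ^ r := by
        rw [div_eq_inv_mul, ENNReal.ofReal_mul (by positivity), mul_assoc]
        congr 1
        have h1 : T ^ κ = τ ^ (r - P) := by
          rw [hT, ← Real.rpow_mul hτ.le, e]; congr 1; field_simp
        rw [h1, ← ENNReal.ofReal_rpow_of_pos hτ, ← htτ, ← ENNReal.rpow_add _ _ h0 ht]
        ring_nf

theorem lintegral_truncBelow_le {κ m r P : ℝ} (hκ : κ < 0) (hm : 0 < m) (hP : 0 < P)
    (e : κ = m * (r - P)) {t : ℝ≥0∞} (ht : t ≠ ⊤) :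
    ∫⁻ s in Ioi (0 : ℝ), ENNReal.ofReal s⁻¹ *
      (ENNReal.ofReal (s ^ κ) * truncBelow (ENNReal.ofReal (s ^ m)) t ^ P) ≤
      ENNReal.ofReal (-κ)⁻¹ * t ^ r := by
  rcases eq_or_ne t 0 with rfl | h0
  · have : ∀ c, truncBelow c 0 = 0 := fun c => by simp [truncBelow]
    simp [this, ENNReal.zero_rpow_of_pos hP]
  set τ := t.toReal with hτd
  have hτ : 0 < τ := ENNReal.toReal_pos h0 ht
  have htτ : t = ENNReal.ofReal τ := (ENNReal.ofReal_toReal ht).symm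
  set T := τ ^ (1 / m) with hT
  have hT0 : 0 < T := by positivity
  have hsub : Ici T ⊆ Ioi (0 : ℝ) := fun s hs => hT0.trans_le hs
  calc _ ≤ ∫⁻ s in Ioi (0 : ℝ),
          (Ici T).indicator (fun s => ENNReal.ofReal (s ^ (κ - 1)) * t ^ P) s := by
        refine setLIntegral_mono' measurableSet_Ioi fun s hs => ?_
        have hs' : (0 : ℝ) < s := hs
        unfold truncBelow
        split_ifs with hlt
        · rw [ENNReal.zero_rpow_of_pos hP, mul_zero, mul_zero]; exact zero_le
        · have hsT : s ∈ Ici T := by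
            rw [htτ, ENNReal.ofReal_lt_ofReal_iff hτ, not_lt] at hlt
            have := Real.rpow_le_rpow hτ.le hlt (by positivity : 0 ≤ 1 / m)
            rwa [← Real.rpow_mul hs'.le, mul_one_div_cancel hm.ne', Real.rpow_one] at this
          rw [indicator_of_mem hsT, ← mul_assoc, ← ENNReal.ofReal_mul (by positivity),
            Real.rpow_sub hs', Real.rpow_one, inv_mul_eq_div]
    _ = (∫⁻ s in Ioi T, ENNReal.ofReal (s ^ (κ - 1))) * t ^ P := by
        rw [lintegral_indicator measurableSet_Ici,
          Measure.restrict_restrict_of_subset hsub, lintegral_mul_const',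
          restrict_Ioi_eq_restrict_Ici]
        exact ENNReal.rpow_ne_top_of_nonneg hP.le ht
    _ = ENNReal.ofReal (T ^ κ / (-κ)) * t ^ P := by
        rw [← ofReal_integral_eq_lintegral_ofReal, integral_Ioi_rpow_of_lt (by linarith) hT0]
        · rw [sub_add_cancel, div_neg, neg_div]
        · exact integrableOn_Ioi_rpow_of_lt (by linarith) hT0
        · exact (ae_restrict_mem measurableSet_Ioi).mono fun s hs =>
            Real.rpow_nonneg (hT0.trans hs).le _
    _ = ENNReal.ofReal (-κ)⁻¹ * t ^ r := by
        rw [div_eq_inv_mul, ENNReal.ofReal_mul (inv_nonneg.mpr (by linarith)), mul_assoc]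
        congr 1
        have h1 : T ^ κ = τ ^ (r - P) := by
          rw [hT, ← Real.rpow_mul hτ.le, e]; congr 1; field_simp
        rw [h1, ← ENNReal.ofReal_rpow_of_pos hτ, ← htτ, ← ENNReal.rpow_add _ _ h0 ht]
        ring_nf

variable {X : Type*} [MeasurableSpace X] {μ : Measure X} [SFinite μ]

/-- With `B s = s^(ε P) ∫ k(s, h)^P dμ`, the pairing bound estimates the integrand by `s⁻¹ G(s)
B(s)^(1/P)`. The hypotheses on `k` give `B ≤ 1` and `∫ B ds/s ≤ D`, and the Cauchy–Schwarz
inequality with respect to `ds/s` finishes the estimate. The majorant `b` is part of the conclusion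
because it is measurable in `s`, whereas joint measurability of `ψ` is not assumed. -/
theorem lintegral_pairing_trunc_le {k : ℝ → ℝ≥0∞ → ℝ≥0∞}
    (hk : Measurable fun z : ℝ × ℝ≥0∞ => k z.1 z.2)
    {γ ε P r : ℝ} {D : ℝ≥0∞} (hP : 0 < P) (hP2 : P ≤ 2)
    (ha : ∀ s, 0 < s → ∀ t : ℝ≥0∞, t ≠ ⊤ → ENNReal.ofReal (s ^ (ε * P)) * k s t ^ P ≤ t ^ r)
    (hb : ∀ t : ℝ≥0∞, t ≠ ⊤ → ∫⁻ s in Ioi (0 : ℝ), ENNReal.ofReal s⁻¹ *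
      (ENNReal.ofReal (s ^ (ε * P)) * k s t ^ P) ≤ D * t ^ r)
    {ψ : ℝ → X → ℝ≥0∞} {G : ℝ → ℝ≥0∞} (hG : AEMeasurable G (volume.restrict (Ioi 0)))
    (hψ : ∀ s, 0 < s → PairingLE μ P (ψ s) (ENNReal.ofReal (s ^ (γ + ε - 1)) * G s))
    {h : X → ℝ≥0∞} (hm : AEMeasurable h μ) (hfin : ∀ᵐ y ∂μ, h y ≠ ⊤)
    (h1 : ∫⁻ y, h y ^ r ∂μ ≤ 1) :
    ∃ b : ℝ → ℝ≥0∞, AEMeasurable b (volume.restrict (Ioi 0)) ∧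
      (∀ s ∈ Ioi (0 : ℝ), ENNReal.ofReal (s ^ (-γ)) * ∫⁻ y, k s (h y) * ψ s y ∂μ ≤ b s) ∧
      ∫⁻ s in Ioi (0 : ℝ), b s ≤
        (∫⁻ s in Ioi (0 : ℝ), G s ^ 2 * ENNReal.ofReal s⁻¹) ^ (1 / 2 : ℝ) * D ^ (1 / 2 : ℝ) := by
  have hkm : ∀ s, AEMeasurable (fun y => k s (h y)) μ := fun s =>
    (hk.comp measurable_prodMk_left).comp_aemeasurable hm
  set B : ℝ → ℝ≥0∞ := fun s => ENNReal.ofReal (s ^ (ε * P)) * ∫⁻ y, k s (h y) ^ P ∂μ with hB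
  have hBm : AEMeasurable B (volume.restrict (Ioi 0)) := by
    refine AEMeasurable.mul (by fun_prop) ?_
    have : AEMeasurable (fun z : ℝ × X => k z.1 (h z.2) ^ P)
        ((volume.restrict (Ioi 0)).prod μ) :=
      (hk.comp_aemeasurable (measurable_fst.aemeasurable.prodMk hm.comp_snd)).pow_const P
    exact this.lintegral_prod_right'
  have hB1 : ∀ s, 0 < s → B s ≤ 1 := by
    intro s hs
    simp only [hB]
    rw [← lintegral_const_mul' _ _ ENNReal.ofReal_ne_top]
    refine le_trans (lintegral_mono_ae ?_) h1
    filter_upwards [hfin] with y hy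
    exact ha s hs _ hy
  have hBD : ∫⁻ s in Ioi (0 : ℝ), ENNReal.ofReal s⁻¹ * B s ≤ D := by
    have hmz : AEMeasurable (fun z : ℝ × X => ENNReal.ofReal z.1⁻¹ *
        (ENNReal.ofReal (z.1 ^ (ε * P)) * k z.1 (h z.2) ^ P))
        ((volume.restrict (Ioi 0)).prod μ) := by
      refine AEMeasurable.mul (by fun_prop) (AEMeasurable.mul (by fun_prop) ?_)
      exact (hk.comp_aemeasurable (measurable_fst.aemeasurable.prodMk hm.comp_snd)).pow_const P
    calc ∫⁻ s in Ioi (0 : ℝ), ENNReal.ofReal s⁻¹ * B s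
        = ∫⁻ s in Ioi (0 : ℝ), ∫⁻ y, ENNReal.ofReal s⁻¹ *
            (ENNReal.ofReal (s ^ (ε * P)) * k s (h y) ^ P) ∂μ := by
          refine lintegral_congr fun s => ?_
          simp only [hB]
          rw [← lintegral_const_mul' _ _ ENNReal.ofReal_ne_top,
            ← lintegral_const_mul' _ _ ENNReal.ofReal_ne_top]
      _ = ∫⁻ y, (∫⁻ s in Ioi (0 : ℝ), ENNReal.ofReal s⁻¹ *
            (ENNReal.ofReal (s ^ (ε * P)) * k s (h y) ^ P)) ∂μ :=
          lintegral_lintegral_swap hmz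
      _ ≤ ∫⁻ y, D * h y ^ r ∂μ := by
          refine lintegral_mono_ae ?_
          filter_upwards [hfin] with y hy
          exact hb _ hy
      _ = D * ∫⁻ y, h y ^ r ∂μ := lintegral_const_mul'' _ (hm.pow_const r)
      _ ≤ D * 1 := by gcongr
      _ = D := mul_one D
  have hpt : ∀ s ∈ Ioi (0 : ℝ), ENNReal.ofReal (s ^ (-γ)) * ∫⁻ y, k s (h y) * ψ s y ∂μ ≤
      (G s * ENNReal.ofReal s⁻¹ ^ (1 / 2 : ℝ)) *
        (B s ^ (1 / P) * ENNReal.ofReal s⁻¹ ^ (1 / 2 : ℝ)) := by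
    intro s hs
    have hs' : (0 : ℝ) < s := hs
    have hsp : (0 : ℝ) < s ^ (ε * P) := by positivity
    have hfinP : ∫⁻ y, k s (h y) ^ P ∂μ ≠ ⊤ := by
      intro htop
      have := hB1 s hs'
      simp only [hB] at this
      rw [htop, ENNReal.mul_top (by simpa using hsp)] at this
      simp at this
    have h2 := (hψ s hs').lintegral_mul_le hP (hkm s) hfinP
    have h3 : ENNReal.ofReal (s ^ ε) * (∫⁻ y, k s (h y) ^ P ∂μ) ^ (1 / P) = B s ^ (1 / P) := by
      simp only [hB]
      rw [ENNReal.mul_rpow_of_nonneg _ _ (by positivity), ENNReal.ofReal_rpow_of_pos hsp,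
        ← Real.rpow_mul hs'.le]
      congr 3
      field_simp
    have h4 : ENNReal.ofReal s⁻¹ ^ (1 / 2 : ℝ) * ENNReal.ofReal s⁻¹ ^ (1 / 2 : ℝ) =
        ENNReal.ofReal s⁻¹ := by
      rw [← ENNReal.rpow_add_of_nonneg _ _ (by norm_num) (by norm_num)]
      norm_num
    have h5 : ENNReal.ofReal (s ^ (-γ)) * ENNReal.ofReal (s ^ (γ + ε - 1)) =
        ENNReal.ofReal s⁻¹ * ENNReal.ofReal (s ^ ε) := by
      rw [← ENNReal.ofReal_mul (by positivity), ← ENNReal.ofReal_mul (by positivity),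
        ← Real.rpow_add hs', ← Real.rpow_neg_one, ← Real.rpow_add hs']
      ring_nf
    calc _ ≤ ENNReal.ofReal (s ^ (-γ)) * (ENNReal.ofReal (s ^ (γ + ε - 1)) * G s *
            (∫⁻ y, k s (h y) ^ P ∂μ) ^ (1 / P)) := by gcongr
      _ = (ENNReal.ofReal (s ^ (-γ)) * ENNReal.ofReal (s ^ (γ + ε - 1))) * G s *
            (∫⁻ y, k s (h y) ^ P ∂μ) ^ (1 / P) := by ring
      _ = ENNReal.ofReal s⁻¹ * G s *
            (ENNReal.ofReal (s ^ ε) * (∫⁻ y, k s (h y) ^ P ∂μ) ^ (1 / P)) := by rw [h5]; ring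
      _ = _ := by 
          rw [h3]
          nth_rw 1 [← h4]
          ring
  have hsm : AEMeasurable (fun s : ℝ => ENNReal.ofReal s⁻¹ ^ (1 / 2 : ℝ))
      (volume.restrict (Ioi 0)) := by fun_prop
  refine ⟨_, (hG.mul hsm).mul ((hBm.pow_const _).mul hsm), hpt, ?_⟩
  have h22 : (2 : ℝ).HolderConjugate 2 := Real.HolderConjugate.two_two
  refine (ENNReal.lintegral_mul_le_Lp_mul_Lq _ h22 (hG.mul hsm)
    ((hBm.pow_const _).mul hsm)).trans ?_
  have hsq : ∀ s : ℝ, (ENNReal.ofReal s⁻¹ ^ (1 / 2 : ℝ)) ^ (2 : ℝ) = ENNReal.ofReal s⁻¹ := by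
    intro s
    rw [← ENNReal.rpow_mul]
    norm_num
  refine mul_le_mul' (ENNReal.rpow_le_rpow (le_of_eq ?_) (by norm_num))
    (ENNReal.rpow_le_rpow ?_ (by norm_num))
  · refine lintegral_congr fun s => ?_
    simp only [Pi.mul_apply]
    rw [ENNReal.mul_rpow_of_nonneg _ _ (by norm_num), hsq, ENNReal.rpow_two]
  · refine le_trans (setLIntegral_mono' measurableSet_Ioi fun s hs => ?_) hBD
    simp only [Pi.mul_apply]
    rw [ENNReal.mul_rpow_of_nonneg _ _ (by norm_num), hsq, ← ENNReal.rpow_mul, mul_comm]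
    gcongr
    -- This is where `P ≤ 2` is needed: `B s ≤ 1` and `2 / P ≥ 1`.
    calc B s ^ (1 / P * 2) ≤ B s ^ (1 : ℝ) := by
          refine ENNReal.rpow_le_rpow_of_exponent_ge (hB1 s hs) ?_
          rw [one_div_mul_eq_div, le_div_iff₀ hP]
          linarith
      _ = B s := ENNReal.rpow_one _

/-- Real interpolation of the bounds of a family, in dual form. -/
theorem lintegral_pairing_interpolation {γ ε₀ ε₁ m P₀ P₁ r : ℝ} (hm : 0 < m) (hr : 0 < r)
    (hε₀ : ε₀ < 0) (hε₁ : 0 < ε₁) (hP₀ : 0 < P₀) (hP₁ : 0 < P₁) (hP₀2 : P₀ ≤ 2) (hP₁2 : P₁ ≤ 2)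
    (e₀ : ε₀ * P₀ = m * (r - P₀)) (e₁ : ε₁ * P₁ = m * (r - P₁))
    {ψ : ℝ → X → ℝ≥0∞} {G : ℝ → ℝ≥0∞} (hψm : ∀ s, AEMeasurable (ψ s) μ)
    (hG : AEMeasurable G (volume.restrict (Ioi 0)))
    (hψ₀ : ∀ s, 0 < s → PairingLE μ P₀ (ψ s) (ENNReal.ofReal (s ^ (γ + ε₀ - 1)) * G s))
    (hψ₁ : ∀ s, 0 < s → PairingLE μ P₁ (ψ s) (ENNReal.ofReal (s ^ (γ + ε₁ - 1)) * G s))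
    {h : X → ℝ≥0∞} (hh : AEMeasurable h μ) (h1 : ∫⁻ y, h y ^ r ∂μ ≤ 1) :
    ∫⁻ s in Ioi (0 : ℝ), ENNReal.ofReal (s ^ (-γ)) * ∫⁻ y, h y * ψ s y ∂μ ≤
      (∫⁻ s in Ioi (0 : ℝ), G s ^ 2 * ENNReal.ofReal s⁻¹) ^ (1 / 2 : ℝ) *
        (ENNReal.ofReal (ε₁ * P₁)⁻¹ ^ (1 / 2 : ℝ) +
          ENNReal.ofReal (-(ε₀ * P₀))⁻¹ ^ (1 / 2 : ℝ)) := by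
  have hfin : ∀ᵐ y ∂μ, h y ≠ ⊤ := by
    have := ae_lt_top' (hh.pow_const r) (ne_top_of_le_ne_top ENNReal.one_ne_top h1)
    filter_upwards [this] with y hy htop
    rw [htop, ENNReal.top_rpow_of_pos hr] at hy
    exact lt_irrefl _ hy
  have hlev : Measurable fun z : ℝ × ℝ≥0∞ => (ENNReal.ofReal (z.1 ^ m), z.2) := by fun_prop
  -- The values of `h` above the height `s^m` are paired by means of the estimate with `ε₁ > 0`,
  -- those below it by means of the estimate with `ε₀ < 0`. The sign decides at which end of `(0,
  -- ∞)` the `s`-integral of the truncation has to converge.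
  obtain ⟨a, ham, ha, haD⟩ := lintegral_pairing_trunc_le (k := fun s t => truncAbove (ENNReal.ofReal (s ^ m)) t)
    (measurable_truncAbove.comp hlev) hP₁ hP₁2
    (fun s hs t ht => rpow_mul_truncAbove_le (by positivity) hm hP₁ e₁ hs ht)
    (fun t ht => lintegral_truncAbove_le (by positivity) hm hP₁ e₁ ht) hG hψ₁ hh hfin h1
  have hneg : ε₀ * P₀ < 0 := mul_neg_of_neg_of_pos hε₀ hP₀
  obtain ⟨b, hbm, hb, hbD⟩ := lintegral_pairing_trunc_le (k := fun s t => truncBelow (ENNReal.ofReal (s ^ m)) t)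
    (measurable_truncBelow.comp hlev) hP₀ hP₀2
    (fun s hs t ht => rpow_mul_truncBelow_le hneg hm hP₀ e₀ hs ht)
    (fun t ht => lintegral_truncBelow_le hneg hm hP₀ e₀ ht) hG hψ₀ hh hfin h1
  rw [mul_add]
  refine le_trans ?_ (add_le_add haD hbD)
  rw [← lintegral_add_left' ham]
  refine setLIntegral_mono' measurableSet_Ioi fun s hs => ?_
  refine le_trans (le_of_eq ?_) (add_le_add (ha s hs) (hb s hs))
  have h2 : AEMeasurable (fun y => truncAbove (ENNReal.ofReal (s ^ m)) (h y) * ψ s y) μ :=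
    ((measurable_truncAbove.comp measurable_prodMk_left).comp_aemeasurable hh).mul (hψm s)
  rw [← mul_add, ← lintegral_add_left' h2]
  congr 1
  refine lintegral_congr fun y => ?_
  rw [← add_mul, truncAbove_add_truncBelow]

end Interpolation

/-! ### Resolvent estimates and embeddings of `D((A*)^γ)` -/

section DualBounds

variable {X : Type*} [MeasurableSpace X] {μ : Measure X}
  {E : Type*} [NormedAddCommGroup E] [InnerProductSpace ℂ E]

theorem enorm_inner_le_lintegral (g φ : Lp E 2 μ) :
    ‖inner ℂ g φ‖ₑ ≤ ∫⁻ y, ‖g y‖ₑ * ‖φ y‖ₑ ∂μ := by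
  rw [L2.inner_def]
  refine (enorm_integral_le_lintegral_enorm _).trans (lintegral_mono fun y => ?_)
  simp only
  rw [← ofReal_norm, ← ofReal_norm, ← ofReal_norm, ← ENNReal.ofReal_mul (norm_nonneg _)]
  exact ENNReal.ofReal_le_ofReal (norm_inner_le_norm _ _)

variable [CompleteSpace E]

/-- The embedding `D((A*)^γ) ⊆ L_{q'}`, in dual form. -/
def DualBound (A : Lp E 2 μ →ₗ.[ℂ] Lp E 2 μ) (γ q : ℝ) : Prop :=
  ∃ C : ℝ≥0, ∀ x : Lp E 2 μ, PairingLE μ q (fun y => ‖negPow A† γ x y‖ₑ) (C * ‖x‖ₑ)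

omit [InnerProductSpace ℂ E] [CompleteSpace E] in
theorem pairingLE_two (x : Lp E 2 μ) : PairingLE μ 2 (fun y => ‖x y‖ₑ) ‖x‖ₑ := by
  refine pairingLE_of_eLpNorm Real.HolderConjugate.two_two (Lp.aestronglyMeasurable x) ?_
  rw [Lp.enorm_def]
  simp

theorem dualBound_zero (A : Lp E 2 μ →ₗ.[ℂ] Lp E 2 μ) : DualBound A 0 2 := by
  refine ⟨1, fun x => ?_⟩
  rw [negPow_zero]
  simpa using pairingLE_two x

variable [IsFiniteMeasure μ]
variable {V : Type*} [NormedAddCommGroup V] [InnerProductSpace ℂ V] [CompleteSpace V]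

/-- A resolvent estimate `(s + B)⁻¹ : L₂ → L_{P'}` with norm `O(s^(e-1))`, in dual form. -/
def ResolventPairing (S : ℝ → Lp E 2 μ →L[ℂ] Lp E 2 μ) (e P : ℝ) : Prop :=
  ∃ K : ℝ≥0, ∀ s, 0 < s → ∀ z : Lp E 2 μ,
    PairingLE μ P (fun y => ‖S s z y‖ₑ) (ENNReal.ofReal (s ^ (e - 1)) * (K * ‖z‖ₑ))

omit [IsFiniteMeasure μ] [CompleteSpace E] in
theorem IsAccretiveResolvent.resolventPairing_two {S : ℝ → Lp E 2 μ →L[ℂ] Lp E 2 μ} {M : ℝ}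
    (h : IsAccretiveResolvent S M) : ResolventPairing S 0 2 := by
  refine ⟨1, fun s hs z => (pairingLE_two _).mono ?_⟩
  rw [ENNReal.coe_one, one_mul, zero_sub, ← ofReal_norm, ← ofReal_norm,
    ← ENNReal.ofReal_mul (by positivity)]
  exact ENNReal.ofReal_le_ofReal ((S s).le_of_opNorm_le (h.norm_le_rpow hs) z)

namespace IsCoerciveForm

variable {a : V →ₗ[ℂ] V →ₗ⋆[ℂ] ℂ} {C c : ℝ} (h : IsCoerciveForm a C c)
  {ι : V →L[ℂ] Lp E 2 μ}
include h

-- The solution operator maps into `V` with norm `O(s^(-1/2))`, and `V` embeds into the Lebesgue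
-- space dual to `P`.
omit [IsFiniteMeasure μ] in
theorem resolventPairing_half {P : ℝ} {K : ℝ≥0}
    (hK : ∀ v, PairingLE μ P (fun y => ‖ι v y‖ₑ) (K * ‖v‖ₑ)) :
    ResolventPairing (formRes ι a) (1 / 2) P := by
  refine ⟨K * (c ^ (-1 / 2 : ℝ)).toNNReal, fun s hs z => (hK (formSol ι a s z)).mono ?_⟩
  have h1 : ‖formSol ι a s z‖ₑ ≤
      ENNReal.ofReal (c ^ (-1 / 2 : ℝ)) * ENNReal.ofReal (s ^ (-1 / 2 : ℝ)) * ‖z‖ₑ := by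
    have hc := h.pos
    rw [← ofReal_norm, ← ofReal_norm, ← ENNReal.ofReal_mul (by positivity),
      ← ENNReal.ofReal_mul (by positivity)]
    exact ENNReal.ofReal_le_ofReal (h.norm_formSol_le_rpow ι hs z)
  calc _ ≤ K * (ENNReal.ofReal (c ^ (-1 / 2 : ℝ)) * ENNReal.ofReal (s ^ (-1 / 2 : ℝ)) * ‖z‖ₑ) := by
        gcongr
    _ = ENNReal.ofReal (s ^ (1 / 2 - 1 : ℝ)) * (K * ENNReal.ofReal (c ^ (-1 / 2 : ℝ)) * ‖z‖ₑ) := by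
        rw [show (1 / 2 - 1 : ℝ) = -1 / 2 by norm_num]; ring
    _ = _ := by rw [ENNReal.coe_mul]; rfl

-- With `u = (s + A†)⁻¹ z`, both `u` and `A† u = z - s u` are bounded by multiples of `‖z‖`
-- uniformly in `s`. Thus the graph norm costs no power of `s`.
omit [IsFiniteMeasure μ] in
theorem resolventPairing_one (hι : DenseRange ι) {P : ℝ} {K : ℝ≥0}
    (hK : ∀ u : (formOperator (ι : V →ₗ[ℂ] Lp E 2 μ) a)†.domain,
      PairingLE μ P (fun y => ‖(u : Lp E 2 μ) y‖ₑ) (K * (‖(u : Lp E 2 μ)‖ₑ +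
        ‖(formOperator (ι : V →ₗ[ℂ] Lp E 2 μ) a)† u‖ₑ))) :
    ResolventPairing (formRes ι (adjForm a)) 1 P := by
  have hS := h.adj.isAccretiveResolvent ι
  set M : ℝ := ‖ι‖ * (‖ι‖ / c)
  refine ⟨K * (M.toNNReal + 2), fun s hs z => ?_⟩
  obtain ⟨hz, e⟩ := (h.isShiftInverse_adjoint hι hs.le).1 z
  refine (hK ⟨_, hz⟩).mono ?_
  rw [sub_self, Real.rpow_zero, ENNReal.ofReal_one, one_mul, ENNReal.coe_mul, mul_assoc]
  gcongr
  rw [eq_sub_of_add_eq e, ENNReal.coe_add, add_mul]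
  refine add_le_add ?_ ?_
  · have := hS.norm_apply_le hs.le z
    have h2 := ENNReal.ofReal_le_ofReal this
    rwa [ENNReal.ofReal_mul hS.const_nonneg, ofReal_norm, ofReal_norm] at h2
  · have := hS.norm_sub_smul_le hs.le z
    have h2 := ENNReal.ofReal_le_ofReal this
    rw [ENNReal.ofReal_mul (by norm_num), ofReal_norm, ofReal_norm] at h2
    rw [Complex.coe_smul]
    simpa using h2

/-- For `γ > 1/2` no interpolation is required. The solution operator into `V` is bounded by a
multiple of `min 1 (s^(-1/2))`, and this times `s^(-γ)` is integrable on `(0, ∞)`. -/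
theorem dualBound_of_half_lt (hι : DenseRange ι) {γ q : ℝ} (hγ : 1 / 2 < γ) (hγ1 : γ < 1)
    (hq : 0 < q) {K : ℝ≥0} (hK : ∀ v, PairingLE μ q (fun y => ‖ι v y‖ₑ) (K * ‖v‖ₑ)) :
    DualBound (formOperator (ι : V →ₗ[ℂ] Lp E 2 μ) a) γ q := by
  have hc := h.pos
  set D : ℝ := max (c ^ (-1 / 2 : ℝ)) (‖ι‖ / c) with hD
  have hD0 : 0 ≤ D := le_max_of_le_right (by positivity)
  set ρ : ℝ → ℝ := fun s => s ^ (-γ) * (D * min 1 (s ^ (-1 / 2 : ℝ))) with hρ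
  have hρ0 : ∀ s, 0 < s → 0 ≤ ρ s := fun s hs => by simp only [hρ]; positivity
  have hρi : IntegrableOn ρ (Ioi 0) := by
    refine integrableOn_Ioi_of_rpow_bounds (p := -γ) (q := -γ + -1 / 2) (K := D) ?_
      (by linarith) (by linarith) ?_ ?_
    · have r : ∀ p : ℝ, ContinuousOn (fun s : ℝ => s ^ p) (Ioi 0) := fun p =>
        continuousOn_id.rpow_const fun s hs => Or.inl (ne_of_gt hs)
      exact (r _).mul (continuousOn_const.mul (ContinuousOn.inf continuousOn_const (r _)))
    · intro s hs
      rw [Real.norm_of_nonneg (hρ0 s hs), hρ, mul_comm D]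
      simp only
      have : D * min 1 (s ^ (-1 / 2 : ℝ)) ≤ D := mul_le_of_le_one_right hD0 (min_le_left _ _)
      gcongr
    · intro s hs
      rw [Real.norm_of_nonneg (hρ0 s hs), hρ, Real.rpow_add hs]
      simp only
      calc _ ≤ s ^ (-γ) * (D * s ^ (-1 / 2 : ℝ)) := by gcongr; exact min_le_right _ _
        _ = _ := by ring
  set Q : ℝ≥0∞ := ∫⁻ s in Ioi (0 : ℝ), ENNReal.ofReal (ρ s) with hQ
  have hQt : Q ≠ ⊤ := (hρi.lintegral_lt_top).ne
  set cγ : ℂ := ((Real.sin (Real.pi * γ) / Real.pi : ℝ) : ℂ)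
  refine ⟨‖cγ‖₊ * (K * Q.toNNReal), fun x => pairingLE_of_inner hq _ fun g hg => ?_⟩
  have hS := h.adj.isAccretiveResolvent ι
  rw [h.negPow_adjoint_formOperator hι (by linarith), _root_.smul_apply, inner_smul_right,
    enorm_mul, ENNReal.coe_mul, ENNReal.coe_mul, ENNReal.coe_toNNReal hQt, mul_assoc]
  refine mul_le_mul' le_rfl ((hS.enorm_inner_integral_le (by linarith) hγ1 x g).trans ?_)
  calc _ ≤ ∫⁻ s in Ioi (0 : ℝ), K * ‖x‖ₑ * ENNReal.ofReal (ρ s) := by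
        refine setLIntegral_mono' measurableSet_Ioi fun s hs => ?_
        have hs' : (0 : ℝ) < s := hs
        have h1 : ‖inner ℂ g (formRes ι (adjForm a) s x)‖ₑ ≤
            K * ‖formSol ι (adjForm a) s x‖ₑ :=
          (enorm_inner_le_lintegral _ _).trans
            (hK _ _ (Lp.aestronglyMeasurable g).enorm hg)
        have h2 : ‖formSol ι (adjForm a) s x‖ ≤ D * min 1 (s ^ (-1 / 2 : ℝ)) * ‖x‖ := by
          refine le_trans ?_ (mul_le_mul_of_nonneg_right (le_of_eq (mul_min_of_nonneg _ _ hD0).symm)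
            (norm_nonneg _))
          rw [mul_one, min_mul_of_nonneg _ _ (norm_nonneg _)]
          refine le_min ?_ ?_
          · exact (h.adj.norm_formSol_le ι hs'.le x).trans
              (mul_le_mul_of_nonneg_right (le_max_right _ _) (norm_nonneg _))
          · refine (h.adj.norm_formSol_le_rpow ι hs' x).trans ?_
            gcongr
            exact le_max_left _ _
        have h3 := ENNReal.ofReal_le_ofReal h2
        rw [ENNReal.ofReal_mul (by positivity), ofReal_norm, ofReal_norm] at h3
        calc _ ≤ ENNReal.ofReal (s ^ (-γ)) *
              (K * (ENNReal.ofReal (D * min 1 (s ^ (-1 / 2 : ℝ))) * ‖x‖ₑ)) := by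
              gcongr
              exact h1.trans (by gcongr)
          _ = K * ‖x‖ₑ * (ENNReal.ofReal (s ^ (-γ)) *
              ENNReal.ofReal (D * min 1 (s ^ (-1 / 2 : ℝ)))) := by ring
          _ = _ := by rw [← ENNReal.ofReal_mul (by positivity)]
    _ = K * ‖x‖ₑ * Q := by
        rw [lintegral_const_mul' _ _ (ENNReal.mul_ne_top ENNReal.coe_ne_top enorm_ne_top)]
    _ = _ := by ring

/-- At `γ = 1/2` the bound used for larger `γ` diverges logarithmically at infinity, and the Kato
property replaces it. A function `g` with `∫ ‖g‖^q ≤ 1` has antidual norm at most `K` on `V`, so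
`A^(-1/2) g` is bounded in `H`, and the adjoint moves the power onto `x`. -/
theorem dualBound_half (hι : DenseRange ι) {q : ℝ} (hq : 0 < q)
    {K : ℝ≥0} (hK : ∀ v, PairingLE μ q (fun y => ‖ι v y‖ₑ) (K * ‖v‖ₑ))
    {K' : ℝ} (hK'0 : 0 ≤ K') (hK' : ∀ (x : Lp E 2 μ) (N : ℝ), 0 ≤ N →
      (∀ φ, ‖inner ℂ (ι φ) x‖ ≤ N * ‖φ‖) →
      ‖negPow (formOperator (ι : V →ₗ[ℂ] Lp E 2 μ) a) (1 / 2) x‖ ≤ K' * N) :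
    DualBound (formOperator (ι : V →ₗ[ℂ] Lp E 2 μ) a) (1 / 2) q := by
  refine ⟨K'.toNNReal * K, fun x => pairingLE_of_inner hq _ fun g hg => ?_⟩
  rw [← h.adjoint_negPow hι, ContinuousLinearMap.adjoint_inner_right]
  have h1 := hK' g K K.2 fun φ => by
    have h2 : ‖inner ℂ g (ι φ)‖ₑ ≤ K * ‖φ‖ₑ := (enorm_inner_le_lintegral _ _).trans
      (hK _ _ (Lp.aestronglyMeasurable g).enorm hg)
    rw [← norm_inner_symm]
    have h3 := ENNReal.toReal_mono (ENNReal.mul_ne_top ENNReal.coe_ne_top enorm_ne_top) h2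
    simpa using h3
  have h2 := (norm_inner_le_norm (𝕜 := ℂ)
    (negPow (formOperator (ι : V →ₗ[ℂ] Lp E 2 μ) a) (1 / 2) g) x).trans
    (mul_le_mul_of_nonneg_right h1 (norm_nonneg x))
  have h3 := ENNReal.ofReal_le_ofReal h2
  rw [ENNReal.ofReal_mul (by positivity), ENNReal.ofReal_mul hK'0, ofReal_norm, ofReal_norm] at h3
  simpa [ENNReal.ofReal] using h3

/-- The interpolation inequality with `ψ s = ‖S s (z s)‖` and `G s = K ‖z s‖`, where `z s = s B (s +
B)⁻² x` has square function norm at most `‖x‖`. The relations `eq₀` and `eq₁` fix the truncation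
height `s^m` and the intermediate exponent `r`. -/
theorem dualBound_interpolation (hι : DenseRange ι) {γ e₀ e₁ m P₀ P₁ r : ℝ} (hm : 0 < m)
    (hr : 0 < r) (hγ0 : 0 < γ) (hγ1 : γ < 1) (he₀ : e₀ < γ) (he₁ : γ < e₁)
    (hP₀ : 0 < P₀) (hP₁ : 0 < P₁) (hP₀2 : P₀ ≤ 2) (hP₁2 : P₁ ≤ 2)
    (eq₀ : (e₀ - γ) * P₀ = m * (r - P₀)) (eq₁ : (e₁ - γ) * P₁ = m * (r - P₁))
    (h₀ : ResolventPairing (formRes ι (adjForm a)) e₀ P₀)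
    (h₁ : ResolventPairing (formRes ι (adjForm a)) e₁ P₁) :
    DualBound (formOperator (ι : V →ₗ[ℂ] Lp E 2 μ) a) γ r := by
  obtain ⟨K₀, hK₀⟩ := h₀
  obtain ⟨K₁, hK₁⟩ := h₁
  set S := formRes ι (adjForm a)
  have hS := h.adj.isAccretiveResolvent ι
  set K := max K₀ K₁
  set Q : ℝ≥0∞ := ENNReal.ofReal ((e₁ - γ) * P₁)⁻¹ ^ (1 / 2 : ℝ) +
          ENNReal.ofReal (-((e₀ - γ) * P₀))⁻¹ ^ (1 / 2 : ℝ) with hQ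
  have hQt : Q ≠ ⊤ := by
    refine ENNReal.add_ne_top.mpr ⟨?_, ?_⟩ <;>
    exact ENNReal.rpow_ne_top_of_nonneg (by norm_num) ENNReal.ofReal_ne_top
  set cγ : ℂ := ((Real.sin (Real.pi * γ) / Real.pi : ℝ) : ℂ)
  set R : ℝ := 2 / (γ * (1 - γ))
  refine ⟨‖cγ‖₊ * (R.toNNReal * (K * Q.toNNReal)), fun x => pairingLE_of_inner hr _ fun g hg => ?_⟩
  set z : ℝ → Lp E 2 μ := fun s => s • (S s x - s • S s (S s x)) with hz
  set G : ℝ → ℝ≥0∞ := fun s => K * ‖z s‖ₑ with hG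
  have hzc : ContinuousOn z (Ioi 0) := by
    have h1 := (hS.continuousOn_apply x).mono Ioi_subset_Ici_self
    exact continuousOn_id.smul (h1.sub (continuousOn_id.smul (hS.continuousOn_Ioi.clm_apply h1)))
  have hGm : AEMeasurable G (volume.restrict (Ioi 0)) :=
    ((hzc.aestronglyMeasurable measurableSet_Ioi).enorm).const_mul _
  have hGi : (∫⁻ s in Ioi (0 : ℝ), G s ^ 2 * ENNReal.ofReal s⁻¹) ^ (1 / 2 : ℝ) ≤ K * ‖x‖ₑ := by
    have h1 : ∫⁻ s in Ioi (0 : ℝ), G s ^ 2 * ENNReal.ofReal s⁻¹ ≤ (K * ‖x‖ₑ) ^ 2 := by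
      simp only [hG, mul_pow, mul_assoc]
      rw [lintegral_const_mul' _ _ (by simp)]
      gcongr
      exact hS.sq_function_estimate x
    refine (ENNReal.rpow_le_rpow h1 (by norm_num)).trans (le_of_eq ?_)
    rw [← ENNReal.rpow_two, ← ENNReal.rpow_mul]
    norm_num
  have hint := lintegral_pairing_interpolation (μ := μ) (γ := γ) (ε₀ := e₀ - γ) (ε₁ := e₁ - γ)
    hm hr (by linarith) (by linarith) hP₀ hP₁ hP₀2 hP₁2 eq₀ eq₁
    (ψ := fun s y => ‖S s (z s) y‖ₑ) (G := G) (fun s => (Lp.aestronglyMeasurable _).enorm) hGm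
    (fun s hs => (hK₀ s hs (z s)).mono (by
      rw [show γ + (e₀ - γ) - 1 = e₀ - 1 by ring]
      simp only [hG]
      gcongr
      exact le_max_left _ _))
    (fun s hs => (hK₁ s hs (z s)).mono (by
      rw [show γ + (e₁ - γ) - 1 = e₁ - 1 by ring]
      simp only [hG]
      gcongr
      exact le_max_right _ _))
    (Lp.aestronglyMeasurable g).enorm hg
  rw [h.negPow_adjoint_formOperator hι hγ0.ne', _root_.smul_apply, inner_smul_right,
    enorm_mul, ENNReal.coe_mul, ENNReal.coe_mul, ENNReal.coe_mul, ENNReal.coe_toNNReal hQt,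
    mul_assoc]
  refine mul_le_mul' le_rfl ((hS.enorm_inner_integral_le' hγ0 hγ1 x g).trans ?_)
  rw [mul_assoc]
  refine mul_le_mul' le_rfl ?_
  calc _ ≤ ∫⁻ s in Ioi (0 : ℝ), ENNReal.ofReal (s ^ (-γ)) *
        ∫⁻ y, ‖g y‖ₑ * ‖S s (z s) y‖ₑ ∂μ := by
        refine lintegral_mono fun s => ?_
        gcongr
        exact enorm_inner_le_lintegral _ _
    _ ≤ K * ‖x‖ₑ * Q := hint.trans (by gcongr)
    _ = _ := by ring

end IsCoerciveForm

end DualBounds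

/-! ### The extrapolation space as a subspace of `H` -/

section ExtrapolationIsometry

variable {H : Type*} [NormedAddCommGroup H] [InnerProductSpace ℂ H] [CompleteSpace H]

/-- `A^(-γ)` as a bounded operator on the copy of `H` with the norm `‖A^(-γ) u‖`. -/
noncomputable def preExtrapPow (A : H →ₗ.[ℂ] H) (γ : ℝ) : PreExtrap A γ →L[ℂ] H :=
  (PreExtrap.pow A γ).mkContinuous 1 fun u => by rw [one_mul]; exact le_rfl

/-- The isometric extension of `A^(-γ)` to `H_{-γ}`. -/
noncomputable def extrapPow (A : H →ₗ.[ℂ] H) (γ : ℝ) : ExtrapSpace A γ →L[ℂ] H :=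
  (preExtrapPow A γ).extend (UniformSpace.Completion.toComplL (𝕜 := ℂ))

theorem extrapPow_toExtrap (A : H →ₗ.[ℂ] H) (γ : ℝ) (u : H) :
    extrapPow A γ (toExtrap A γ u) = negPow A γ u :=
  ContinuousLinearMap.extend_eq _ UniformSpace.Completion.denseRange_coe
    (UniformSpace.Completion.isUniformInducing_coe _) _

theorem norm_extrapPow (A : H →ₗ.[ℂ] H) (γ : ℝ) (g : ExtrapSpace A γ) :
    ‖extrapPow A γ g‖ = ‖g‖ := by
  refine UniformSpace.Completion.induction_on g
    (isClosed_eq (by fun_prop) continuous_norm) fun u => ?_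
  rw [UniformSpace.Completion.norm_coe]
  exact congrArg norm (extrapPow_toExtrap A γ u)

/-- An isometry of a complete space has closed range, so the range of the extension contains the
closure of the range of `A^(-γ)`. Working with this closure avoids proving that `A^(-γ)` has dense
range. -/
theorem exists_extrapPow_eq (A : H →ₗ.[ℂ] H) (γ : ℝ) {x : H}
    (hx : x ∈ closure (range (negPow A γ))) : ∃ g, extrapPow A γ g = x := by
  have hi : Isometry (extrapPow A γ) :=
    AddMonoidHomClass.isometry_of_norm _ (norm_extrapPow A γ)
  have hc : IsClosed (range (extrapPow A γ)) := hi.isClosedEmbedding.isClosed_range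
  have hs : range (negPow A γ) ⊆ range (extrapPow A γ) := by
    rintro _ ⟨u, rfl⟩
    exact ⟨_, extrapPow_toExtrap A γ u⟩
  exact closure_minimal hs hc hx

omit [CompleteSpace H] in
theorem extrap_ext_clm {A : H →ₗ.[ℂ] H} {γ : ℝ} {F : Type*} [NormedAddCommGroup F]
    [NormedSpace ℂ F] {ℓ ℓ' : ExtrapSpace A γ →L[ℂ] F}
    (h : ∀ u, ℓ (toExtrap A γ u) = ℓ' (toExtrap A γ u)) (g : ExtrapSpace A γ) : ℓ g = ℓ' g :=
  UniformSpace.Completion.induction_on g (isClosed_eq ℓ.continuous ℓ'.continuous) h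

/-- The closure of the range is the double orthogonal complement, and the orthogonal complement of
the range is contained in the kernel of the adjoint. -/
theorem mem_closure_range_of_orthogonal_ker (T : H →L[ℂ] H) {x : H}
    (hx : ∀ z, ContinuousLinearMap.adjoint T z = 0 → inner ℂ z x = 0) :
    x ∈ closure (range T) := by
  have h1 : x ∈ (LinearMap.range (T : H →ₗ[ℂ] H)).topologicalClosure := by
    rw [← Submodule.orthogonal_orthogonal_eq_closure, Submodule.mem_orthogonal]
    intro z hz
    apply hx
    refine ext_inner_right ℂ fun y => ?_
    rw [ContinuousLinearMap.adjoint_inner_left, inner_zero_left, ← inner_conj_symm,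
      hz (T y) ⟨y, rfl⟩, map_zero]
  exact h1

end ExtrapolationIsometry

/-! ### Functions as elements of `H_{-γ}` -/

section Representation

variable {d n : ℕ} {Ω : Set (EuclideanSpace ℝ (Fin d))} {A : L2 n Ω →ₗ.[ℂ] L2 n Ω} {γ q : ℝ}

theorem integrable_inner_of_pairingLE (hq : 0 < q) {φ : L2 n Ω} {K : ℝ≥0}
    (hφ : PairingLE (volume.restrict Ω) q (fun y => ‖φ y‖ₑ) K)
    {w : EuclideanSpace ℝ (Fin d) → EuclideanSpace ℂ (Fin n)}
    (hw : MemLp w (ENNReal.ofReal q) (volume.restrict Ω)) :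
    Integrable (fun x => inner ℂ (φ x) (w x)) (volume.restrict Ω) ∧
      ‖∫ x in Ω, inner ℂ (φ x) (w x)‖ₑ ≤ K * eLpNorm w (ENNReal.ofReal q) (volume.restrict Ω) := by
  have hq' : ENNReal.ofReal q ≠ 0 := by simpa using hq
  have h1 : ∫⁻ x in Ω, ‖w x‖ₑ ^ q ≠ ⊤ := by
    have := lintegral_rpow_enorm_lt_top_of_eLpNorm_lt_top hq' ENNReal.ofReal_ne_top hw.2
    rw [ENNReal.toReal_ofReal hq.le] at this
    exact this.ne
  have h2 := hφ.lintegral_mul_le hq hw.1.enorm h1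
  have h3 : ∫⁻ x in Ω, ‖inner ℂ (φ x) (w x)‖ₑ ≤
      K * eLpNorm w (ENNReal.ofReal q) (volume.restrict Ω) := by
    rw [eLpNorm_eq_lintegral_rpow_enorm_toReal hq' ENNReal.ofReal_ne_top,
      ENNReal.toReal_ofReal hq.le]
    refine le_trans (lintegral_mono fun x => ?_) h2
    simp only
    rw [← ofReal_norm, ← ofReal_norm, ← ofReal_norm, ← ENNReal.ofReal_mul (norm_nonneg _), mul_comm]
    exact ENNReal.ofReal_le_ofReal (norm_inner_le_norm _ _)
  exact ⟨⟨(Lp.aestronglyMeasurable φ).inner hw.1,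
    h3.trans_lt (ENNReal.mul_lt_top ENNReal.coe_lt_top hw.2)⟩,
    (enorm_integral_le_lintegral_enorm _).trans h3⟩

/-- The functional `ψ ↦ ∫ ⟨w, (A†)^(-γ) ψ⟩` is bounded on `L₂` by the dual bound. Its Riesz
representative `x` plays the role of `A^(-γ) g`, and `g` is recovered from it by the isometry. -/
theorem exists_represents (hadj : ContinuousLinearMap.adjoint (negPow A γ) = negPow A† γ)
    (hq : 0 < q) (hA : DualBound A γ q)
    {w : EuclideanSpace ℝ (Fin d) → EuclideanSpace ℂ (Fin n)}
    (hw : MemLp w (ENNReal.ofReal q) (volume.restrict Ω)) :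
    ∃ g, Represents A γ w g := by
  obtain ⟨C, hC⟩ := hA
  have key : ∀ ψ : L2 n Ω,
      Integrable (fun x => inner ℂ (negPow A† γ ψ x) (w x)) (volume.restrict Ω) ∧
      ‖∫ x in Ω, inner ℂ (negPow A† γ ψ x) (w x)‖ₑ ≤
        C * ‖ψ‖ₑ * eLpNorm w (ENNReal.ofReal q) (volume.restrict Ω) := fun ψ =>
    integrable_inner_of_pairingLE hq (K := C * ‖ψ‖₊) (hC ψ) hw
  have hI : ∀ ψ : L2 n Ω,
      Integrable (fun x => inner ℂ (w x) (negPow A† γ ψ x)) (volume.restrict Ω) := by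
    intro ψ
    have := (key ψ).1
    refine (RCLike.conjCLE.integrable_comp_iff.mpr this).congr (Eventually.of_forall fun x => ?_)
    exact inner_conj_symm _ _
  have hconj : ∀ ψ : L2 n Ω, starRingEnd ℂ (∫ x in Ω, inner ℂ (negPow A† γ ψ x) (w x)) =
      ∫ x in Ω, inner ℂ (w x) (negPow A† γ ψ x) := by
    intro ψ
    rw [← integral_conj]
    exact integral_congr_ae (Eventually.of_forall fun x => inner_conj_symm _ _)
  let Λ₀ : L2 n Ω →ₗ[ℂ] ℂ :=
    { toFun := fun ψ => ∫ x in Ω, inner ℂ (w x) (negPow A† γ ψ x)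
      map_add' := fun ψ ψ' => by
        rw [← integral_add (hI ψ) (hI ψ'), map_add]
        refine integral_congr_ae ?_
        filter_upwards [Lp.coeFn_add (negPow A† γ ψ) (negPow A† γ ψ')] with x hx
        rw [hx, Pi.add_apply, inner_add_right]
      map_smul' := fun c ψ => by
        rw [RingHom.id_apply, ← integral_smul, map_smul]
        refine integral_congr_ae ?_
        filter_upwards [Lp.coeFn_smul c (negPow A† γ ψ)] with x hx
        rw [hx, Pi.smul_apply, inner_smul_right, smul_eq_mul] }
  let Λ : L2 n Ω →L[ℂ] ℂ := Λ₀.mkContinuous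
    (C * (eLpNorm w (ENNReal.ofReal q) (volume.restrict Ω)).toReal) fun ψ => by
      have h1 := (key ψ).2
      have h2 := ENNReal.toReal_mono (ENNReal.mul_ne_top
        (ENNReal.mul_ne_top ENNReal.coe_ne_top enorm_ne_top) hw.2.ne) h1
      change ‖∫ x in Ω, inner ℂ (w x) (negPow A† γ ψ x)‖ ≤ _
      rw [← hconj, RCLike.norm_conj]
      simp only [toReal_enorm, ENNReal.toReal_mul, ENNReal.coe_toReal] at h2
      linarith [mul_right_comm (C : ℝ) ‖ψ‖
        (eLpNorm w (ENNReal.ofReal q) (volume.restrict Ω)).toReal]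
  obtain ⟨x, hx⟩ : ∃ x : L2 n Ω, ∀ ψ, inner ℂ ψ x = ∫ y in Ω, inner ℂ (negPow A† γ ψ y) (w y) := by
    refine ⟨(InnerProductSpace.toDual ℂ (L2 n Ω)).symm Λ, fun ψ => ?_⟩
    rw [← inner_conj_symm, InnerProductSpace.toDual_symm_apply]
    change starRingEnd ℂ (∫ x in Ω, inner ℂ (w x) (negPow A† γ ψ x)) = _
    rw [← hconj, Complex.conj_conj]
  -- The functional vanishes on the kernel of `(A†)^(-γ)`, the adjoint of `A^(-γ)`.
  have hmem : x ∈ closure (range (negPow A γ)) := by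
    refine mem_closure_range_of_orthogonal_ker _ fun z hz => ?_
    rw [hx, ← hadj, hz]
    rw [← integral_zero (EuclideanSpace ℝ (Fin d)) ℂ (μ := volume.restrict Ω)]
    refine integral_congr_ae ?_
    filter_upwards [Lp.coeFn_zero (EuclideanSpace ℂ (Fin n)) 2 (volume.restrict Ω)] with y hy
    rw [hy, Pi.zero_apply, inner_zero_left]
  obtain ⟨g, hg⟩ := exists_extrapPow_eq A γ hmem
  refine ⟨g, hw.1, fun φ hφ => ?_⟩
  rw [fracPow_domain] at hφ
  obtain ⟨ψ, rfl⟩ := hφ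
  refine ⟨(key ψ).1, (innerSL ℂ ψ) ∘L extrapPow A γ, fun u => ?_, ?_⟩
  · rw [ContinuousLinearMap.comp_apply, extrapPow_toExtrap, innerSL_apply_apply,
      ← ContinuousLinearMap.adjoint_inner_left, hadj]
    rfl
  · rw [ContinuousLinearMap.comp_apply, hg, innerSL_apply_apply, hx]
    rfl

/-- The norm of `g - g'` is that of `ψ = A^(-γ) (g - g')` in `L₂`, and `⟨ψ, ψ⟩` is the pairing of `w
- w'` with `(A†)^(-γ) ψ`. The dual bound estimates this by a multiple of `‖ψ‖`, one factor of which
cancels. With `w = w'` the same inequality shows that the represented element is unique. -/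
theorem Represents.enorm_sub_le (hadj : ContinuousLinearMap.adjoint (negPow A γ) = negPow A† γ)
    (hq : 0 < q) {C : ℝ≥0}
    (hC : ∀ x : L2 n Ω, PairingLE (volume.restrict Ω) q (fun y => ‖negPow A† γ x y‖ₑ) (C * ‖x‖ₑ))
    {w w' : EuclideanSpace ℝ (Fin d) → EuclideanSpace ℂ (Fin n)} {g g' : ExtrapSpace A γ}
    (hw : Represents A γ w g) (hw' : Represents A γ w' g')
    (hL : MemLp (fun x => w x - w' x) (ENNReal.ofReal q) (volume.restrict Ω)) :
    ‖g - g'‖ₑ ≤ C * eLpNorm (fun x => w x - w' x) (ENNReal.ofReal q) (volume.restrict Ω) := by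
  have hJ : ∀ {w : EuclideanSpace ℝ (Fin d) → EuclideanSpace ℂ (Fin n)} {g : ExtrapSpace A γ},
      Represents A γ w g → ∀ ψ : L2 n Ω,
      Integrable (fun x => inner ℂ (negPow A† γ ψ x) (w x)) (volume.restrict Ω) ∧
      inner ℂ ψ (extrapPow A γ g) = ∫ y in Ω, inner ℂ (negPow A† γ ψ y) (w y) := by
    intro w g h ψ
    obtain ⟨h1, ℓ, h2, h3⟩ := h.2 (negPow A† γ ψ) (by rw [fracPow_domain]; exact ⟨ψ, rfl⟩)
    refine ⟨h1, ?_⟩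
    rw [← h3]
    have := extrap_ext_clm (ℓ := (innerSL ℂ ψ) ∘L extrapPow A γ) (ℓ' := ℓ) (fun u => by
      rw [h2, ContinuousLinearMap.comp_apply, extrapPow_toExtrap, innerSL_apply_apply,
        ← ContinuousLinearMap.adjoint_inner_left, hadj]) g
    rw [← this, ContinuousLinearMap.comp_apply, innerSL_apply_apply]
  set ψ := extrapPow A γ (g - g') with hψ
  have h1 : inner ℂ ψ ψ = ∫ y in Ω, inner ℂ (negPow A† γ ψ y) (w y - w' y) := by
    have e : inner ℂ ψ ψ = inner ℂ ψ (extrapPow A γ g - extrapPow A γ g') := by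
      rw [← map_sub]
    rw [e, inner_sub_right, (hJ hw ψ).2, (hJ hw' ψ).2, ← integral_sub (hJ hw ψ).1 (hJ hw' ψ).1]
    simp_rw [inner_sub_right]
  have h2 := (integrable_inner_of_pairingLE hq (K := C * ‖ψ‖₊) (hC ψ) hL).2
  rw [← h1] at h2
  have h3 : ‖ψ‖ₑ = ‖g - g'‖ₑ := by rw [← ofReal_norm, ← ofReal_norm, norm_extrapPow]
  have h4 : ‖inner ℂ ψ ψ‖ₑ = ‖ψ‖ₑ * ‖ψ‖ₑ := by
    rw [← ofReal_norm, ← ofReal_norm, ← ENNReal.ofReal_mul (norm_nonneg _), inner_self_eq_norm_sq_to_K]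
    simp [sq]
  rw [h4, ENNReal.coe_mul, mul_assoc, mul_comm (C : ℝ≥0∞), mul_assoc] at h2
  rw [← h3]
  rcases eq_or_ne ‖ψ‖ₑ 0 with h0 | h0
  · rw [h0]; exact zero_le
  · have h5 := (ENNReal.mul_le_mul_iff_right h0 enorm_ne_top).mp h2
    rwa [mul_comm]

end Representation

/-! ### Measurability and Hölder's inequality for superpositions -/

section Superposition

variable {X : Type*} [MeasurableSpace X] {μ : Measure X}

/-- The Carathéodory argument: the claim is clear for simple functions, on whose countably many
fibres the second argument is constant. Continuity in that argument passes to the limit. -/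
theorem aestronglyMeasurable_superposition {E F : Type*} [TopologicalSpace E]
    [TopologicalSpace.PseudoMetrizableSpace E]
    [TopologicalSpace F] [TopologicalSpace.PseudoMetrizableSpace F] {g : X → E → F}
    (hg : ∀ u, AEStronglyMeasurable (fun x => g x u) μ) (hc : ∀ᵐ x ∂μ, Continuous (g x))
    {u : X → E} (hu : AEStronglyMeasurable u μ) :
    AEStronglyMeasurable (fun x => g x (u x)) μ := by
  have hs : ∀ s : SimpleFunc X E, AEStronglyMeasurable (fun x => g x (s x)) μ := by
    intro s
    have hcov : ⋃ y : s.range, s ⁻¹' {(y : E)} = univ := by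
      rw [eq_univ_iff_forall]
      exact fun x => mem_iUnion.mpr ⟨⟨s x, s.mem_range_self x⟩, rfl⟩
    rw [← Measure.restrict_univ (μ := μ), ← hcov, aestronglyMeasurable_iUnion_iff]
    intro y
    refine ((hg y).restrict (s := s ⁻¹' {(y : E)})).congr ?_
    filter_upwards [ae_restrict_mem (s.measurableSet_fiber y)] with x hx
    rw [show s x = y from hx]
  have hum := hu.stronglyMeasurable_mk
  refine AEStronglyMeasurable.congr (f := fun x => g x (hu.mk u x)) ?_
    (by filter_upwards [hu.ae_eq_mk] with x hx; rw [hx])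
  refine aestronglyMeasurable_of_tendsto_ae atTop (fun k => hs (hum.approx k)) ?_
  filter_upwards [hc] with x hx
  exact (hx.tendsto _).comp (hum.tendsto_approx x)

/-- Hölder's inequality for the product `a ^ (σ - 1) b`. -/
theorem eLpNorm_rpow_mul_le {a b : X → ℝ} (ha : AEStronglyMeasurable a μ)
    (hb : AEStronglyMeasurable b μ) {p σ : ℝ} (hp : 0 < p) (hσ : 1 ≤ σ) :
    eLpNorm (fun x => |a x| ^ (σ - 1) * b x) (ENNReal.ofReal (p / σ)) μ ≤
      eLpNorm a (ENNReal.ofReal p) μ ^ (σ - 1) * eLpNorm b (ENNReal.ofReal p) μ := by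
  have hσ0 : 0 < σ := by linarith
  have hpσ : 0 < p / σ := by positivity
  rw [eLpNorm_eq_lintegral_rpow_enorm_toReal (by simpa using hpσ) ENNReal.ofReal_ne_top,
    eLpNorm_eq_lintegral_rpow_enorm_toReal (by simpa using hp) ENNReal.ofReal_ne_top,
    eLpNorm_eq_lintegral_rpow_enorm_toReal (by simpa using hp) ENNReal.ofReal_ne_top,
    ENNReal.toReal_ofReal hpσ.le, ENNReal.toReal_ofReal hp.le]
  have h1 := ENNReal.lintegral_mul_norm_pow_le (ha.enorm.pow_const p) (hb.enorm.pow_const p)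
    (p := (σ - 1) / σ) (q := 1 / σ) (div_nonneg (by linarith) hσ0.le) (by positivity)
    (by field_simp; ring)
  calc (∫⁻ x, ‖|a x| ^ (σ - 1) * b x‖ₑ ^ (p / σ) ∂μ) ^ (1 / (p / σ))
      = (∫⁻ x, (‖a x‖ₑ ^ p) ^ ((σ - 1) / σ) * (‖b x‖ₑ ^ p) ^ (1 / σ) ∂μ) ^ (1 / (p / σ)) := by
        congr 1
        refine lintegral_congr fun x => ?_
        rw [enorm_mul, ENNReal.mul_rpow_of_nonneg _ _ hpσ.le, Real.enorm_rpow_of_nonneg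
          (abs_nonneg _) (by linarith), Real.enorm_abs, ← ENNReal.rpow_mul, ← ENNReal.rpow_mul,
          ← ENNReal.rpow_mul]
        congr 2 <;> ring
    _ ≤ ((∫⁻ x, ‖a x‖ₑ ^ p ∂μ) ^ ((σ - 1) / σ) * (∫⁻ x, ‖b x‖ₑ ^ p ∂μ) ^ (1 / σ)) ^
          (1 / (p / σ)) := ENNReal.rpow_le_rpow h1 (by positivity)
    _ = _ := by
        rw [ENNReal.mul_rpow_of_nonneg _ _ (by positivity), ← ENNReal.rpow_mul, ← ENNReal.rpow_mul,
          ← ENNReal.rpow_mul]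
        congr 2 <;> field_simp

end Superposition

/-! ### The superposition operator between Lebesgue spaces -/

section Growth

theorem exists_eLpNorm_le_of_exponent_le {X : Type*} [MeasurableSpace X] (μ : Measure X)
    [IsFiniteMeasure μ] {p q : ℝ} (hp : 0 < p) (hpq : p ≤ q) :
    ∃ K : ℝ≥0, ∀ {F : Type} [NormedAddCommGroup F] {φ : X → F}, AEStronglyMeasurable φ μ →
      eLpNorm φ (ENNReal.ofReal p) μ ≤ K * eLpNorm φ (ENNReal.ofReal q) μ := by
  have hq : 0 < q := hp.trans_le hpq
  have hfin : μ univ ^ (1 / p - 1 / q) ≠ ⊤ :=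
    ENNReal.rpow_ne_top_of_nonneg
      (sub_nonneg.mpr (one_div_le_one_div_of_le hp hpq)) (measure_ne_top μ univ)
  refine ⟨(μ univ ^ (1 / p - 1 / q)).toNNReal, fun hφ => ?_⟩
  have := eLpNorm_le_eLpNorm_mul_rpow_measure_univ (ENNReal.ofReal_le_ofReal hpq) hφ
  rw [ENNReal.toReal_ofReal hp.le, ENNReal.toReal_ofReal hq.le] at this
  rwa [ENNReal.coe_toNNReal hfin, mul_comm]

variable {d n : ℕ} {Ω : Set (EuclideanSpace ℝ (Fin d))}
  {f : ℝ → EuclideanSpace ℝ (Fin d) → EuclideanSpace ℂ (Fin n) → EuclideanSpace ℂ (Fin n)}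
  {p q q₀ σ : ℝ}

theorem eLpNorm_coe_nnreal_le_one {X : Type*} [MeasurableSpace X] {μ : Measure X} {p : ℝ}
    (hp : 0 < p) {a : X → ℝ≥0} (h : ∫⁻ x, (a x : ℝ≥0∞) ^ p ∂μ ≤ 1) :
    eLpNorm (fun x => (a x : ℝ)) (ENNReal.ofReal p) μ ≤ 1 := by
  rw [eLpNorm_eq_lintegral_rpow_enorm_toReal (by simpa using hp) ENNReal.ofReal_ne_top,
    ENNReal.toReal_ofReal hp.le]
  have : ∀ x, ‖(a x : ℝ)‖ₑ = a x := fun x => by simp [enorm]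
  simp_rw [this]
  calc _ ≤ (1 : ℝ≥0∞) ^ (1 / p) := ENNReal.rpow_le_rpow h (by positivity)
    _ = 1 := ENNReal.one_rpow _

/-- The bounds for the superposition operator `L_p → L_{q₀}` near a point of time. -/
theorem LipHolderGrowth.local_bounds (hf : LipHolderGrowth Ω f p q σ) (hΩ : volume Ω < ⊤)
    (hσ : 1 ≤ σ) (hq₀ : 1 ≤ q₀) (hq : q₀ ≤ q) (hp : σ * q₀ ≤ p) {t₀ : ℝ} (ht₀ : 0 ≤ t₀) :
    ∃ K : ℝ≥0, ∃ σ₀ : ℝ, 0 < σ₀ ∧ ∃ I : Set ℝ, I ⊆ Ici 0 ∧ I ∈ 𝓝[Ici 0] t₀ ∧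
      (∀ t ∈ I, ∀ u v : EuclideanSpace ℝ (Fin d) → EuclideanSpace ℂ (Fin n),
        AEStronglyMeasurable u (volume.restrict Ω) → AEStronglyMeasurable v (volume.restrict Ω) →
        eLpNorm (fun x => f t x (u x) - f t x (v x)) (ENNReal.ofReal q₀) (volume.restrict Ω) ≤
          K * ((1 + eLpNorm u (ENNReal.ofReal p) (volume.restrict Ω) +
            eLpNorm v (ENNReal.ofReal p) (volume.restrict Ω)) ^ (σ - 1) *
            eLpNorm (fun x => u x - v x) (ENNReal.ofReal p) (volume.restrict Ω))) ∧
      (∀ t ∈ I, ∀ s ∈ I, ∀ u : EuclideanSpace ℝ (Fin d) → EuclideanSpace ℂ (Fin n),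
        AEStronglyMeasurable u (volume.restrict Ω) →
        eLpNorm (fun x => f t x (u x) - f s x (u x)) (ENNReal.ofReal q₀) (volume.restrict Ω) ≤
          K * ((2 + eLpNorm u (ENNReal.ofReal p) (volume.restrict Ω) ^ σ) *
            ENNReal.ofReal (|t - s| ^ σ₀))) := by
  have : IsFiniteMeasure (volume.restrict Ω) := ⟨by simpa using hΩ⟩
  set μ := volume.restrict Ω
  obtain ⟨L, σ₀, hL, hσ₀, I, hI0, hI, a, b, hab, hlip, hhol⟩ := hf.1 t₀ ht₀
  have hσ0 : 0 < σ := by linarith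
  have hq₀0 : 0 < q₀ := by linarith
  have hq0 : 0 < q := by linarith
  have hp0 : 0 < p := lt_of_lt_of_le (by positivity) hp
  have hp1 : 1 ≤ p := by nlinarith
  have hpσ : q₀ ≤ p / σ := by rw [le_div_iff₀ hσ0]; linarith
  obtain ⟨K₁, hK₁⟩ := exists_eLpNorm_le_of_exponent_le μ hq₀0 hpσ
  obtain ⟨K₂, hK₂⟩ := exists_eLpNorm_le_of_exponent_le μ hq₀0 hq
  obtain ⟨K₃, hK₃⟩ := exists_eLpNorm_le_of_exponent_le μ (by positivity : 0 < q₀ * σ)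
    (by linarith : q₀ * σ ≤ p)
  have e1 : (1 : ℝ≥0∞) ≤ ENNReal.ofReal p := by simpa using hp1
  have e2 : (1 : ℝ≥0∞) ≤ ENNReal.ofReal q₀ := by simpa using hq₀
  -- `K₁`, `K₂`, `K₃` are the embedding constants on the finite measure space for `L_{p/σ}` and
  -- `L_q` into `L_{q₀}` and for `L_p` into `L_{σ q₀}`. Their combination serves both estimates at
  -- once.
  refine ⟨L.toNNReal * (K₁ + K₂ + K₃ ^ σ), σ₀, hσ₀, I, hI0, hI, ?_, ?_⟩
  · intro t ht u v hu hv
    obtain ⟨ham, -, ha1, -⟩ := hab t ht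
    set A : EuclideanSpace ℝ (Fin d) → ℝ := fun x => (a t x : ℝ) + ‖u x‖ + ‖v x‖ with hA
    have ham' : AEStronglyMeasurable (fun x => (a t x : ℝ)) μ :=
      ham.coe_nnreal_real.aestronglyMeasurable
    have hAm : AEStronglyMeasurable A μ := (ham'.add hu.norm).add hv.norm
    have hBm : AEStronglyMeasurable (fun x => ‖u x - v x‖) μ := (hu.sub hv).norm
    have hA0 : ∀ x, 0 ≤ A x := fun x => by simp only [hA]; positivity
    have hAn : eLpNorm A (ENNReal.ofReal p) μ ≤
        1 + eLpNorm u (ENNReal.ofReal p) μ + eLpNorm v (ENNReal.ofReal p) μ := by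
      refine (eLpNorm_add_le (ham'.add hu.norm) hv.norm e1).trans ?_
      rw [eLpNorm_norm]
      gcongr
      refine (eLpNorm_add_le ham' hu.norm e1).trans ?_
      rw [eLpNorm_norm]
      gcongr
      exact eLpNorm_coe_nnreal_le_one hp0 ha1
    have hprod : AEStronglyMeasurable (fun x => |A x| ^ (σ - 1) * ‖u x - v x‖) μ :=
      ((hAm.aemeasurable.norm.pow_const _).mul hBm.aemeasurable).aestronglyMeasurable
    calc eLpNorm (fun x => f t x (u x) - f t x (v x)) (ENNReal.ofReal q₀) μ
        ≤ eLpNorm (fun x => L • (|A x| ^ (σ - 1) * ‖u x - v x‖)) (ENNReal.ofReal q₀) μ := by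
          refine eLpNorm_mono_ae_real ?_
          filter_upwards [hlip t ht] with x hx
          rw [abs_of_nonneg (hA0 x), smul_eq_mul, ← mul_assoc]
          exact hx _ _
      _ = ENNReal.ofReal L *
          eLpNorm (fun x => |A x| ^ (σ - 1) * ‖u x - v x‖) (ENNReal.ofReal q₀) μ := by
          exact (eLpNorm_const_smul L _ _ _).trans (by rw [Real.enorm_of_nonneg hL])
      _ ≤ ENNReal.ofReal L * (K₁ *
          (eLpNorm A (ENNReal.ofReal p) μ ^ (σ - 1) *
            eLpNorm (fun x => ‖u x - v x‖) (ENNReal.ofReal p) μ)) := by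
          gcongr
          exact (hK₁ hprod).trans (mul_le_mul' le_rfl (eLpNorm_rpow_mul_le hAm hBm hp0 hσ))
      _ ≤ ENNReal.ofReal L * ((K₁ + K₂ + K₃ ^ σ : ℝ≥0) * ((1 + eLpNorm u (ENNReal.ofReal p) μ +
            eLpNorm v (ENNReal.ofReal p) μ) ^ (σ - 1) *
            eLpNorm (fun x => u x - v x) (ENNReal.ofReal p) μ)) := by
          rw [eLpNorm_norm (fun x => u x - v x)]
          gcongr
          rw [add_assoc]; exact le_self_add
      _ = _ := by rw [ENNReal.coe_mul, mul_assoc]; rfl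
  · intro t ht s hs u hu
    obtain ⟨-, hbm, -, hb1⟩ := hab t ht
    obtain ⟨-, hbm', -, hb1'⟩ := hab s hs
    have hbm1 : AEStronglyMeasurable (fun x => (b t x : ℝ)) μ :=
      hbm.coe_nnreal_real.aestronglyMeasurable
    have hbm2 : AEStronglyMeasurable (fun x => (b s x : ℝ)) μ :=
      hbm'.coe_nnreal_real.aestronglyMeasurable
    have hum : AEStronglyMeasurable (fun x => ‖u x‖ ^ σ) μ :=
      (hu.norm.aemeasurable.pow_const _).aestronglyMeasurable
    have hB : eLpNorm (fun x => (b t x : ℝ) + (b s x : ℝ) + ‖u x‖ ^ σ) (ENNReal.ofReal q₀) μ ≤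
        (K₁ + K₂ + K₃ ^ σ : ℝ≥0) * (2 + eLpNorm u (ENNReal.ofReal p) μ ^ σ) := by
      refine (eLpNorm_add_le (hbm1.add hbm2) hum e2).trans ?_
      have h1 : eLpNorm (fun x => (b t x : ℝ) + (b s x : ℝ)) (ENNReal.ofReal q₀) μ ≤ K₂ * 2 := by
        refine (eLpNorm_add_le hbm1 hbm2 e2).trans ?_
        rw [mul_two]
        refine add_le_add ((hK₂ hbm1).trans ?_) ((hK₂ hbm2).trans ?_)
        · exact mul_le_of_le_one_right' (eLpNorm_coe_nnreal_le_one hq0 hb1)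
        · exact mul_le_of_le_one_right' (eLpNorm_coe_nnreal_le_one hq0 hb1')
      have h2 : eLpNorm (fun x => ‖u x‖ ^ σ) (ENNReal.ofReal q₀) μ ≤
          (K₃ ^ σ : ℝ≥0) * eLpNorm u (ENNReal.ofReal p) μ ^ σ := by
        rw [eLpNorm_norm_rpow u hσ0, ← ENNReal.ofReal_mul hq₀0.le, ENNReal.coe_rpow_of_nonneg _ hσ0.le,
          ← ENNReal.mul_rpow_of_nonneg _ _ hσ0.le]
        exact ENNReal.rpow_le_rpow (hK₃ hu) hσ0.le
      rw [mul_add]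
      refine add_le_add (h1.trans ?_) (h2.trans ?_)
      · gcongr
        rw [add_right_comm]
        exact le_add_self
      · gcongr
        exact le_add_self
    calc eLpNorm (fun x => f t x (u x) - f s x (u x)) (ENNReal.ofReal q₀) μ
        ≤ eLpNorm (fun x => (L * |t - s| ^ σ₀) • ((b t x : ℝ) + (b s x : ℝ) + ‖u x‖ ^ σ))
            (ENNReal.ofReal q₀) μ := by
          refine eLpNorm_mono_ae_real ?_
          filter_upwards [hhol t ht s hs] with x hx
          rw [smul_eq_mul, mul_right_comm]
          exact hx _
      _ = ENNReal.ofReal L * ENNReal.ofReal (|t - s| ^ σ₀) *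
          eLpNorm (fun x => (b t x : ℝ) + (b s x : ℝ) + ‖u x‖ ^ σ) (ENNReal.ofReal q₀) μ := by
          exact (eLpNorm_const_smul (L * |t - s| ^ σ₀) _ _ _).trans
            (by rw [Real.enorm_of_nonneg (by positivity), ENNReal.ofReal_mul hL])
      _ ≤ ENNReal.ofReal L * ENNReal.ofReal (|t - s| ^ σ₀) *
          ((K₁ + K₂ + K₃ ^ σ : ℝ≥0) * (2 + eLpNorm u (ENNReal.ofReal p) μ ^ σ)) := by
          gcongr
      _ = _ := by
          rw [ENNReal.coe_mul]
          change _ = ENNReal.ofReal L * _ * _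
          ring

theorem LipHolderGrowth.aestronglyMeasurable (hf : LipHolderGrowth Ω f p q σ) (hσ : 1 ≤ σ) {t : ℝ}
    (ht : 0 ≤ t) {u : EuclideanSpace ℝ (Fin d) → EuclideanSpace ℂ (Fin n)}
    (hu : AEStronglyMeasurable u (volume.restrict Ω)) :
    AEStronglyMeasurable (fun x => f t x (u x)) (volume.restrict Ω) := by
  refine aestronglyMeasurable_superposition (hf.2.1 t ht) ?_ hu
  obtain ⟨L, σ₀, hL, hσ₀, I, hI0, hI, a, b, hab, hlip, hhol⟩ := hf.1 t ht
  filter_upwards [hlip t (mem_of_mem_nhdsWithin ht hI)] with x hx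
  rw [continuous_iff_continuousAt]
  intro v
  rw [ContinuousAt, tendsto_iff_norm_sub_tendsto_zero]
  have hlim : Tendsto (fun w : EuclideanSpace ℂ (Fin n) =>
      L * ((a t x : ℝ) + ‖w‖ + ‖v‖) ^ (σ - 1) * ‖w - v‖) (𝓝 v) (𝓝 0) := by
    have hc : Continuous fun w : EuclideanSpace ℂ (Fin n) =>
        L * ((a t x : ℝ) + ‖w‖ + ‖v‖) ^ (σ - 1) * ‖w - v‖ := by
      have h1 : Continuous fun w : EuclideanSpace ℂ (Fin n) => (a t x : ℝ) + ‖w‖ + ‖v‖ := by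
        fun_prop
      exact (continuous_const.mul (h1.rpow_const fun _ => Or.inr (by linarith))).mul (by fun_prop)
    have := hc.tendsto v
    simpa using this
  exact squeeze_zero (fun _ => norm_nonneg _) (fun w => hx w v) hlim

/-- Integrability is known only for `f(0, ·, 0)`. The Hölder condition propagates it in time to
`f(t, ·, 0)`, and the Lipschitz condition then passes from `0` to `u`. -/
theorem LipHolderGrowth.memLp (hf : LipHolderGrowth Ω f p q σ) (hΩ : volume Ω < ⊤)
    (hσ : 1 ≤ σ) (hq₀ : 1 ≤ q₀) (hq : q₀ ≤ q) (hp : σ * q₀ ≤ p) {t : ℝ} (ht : 0 ≤ t)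
    {u : EuclideanSpace ℝ (Fin d) → EuclideanSpace ℂ (Fin n)}
    (hu : MemLp u (ENNReal.ofReal p) (volume.restrict Ω)) :
    MemLp (fun x => f t x (u x)) (ENNReal.ofReal q₀) (volume.restrict Ω) := by
  have : IsFiniteMeasure (volume.restrict Ω) := ⟨by simpa using hΩ⟩
  have hm0 : ∀ s, 0 ≤ s → AEStronglyMeasurable (fun x => f s x 0) (volume.restrict Ω) := fun s hs =>
    hf.2.1 s hs 0
  have hz : MemLp (fun _ : EuclideanSpace ℝ (Fin d) => (0 : EuclideanSpace ℂ (Fin n)))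
      (ENNReal.ofReal p) (volume.restrict Ω) := MemLp.zero
  have hzero : MemLp (fun x => f 0 x 0) (ENNReal.ofReal q₀) (volume.restrict Ω) →
      MemLp (fun x => f t x 0) (ENNReal.ofReal q₀) (volume.restrict Ω) := by
    -- The constants in the Hölder condition are local in time, so a chain of neighbourhoods is
    -- needed. Integrability passes between nearby times in both directions, and connectedness of
    -- `[0, ∞)` links `0` with `t`.
    refine isPreconnected_Ici.induction₂' (s := Ici (0 : ℝ))
      (fun s t => MemLp (fun x => f s x 0) (ENNReal.ofReal q₀) (volume.restrict Ω) →
        MemLp (fun x => f t x 0) (ENNReal.ofReal q₀) (volume.restrict Ω)) ?_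
      (fun _ _ _ _ _ _ h1 h2 h3 => h2 (h1 h3)) self_mem_Ici (mem_Ici.mpr ht)
    intro t₀ ht₀
    obtain ⟨K, σ₀, -, I, hI0, hI, -, hhol⟩ := hf.local_bounds hΩ hσ hq₀ hq hp ht₀
    have ht₀I := mem_of_mem_nhdsWithin ht₀ hI
    have key : ∀ s ∈ I, ∀ t ∈ I, MemLp (fun x => f s x 0) (ENNReal.ofReal q₀) (volume.restrict Ω) →
        MemLp (fun x => f t x 0) (ENNReal.ofReal q₀) (volume.restrict Ω) := by
      intro s hs t ht h
      have h2 : MemLp (fun x => f t x 0 - f s x 0) (ENNReal.ofReal q₀) (volume.restrict Ω) := by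
        refine ⟨(hm0 t (hI0 ht)).sub (hm0 s (hI0 hs)),
          (hhol t ht s hs (fun _ => 0) hz.1).trans_lt ?_⟩
        refine ENNReal.mul_lt_top ENNReal.coe_lt_top (ENNReal.mul_lt_top ?_ ENNReal.ofReal_lt_top)
        exact ENNReal.add_lt_top.mpr ⟨by simp, ENNReal.rpow_lt_top_of_nonneg (by linarith) hz.2.ne⟩
      have := h2.add h
      refine this.ae_eq (Eventually.of_forall fun x => ?_)
      simp
    filter_upwards [hI] with s hs
    exact ⟨key t₀ ht₀I s hs, key s hs t₀ ht₀I⟩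
  have h0 := hzero (hf.2.2.mono_exponent (ENNReal.ofReal_le_ofReal hq))
  obtain ⟨K, σ₀, -, I, hI0, hI, hlip, -⟩ := hf.local_bounds hΩ hσ hq₀ hq hp ht
  have h2 : MemLp (fun x => f t x (u x) - f t x 0) (ENNReal.ofReal q₀) (volume.restrict Ω) := by
    refine ⟨(hf.aestronglyMeasurable hσ ht hu.1).sub (hm0 t ht),
      (hlip t (mem_of_mem_nhdsWithin ht hI) u (fun _ => 0) hu.1 hz.1).trans_lt ?_⟩
    refine ENNReal.mul_lt_top ENNReal.coe_lt_top (ENNReal.mul_lt_top ?_ (hu.sub hz).2)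
    refine ENNReal.rpow_lt_top_of_nonneg (by linarith) ?_
    exact (ENNReal.add_lt_top.mpr ⟨ENNReal.add_lt_top.mpr ⟨by simp, hu.2⟩, hz.2⟩).ne
  refine (h2.add h0).ae_eq (Eventually.of_forall fun x => ?_)
  simp

end Growth

/-! ### From the dual bound to the superposition operator -/

section Superposition

variable {d n : ℕ} {Ω : Set (EuclideanSpace ℝ (Fin d))} {A : L2 n Ω →ₗ.[ℂ] L2 n Ω}
  {f : ℝ → EuclideanSpace ℝ (Fin d) → EuclideanSpace ℂ (Fin n) → EuclideanSpace ℂ (Fin n)}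
  {α γ p q q₀ σ : ℝ}

/-- A map which is Lipschitz on bounded sets, uniformly for locally all times, and locally Hölder
in time, uniformly on bounded sets, is right locally Hölder-Lipschitz and left-locally bounded. -/
theorem rightLocallyHolderLipschitz_and_leftLocallyBounded {X Y : Type*} [SeminormedAddCommGroup X]
    [SeminormedAddCommGroup Y] {F : ℝ → X → Y}
    (h : ∀ t₀ : ℝ, 0 ≤ t₀ → ∃ I ∈ 𝓝[Ici 0] t₀, ∃ σ₀ : ℝ, 0 < σ₀ ∧ ∀ R : ℝ, ∃ K : ℝ, 0 ≤ K ∧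
      (∀ t ∈ I, ∀ u v, ‖u‖ ≤ R → ‖v‖ ≤ R → ‖F t u - F t v‖ ≤ K * ‖u - v‖) ∧
      (∀ t ∈ I, ∀ s ∈ I, ∀ u, ‖u‖ ≤ R → ‖F t u - F s u‖ ≤ K * |t - s| ^ σ₀)) :
    RightLocallyHolderLipschitz F ∧ LeftLocallyBounded F := by
  refine ⟨fun t₀ ht₀ u₀ => ?_, fun t₁ ht₁ M hM => ?_⟩
  · obtain ⟨I, hI, σ₀, hσ₀, hK⟩ := h t₀ ht₀
    obtain ⟨K, hK0, h1, h2⟩ := hK (‖u₀‖ + 1)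
    have hball : ∀ u ∈ Metric.ball u₀ 1, ‖u‖ ≤ ‖u₀‖ + 1 := fun u hu => by
      have := norm_le_norm_add_norm_sub' u u₀
      rw [mem_ball_iff_norm] at hu
      linarith
    refine ⟨(I ∩ Ici t₀) ×ˢ Metric.ball u₀ 1, ?_, fun z hz => ⟨hz.1.2, mem_univ _⟩,
      K, σ₀, hσ₀, ?_⟩
    · rw [nhdsWithin_prod_eq, nhdsWithin_univ]
      exact prod_mem_prod (inter_mem (nhdsWithin_mono _ (Ici_subset_Ici.mpr ht₀) hI)
        self_mem_nhdsWithin) (Metric.ball_mem_nhds _ one_pos)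
    · rintro ⟨t, u⟩ ⟨ht, hu⟩ ⟨s, v⟩ ⟨hs, hv⟩
      have e1 := h1 t ht.1 u v (hball u hu) (hball v hv)
      have e2 := h2 t ht.1 s hs.1 v (hball v hv)
      have e3 := norm_sub_le_norm_sub_add_norm_sub (F t u) (F t v) (F s v)
      simp only
      linarith
  · obtain ⟨I, hI, σ₀, hσ₀, hK⟩ := h t₁ ht₁.le
    obtain ⟨R, hR0, hR⟩ := hM.exists_pos_norm_le
    obtain ⟨K, hK0, h1, h2⟩ := hK R
    obtain ⟨ε, hε, hεI⟩ := Metric.mem_nhdsWithin_iff.mp hI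
    -- Halving keeps the closed endpoint `t₁ - ε / 2` inside the open ball of radius `ε`. All values
    -- are then compared with the single value `F t₁ 0`.
    refine ⟨ε / 2, by positivity, ?_⟩
    rw [isBounded_iff_forall_norm_le]
    refine ⟨K * R + K * ε ^ σ₀ + ‖F t₁ 0‖, ?_⟩
    rintro _ ⟨t, ⟨ht0, ht, ht'⟩, u, hu, rfl⟩
    have habs : |t - t₁| ≤ ε / 2 := by rw [abs_le]; constructor <;> linarith
    have htI : t ∈ I := hεI ⟨by rw [Metric.mem_ball, Real.dist_eq]; linarith, ht0⟩
    have ht₁I : t₁ ∈ I := hεI ⟨Metric.mem_ball_self hε, ht₁.le⟩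
    have e0 : ‖(0 : X)‖ ≤ R := by rw [norm_zero]; exact hR0.le
    have e1 := h1 t htI u 0 (hR u hu) e0
    have e2 := h2 t htI t₁ ht₁I 0 e0
    rw [sub_zero] at e1
    have e3 : K * ‖u‖ ≤ K * R := mul_le_mul_of_nonneg_left (hR u hu) hK0
    have e4 : K * |t - t₁| ^ σ₀ ≤ K * ε ^ σ₀ := by
      gcongr
      linarith
    have e5 : ‖F t u‖ ≤ ‖F t u - F t 0‖ + ‖F t 0 - F t₁ 0‖ + ‖F t₁ 0‖ := by
      have := norm_add₃_le (a := F t u - F t 0) (b := F t 0 - F t₁ 0) (c := F t₁ 0)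
      simpa using this
    linarith

/-- The superposition operator factors as `H_α ⊆ L_p → L_{q₀} → H_{-γ}`. The first arrow is the
assumed embedding, the second is controlled by the growth condition, and the third by the dual
bound. -/
theorem superpositionGood_of_dualBound
    (hadj : ContinuousLinearMap.adjoint (negPow A γ) = negPow A† γ) (hA : DualBound A γ q₀)
    (hf : LipHolderGrowth Ω f p q σ) (hΩ : volume Ω < ⊤) (hσ : 1 ≤ σ) (hq₀ : 1 ≤ q₀) (hq : q₀ ≤ q)
    (hp : σ * q₀ ≤ p) (hemb : ∃ C : ℝ≥0, ∀ u : PowSpace A α,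
      eLpNorm (PowSpace.incl A α u) (ENNReal.ofReal p) (volume.restrict Ω) ≤ C * ‖u‖ₑ) :
    SuperpositionGood A f α γ := by
  have hq₀0 : 0 < q₀ := by linarith
  obtain ⟨C, hC⟩ := hemb
  have hu : ∀ u : PowSpace A α,
      MemLp (PowSpace.incl A α u) (ENNReal.ofReal p) (volume.restrict Ω) := fun u =>
    ⟨Lp.aestronglyMeasurable _, (hC u).trans_lt (ENNReal.mul_lt_top ENNReal.coe_lt_top
      enorm_lt_top)⟩
  have hfu : ∀ t, 0 ≤ t → ∀ u : PowSpace A α, MemLp (fun x => f t x (PowSpace.incl A α u x))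
      (ENNReal.ofReal q₀) (volume.restrict Ω) := fun t ht u =>
    hf.memLp hΩ hσ hq₀ hq hp ht (hu u)
  have hex : ∀ (t : ℝ) (u : PowSpace A α), ∃ g : ExtrapSpace A γ,
      0 ≤ t → Represents A γ (fun x => f t x (PowSpace.incl A α u x)) g := by
    intro t u
    by_cases ht : 0 ≤ t
    · obtain ⟨g, hg⟩ := exists_represents hadj hq₀0 hA (hfu t ht u)
      exact ⟨g, fun _ => hg⟩
    -- A dummy value at negative times, where nothing is required of `F`.
    · exact ⟨0, fun h => absurd h ht⟩
  choose F hF using hex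
  refine ⟨F, fun t ht u => hF t u ht, ?_⟩
  obtain ⟨D, hD⟩ := hA
  have hdiff : ∀ t, 0 ≤ t → ∀ s, 0 ≤ s → ∀ u v : PowSpace A α, ‖F t u - F s v‖ₑ ≤
      D * eLpNorm (fun x => f t x (PowSpace.incl A α u x) - f s x (PowSpace.incl A α v x))
        (ENNReal.ofReal q₀) (volume.restrict Ω) := fun t ht s hs u v =>
    (hF t u ht).enorm_sub_le hadj hq₀0 hD (hF s v hs) ((hfu t ht u).sub (hfu s hs v))
  have hsub : ∀ u v : PowSpace A α, eLpNorm (fun x => PowSpace.incl A α u x - PowSpace.incl A α v x)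
      (ENNReal.ofReal p) (volume.restrict Ω) ≤ C * ‖u - v‖ₑ := by
    intro u v
    refine le_trans (le_of_eq (eLpNorm_congr_ae ?_)) (hC (u - v))
    rw [map_sub]
    exact (Lp.coeFn_sub _ _).symm
  refine rightLocallyHolderLipschitz_and_leftLocallyBounded fun t₀ ht₀ => ?_
  obtain ⟨K, σ₀, hσ₀, I, hI0, hI, hlip, hhol⟩ := hf.local_bounds hΩ hσ hq₀ hq hp ht₀
  refine ⟨I, hI, σ₀, hσ₀, fun R => ?_⟩
  have hCR : ∀ u : PowSpace A α, ‖u‖ ≤ R →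
      eLpNorm (PowSpace.incl A α u) (ENNReal.ofReal p) (volume.restrict Ω) ≤
        (C * R.toNNReal : ℝ≥0) := by
    intro u hu
    refine (hC u).trans ?_
    rw [ENNReal.coe_mul]
    gcongr
    rw [← ofReal_norm]
    exact ENNReal.ofReal_le_ofReal hu
  set T : ℝ≥0 := C * R.toNNReal with hT
  -- The sum of the Lipschitz constant on the ball of radius `R` and of the Hölder constant in time.
  -- `T` bounds the `L_p` norm on that ball.
  refine ⟨(D * (K * ((1 + T + T) ^ (σ - 1) * C)) + D * (K * (2 + T ^ σ)) : ℝ≥0), NNReal.coe_nonneg _,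
    fun t ht u v hu' hv' => ?_, fun t ht s hs u hu' => ?_⟩
  · have h1 := (hdiff t (hI0 ht) t (hI0 ht) u v).trans (mul_le_mul' le_rfl
      (hlip t ht _ _ (hu u).1 (hu v).1))
    have h2 : ‖F t u - F t v‖ₑ ≤ (D * (K * ((1 + T + T) ^ (σ - 1) * (C * ‖u - v‖₊))) : ℝ≥0) := by
      refine h1.trans ?_
      simp only [ENNReal.coe_mul, ENNReal.coe_rpow_of_nonneg _ (sub_nonneg.mpr hσ),
        ENNReal.coe_add, ENNReal.coe_one]
      have hs0 : 0 ≤ σ - 1 := sub_nonneg.mpr hσ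
      gcongr
      · exact hCR u hu'
      · exact hCR v hv'
      · exact hsub u v
    have h3 := ENNReal.coe_le_coe.mp h2
    have h4 : ‖F t u - F t v‖₊ ≤
        (D * (K * ((1 + T + T) ^ (σ - 1) * C)) + D * (K * (2 + T ^ σ)) : ℝ≥0) * ‖u - v‖₊ := by
      refine h3.trans ?_
      rw [add_mul]
      refine le_add_right (le_of_eq ?_)
      ring
    exact_mod_cast h4
  · have h1 := (hdiff t (hI0 ht) s (hI0 hs) u u).trans (mul_le_mul' le_rfl
      (hhol t ht s hs _ (hu u).1))
    have h2 : ‖F t u - F s u‖ₑ ≤ (D * (K * ((2 + T ^ σ) * (|t - s| ^ σ₀).toNNReal)) : ℝ≥0) := by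
      refine h1.trans ?_
      have hs0 : 0 ≤ σ := by linarith
      simp only [ENNReal.coe_mul, ENNReal.coe_rpow_of_nonneg _ hs0,
        ENNReal.coe_add, ENNReal.coe_ofNat]
      gcongr
      · exact hCR u hu'
      · exact le_rfl
    have h3 := ENNReal.coe_le_coe.mp h2
    have h4 : ‖F t u - F s u‖₊ ≤ (D * (K * ((1 + T + T) ^ (σ - 1) * C)) +
        D * (K * (2 + T ^ σ)) : ℝ≥0) * (|t - s| ^ σ₀).toNNReal := by
      refine h3.trans ?_
      refine (le_of_eq ?_).trans (mul_le_mul_left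
        (le_add_self : D * (K * (2 + T ^ σ)) ≤ _) _)
      ring
    have h5 : ((|t - s| ^ σ₀).toNNReal : ℝ) = |t - s| ^ σ₀ := Real.coe_toNNReal _ (by positivity)
    rw [← h5]
    exact_mod_cast h4

end Superposition

/-! ### The Sobolev space and its embeddings -/

section Sobolev

variable {d n : ℕ} {Ω : Set (EuclideanSpace ℝ (Fin d))}

theorem continuous_integral_test_smul {φ : EuclideanSpace ℝ (Fin d) → ℝ} (hc : Continuous φ)
    (hs : HasCompactSupport φ) : Continuous fun u : L2 n Ω => ∫ x in Ω, φ x • u x := by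
  have h1 : MemLp φ 2 (volume.restrict Ω) := hc.memLp_of_hasCompactSupport hs
  have h2 : ∀ u : L2 n Ω, ∫ x in Ω, φ x • u x =
      (ContinuousLinearMap.lsmul ℝ ℝ :
        ℝ →L[ℝ] EuclideanSpace ℂ (Fin n) →L[ℝ] EuclideanSpace ℂ (Fin n)).lpPairing
          (volume.restrict Ω) 2 2 h1.toLp u := by
    intro u
    rw [ContinuousLinearMap.lpPairing_eq_integral]
    refine integral_congr_ae ?_
    filter_upwards [h1.coeFn_toLp] with x hx
    rw [hx]
    rfl
  simp_rw [h2]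
  fun_prop

/-- For a fixed test function both sides of the weak derivative identity are continuous for `L₂`
convergence. This yields completeness of `W^{1,2}`, and with it completeness of the closed subspace
`V`, which Lax–Milgram requires. -/
theorem isClosed_weakGraph : IsClosed
    (weakGraph n Ω : Set (WithLp 2 (L2 n Ω × PiLp 2 (fun _ : Fin d => L2 n Ω)))) := by
  change IsClosed {z : WithLp 2 (L2 n Ω × PiLp 2 (fun _ : Fin d => L2 n Ω)) |
    ∀ i, IsWeakPartial n Ω i z.fst (z.snd i)}
  simp only [IsWeakPartial, ofPred_forall]
  refine isClosed_iInter fun i => isClosed_iInter fun φ => isClosed_iInter fun h1 =>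
    isClosed_iInter fun h2 => isClosed_iInter fun _ => isClosed_eq ?_ ?_
  · exact (continuous_integral_test_smul (continuous_partial h1 i)
      (h2.fderiv_apply (𝕜 := ℝ) _)).comp (by fun_prop)
  · exact ((continuous_integral_test_smul h1.continuous h2).comp
      (g := fun u : L2 n Ω => ∫ x in Ω, φ x • u x) (f := fun z :
        WithLp 2 (L2 n Ω × PiLp 2 (fun _ : Fin d => L2 n Ω)) => z.snd i) (by fun_prop)).neg

instance : CompleteSpace (W12 n Ω) :=
  have : IsClosed
    (weakGraph n Ω : Set (WithLp 2 (L2 n Ω × PiLp 2 (fun _ : Fin d => L2 n Ω)))) :=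
      isClosed_weakGraph
  this.completeSpace_coe

theorem norm_toL2_le (u : W12 n Ω) : ‖W12.toL2 u‖ ≤ ‖u‖ := WithLp.norm_fst_le _ u.1

/-- The bounded inclusion of a subspace of `W^{1,2}` into `L₂`. -/
noncomputable def inclL2CLM (V : Submodule ℂ (W12 n Ω)) : V →L[ℂ] L2 n Ω :=
  (inclL2 V).mkContinuous 1 fun u => by
    rw [one_mul]
    exact norm_toL2_le (u : W12 n Ω)

theorem EmbedsLp.pairingLE {V : Submodule ℂ (W12 n Ω)} {p q : ℝ} (hpq : p.HolderConjugate q)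
    (h : EmbedsLp V (ENNReal.ofReal p)) : ∃ K : ℝ≥0, ∀ v : V,
      PairingLE (volume.restrict Ω) q (fun y => ‖inclL2CLM V v y‖ₑ) (K * ‖v‖ₑ) :=
  h.imp fun _ hC v => pairingLE_of_eLpNorm hpq (Lp.aestronglyMeasurable _) (hC v)

theorem EmbedsLp.pairingLE_one {V : Submodule ℂ (W12 n Ω)} (h : EmbedsLp V ⊤) : ∃ K : ℝ≥0, ∀ v : V,
      PairingLE (volume.restrict Ω) 1 (fun y => ‖inclL2CLM V v y‖ₑ) (K * ‖v‖ₑ) :=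
  h.imp fun _ hC v => pairingLE_of_eLpNorm_top (hC v)

theorem IsKatoOperator.exists_isCoerciveForm {H V : Type*} [NormedAddCommGroup H]
    [InnerProductSpace ℂ H] [CompleteSpace H] [NormedAddCommGroup V] [InnerProductSpace ℂ V]
    {ι : V →ₗ[ℂ] H} {A : H →ₗ.[ℂ] H} (hA : IsKatoOperator ι A) :
    ∃ a C c, IsCoerciveForm a C c ∧ A = formOperator ι a := by
  obtain ⟨⟨a, ⟨C, hC0, hC⟩, ⟨c, hc0, hc⟩, h⟩, -, -⟩ := hA
  exact ⟨a, C, c, ⟨hC0, hC, hc0, hc⟩, h⟩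

theorem norm_powSpace_zero {H : Type*} [NormedAddCommGroup H]
    [InnerProductSpace ℂ H] [CompleteSpace H] (A : H →ₗ.[ℂ] H) (u : PowSpace A 0) :
    ‖PowSpace.incl A 0 u‖ = ‖u‖ := by
  change _ = ‖PowSpace.pow A 0 u‖
  have h0 : ∀ x, negPow A 0 x = x := fun x => by rw [negPow_zero]; rfl
  have : fracPow A 0 u = PowSpace.incl A 0 u :=
    fracPow_apply (fun x h => by rwa [h0] at h) u (h0 _)
  rw [← this]
  rfl

theorem eLpNorm_powSpace_zero_le (A : L2 n Ω →ₗ.[ℂ] L2 n Ω) (u : PowSpace A 0) :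
    eLpNorm (PowSpace.incl A 0 u) (ENNReal.ofReal 2) (volume.restrict Ω) ≤ (1 : ℝ≥0) * ‖u‖ₑ := by
  rw [ENNReal.coe_one, one_mul, ← ofReal_norm, ← norm_powSpace_zero, ofReal_norm, Lp.enorm_def]
  simp

/-- Only the lower half of the Kato norm equivalence is used here. The upper half enters in the dual
bound for `γ = 1/2`. -/
theorem IsKatoOperator.eLpNorm_powSpace_half_le {V : Submodule ℂ (W12 n Ω)}
    {A : L2 n Ω →ₗ.[ℂ] L2 n Ω} (hA : IsKatoOperator (inclL2 V) A) {p : ℝ≥0∞} (h : EmbedsLp V p) :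
    ∃ C : ℝ≥0, ∀ u : PowSpace A (1 / 2),
      eLpNorm (PowSpace.incl A (1 / 2) u) p (volume.restrict Ω) ≤ C * ‖u‖ₑ := by
  obtain ⟨-, hr, c, D, hc, hD, hn⟩ := hA
  obtain ⟨C, hC⟩ := h
  refine ⟨C * (c⁻¹).toNNReal, fun u => ?_⟩
  obtain ⟨v, hv⟩ : PowSpace.incl A (1 / 2) u ∈ LinearMap.range (inclL2 V) := by
    rw [← hr]; exact ⟨u, rfl⟩
  rw [← hv]
  refine (hC v).trans ?_
  rw [ENNReal.coe_mul, mul_assoc]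
  gcongr
  have h1 := (hn v u hv.symm).1
  rw [← ofReal_norm, ← ofReal_norm]
  change _ ≤ ENNReal.ofReal _ * _
  rw [← ENNReal.ofReal_mul (by positivity)]
  refine ENNReal.ofReal_le_ofReal ?_
  rw [inv_mul_eq_div, le_div_iff₀ hc]
  linarith

end Sobolev

/-! ### Dual bounds for Kato operators -/

section DualBounds

theorem holderConjugate_one_sub_inv {p : ℝ} (hp : 1 < p) : p.HolderConjugate (1 - 1 / p)⁻¹ :=
  Real.holderConjugate_iff.mpr ⟨hp, by rw [inv_inv]; ring⟩

/-- Interpolation of resolvent estimates, with the exponents given by their reciprocals. -/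
theorem IsCoerciveForm.dualBound_inv {X : Type*} [MeasurableSpace X] {μ : Measure X}
    [IsFiniteMeasure μ] {E : Type*} [NormedAddCommGroup E] [InnerProductSpace ℂ E] [CompleteSpace E]
    {V : Type*} [NormedAddCommGroup V] [InnerProductSpace ℂ V] [CompleteSpace V]
    {a : V →ₗ[ℂ] V →ₗ⋆[ℂ] ℂ} {C c : ℝ} (h : IsCoerciveForm a C c) {ι : V →L[ℂ] Lp E 2 μ}
    (hι : DenseRange ι) {γ e₀ e₁ x₀ x₁ x : ℝ} (hγ0 : 0 < γ) (hγ1 : γ < 1) (he₀ : e₀ < γ)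
    (he₁ : γ < e₁) (hx₀ : 1 / 2 ≤ x₀) (hx₁ : x₀ < x₁)
    (hx : (e₁ - e₀) * x = (e₁ - γ) * x₀ + (γ - e₀) * x₁)
    (h₀ : ResolventPairing (formRes ι (adjForm a)) e₀ x₀⁻¹)
    (h₁ : ResolventPairing (formRes ι (adjForm a)) e₁ x₁⁻¹) :
    DualBound (formOperator (ι : V →ₗ[ℂ] Lp E 2 μ) a) γ x⁻¹ := by
  have hx₀0 : 0 < x₀ := by linarith
  have hx₁0 : 0 < x₁ := by linarith
  have hx0 : 0 < x := by
    have : 0 < (e₁ - e₀) * x := by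
      rw [hx]
      exact add_pos (mul_pos (by linarith) hx₀0) (mul_pos (by linarith) hx₁0)
    exact pos_of_mul_pos_right this (by linarith)
  have hinv : ∀ y : ℝ, 1 / 2 ≤ y → y⁻¹ ≤ 2 := fun y hy => by
    rw [inv_le_comm₀ (by linarith) (by norm_num)]
    linarith
  have hd : x₁ - x₀ ≠ 0 := by linarith
  -- In reciprocal exponents `x` is the affine interpolant of `x₀` and `x₁` at `γ` between `e₀` and
  -- `e₁`. This value of `m` is the one for which both exponent relations reduce to that affine
  -- identity.
  refine h.dualBound_interpolation hι (m := (e₁ - e₀) * x / (x₁ - x₀)) ?_ (by positivity) hγ0 hγ1 he₀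
    he₁ (by positivity) (by positivity) (hinv _ hx₀) (hinv _ (by linarith)) ?_ ?_ h₀ h₁
  · exact div_pos (mul_pos (by linarith) hx0) (by linarith)
  · field_simp
    linear_combination hx
  · field_simp
    linear_combination hx

theorem IsKatoOperator.adjoint_negPow {d n : ℕ} {Ω : Set (EuclideanSpace ℝ (Fin d))}
    {V : Submodule ℂ (W12 n Ω)} [CompleteSpace V] (hV : DenseRange (inclL2CLM V))
    {A : L2 n Ω →ₗ.[ℂ] L2 n Ω} (hA : IsKatoOperator (inclL2 V) A) (γ : ℝ) :
    ContinuousLinearMap.adjoint (negPow A γ) = negPow A† γ := by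
  obtain ⟨a, C, c, h, rfl⟩ := hA.exists_isCoerciveForm
  exact h.adjoint_negPow (ι := inclL2CLM V) hV γ

theorem IsKatoOperator.dualBound_of_half_le {d n : ℕ} {Ω : Set (EuclideanSpace ℝ (Fin d))}
    [IsFiniteMeasure (volume.restrict Ω)] {V : Submodule ℂ (W12 n Ω)} [CompleteSpace V]
    (hV : DenseRange (inclL2CLM V)) {A : L2 n Ω →ₗ.[ℂ] L2 n Ω} (hA : IsKatoOperator (inclL2 V) A)
    {γ q : ℝ} (hγ : 1 / 2 ≤ γ) (hγ1 : γ < 1) (hq : 0 < q)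
    (hK : ∃ K : ℝ≥0, ∀ v : V,
      PairingLE (volume.restrict Ω) q (fun y => ‖inclL2CLM V v y‖ₑ) (K * ‖v‖ₑ)) :
    DualBound A γ q := by
  obtain ⟨a, C, c, h, rfl⟩ := hA.exists_isCoerciveForm
  obtain ⟨K, hK⟩ := hK
  rcases hγ.eq_or_lt with rfl | hγ
  · obtain ⟨-, hr, c', D, -, hD, hn⟩ := hA
    obtain ⟨K', hK'0, hK'⟩ := h.norm_negPow_half_le hV rfl hr hD fun v u e => (hn v u e).2
    exact h.dualBound_half hV hq hK hK'0 hK'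
  · exact h.dualBound_of_half_lt hV hγ hγ1 hq hK

end DualBounds

/-! ### The three cases of the proposition -/

theorem proposition5p6 {d n : ℕ} (hd : 1 ≤ d)
    (Ω : Set (EuclideanSpace ℝ (Fin d))) (hΩ : IsOpen Ω) (hfin : volume Ω < ⊤)
    (pS : ℝ) (hpS : 2 < pS) (hpS' : 3 ≤ d → pS = 2 * (d : ℝ) / ((d : ℝ) - 2))
    (V : Submodule ℂ (W12 n Ω)) (hVclosed : IsClosed (V : Set (W12 n Ω)))
    (hVdense : DenseRange (inclL2 V))
    (hSob : EmbedsLp V (ENNReal.ofReal pS))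
    (A : L2 n Ω →ₗ.[ℂ] L2 n Ω) (hA : IsKatoOperator (inclL2 V) A)
    (f : ℝ → EuclideanSpace ℝ (Fin d) → EuclideanSpace ℂ (Fin n) → EuclideanSpace ℂ (Fin n))
    (σ : ℝ) (hσ : 1 ≤ σ) :
    -- `α = 0`, without information on the domain of the adjoint
    (∀ γ ∈ Set.Ico (1 / 2 : ℝ) 1,
      (d = 1 → σ = 2 → EmbedsLp V ⊤ →
        LipHolderGrowth Ω f 2 1 σ → SuperpositionGood A f 0 γ) ∧
      (d = 2 → σ < 2 → (∃ P : ℝ, 2 < P ∧ σ ≤ 2 - 2 / P ∧ EmbedsLp V (ENNReal.ofReal P)) →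
        LipHolderGrowth Ω f 2 (1 - 1 / pS)⁻¹ σ → SuperpositionGood A f 0 γ) ∧
      (3 ≤ d → σ = 2 - 2 / pS →
        LipHolderGrowth Ω f 2 (1 - 1 / pS)⁻¹ σ → SuperpositionGood A f 0 γ)) ∧
    -- `α = 0`, with an embedding of the domain of the adjoint
    (∀ p : ℝ, pS < p → DomainEmbedsLp A† (ENNReal.ofReal p) → σ < 2 - 2 / p →
      ((σ - 2) * pS * p - 2 * pS + 4 * p) / (4 * (p - pS)) < 1 ∧
      ∀ γ ∈ Set.Ico (max (((σ - 2) * pS * p - 2 * pS + 4 * p) / (4 * (p - pS))) (1 / 2)) 1,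
        LipHolderGrowth Ω f 2 (1 - (2 * γ - 1) / p - (2 - 2 * γ) / pS)⁻¹ σ →
          SuperpositionGood A f 0 γ) ∧
    -- `α = 1/2`
    (σ < pS - 1 →
      (2 * σ - pS) / (2 * pS - 4) < 1 / 2 ∧
      ∀ γ ∈ Set.Ico (max ((2 * σ - pS) / (2 * pS - 4)) 0) (1 / 2),
        LipHolderGrowth Ω f pS (1 / 2 + γ - 2 * γ / pS)⁻¹ σ →
          SuperpositionGood A f (1 / 2) γ) := by
  have : IsFiniteMeasure (volume.restrict Ω) := ⟨by simpa using hfin⟩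
  have : CompleteSpace V := hVclosed.completeSpace_coe
  have hV : DenseRange (inclL2CLM V) := hVdense
  have hpS0 : 0 < pS := by linarith
  have hpSinv : 1 / pS < 1 / 2 := one_div_lt_one_div_of_lt (by norm_num) hpS
  have hpSinv0 : 0 < 1 / pS := by positivity
  have hadj := hA.adjoint_negPow hV
  have hzero : ∃ C : ℝ≥0, ∀ u : PowSpace A 0,
      eLpNorm (PowSpace.incl A 0 u) (ENNReal.ofReal 2) (volume.restrict Ω) ≤ C * ‖u‖ₑ :=
    ⟨1, eLpNorm_powSpace_zero_le A⟩
  refine ⟨fun γ hγ => ⟨fun _ h2 hinf hf => ?_, fun _ _ hP hf => ?_, fun _ h2 hf => ?_⟩,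
    fun p hp hdom hσp => ⟨?_, fun γ hγ hf => ?_⟩, fun hσp => ⟨?_, fun γ hγ hf => ?_⟩⟩
  · exact superpositionGood_of_dualBound (hadj γ)
      (hA.dualBound_of_half_le hV hγ.1 hγ.2 one_pos hinf.pairingLE_one) hf hfin hσ le_rfl le_rfl
      (by linarith) hzero
  · obtain ⟨P, hP2, hσP, hP⟩ := hP
    -- Here `r = max P p_*`. Its conjugate exponent `q₀` has to satisfy two conditions: `q₀ ≤ q`,
    -- which means `r ≥ p_*`, and `σ q₀ ≤ 2`, which means `σ ≤ 2 - 2/r` and persists when `r`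
    -- increases.
    obtain ⟨r, hr2, hrS, hσr, hr⟩ : ∃ r : ℝ, 2 < r ∧ pS ≤ r ∧ σ ≤ 2 - 2 / r ∧
        EmbedsLp V (ENNReal.ofReal r) := by
      rcases le_total P pS with h | h
      · refine ⟨pS, hpS, le_rfl, hσP.trans ?_, hSob⟩
        gcongr
      · exact ⟨P, hP2, h, hσP, hP⟩
    have hr0 : 0 < r := by linarith
    have hrinv : 1 / r ≤ 1 / pS := one_div_le_one_div_of_le hpS0 hrS
    have hrinv0 : 0 < 1 / r := by positivity
    have hx0 : 0 < 1 - 1 / r := by linarith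
    refine superpositionGood_of_dualBound (hadj γ) (hA.dualBound_of_half_le hV hγ.1 hγ.2
      (inv_pos.mpr hx0) (hr.pairingLE (holderConjugate_one_sub_inv (by linarith)))) hf hfin hσ
      ?_ ?_ ?_ hzero
    · exact (one_le_inv₀ hx0).mpr (by linarith)
    · exact inv_anti₀ (by linarith) (by linarith)
    · rw [← div_eq_mul_inv, div_le_iff₀ hx0]
      linarith [show 2 / r = 2 * (1 / r) by ring]
  · have hx0 : 0 < 1 - 1 / pS := by linarith
    refine superpositionGood_of_dualBound (hadj γ) (hA.dualBound_of_half_le hV hγ.1 hγ.2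
      (inv_pos.mpr hx0) (hSob.pairingLE (holderConjugate_one_sub_inv (by linarith)))) hf hfin hσ
      ?_ le_rfl ?_ hzero
    · exact (one_le_inv₀ hx0).mpr (by linarith)
    · rw [← div_eq_mul_inv, div_le_iff₀ hx0]
      linarith [show 2 / pS = 2 * (1 / pS) by ring]
  · have hp0 : 0 < p := by linarith
    have h1 : 2 / p * p = 2 := div_mul_cancel₀ _ hp0.ne'
    -- Multiplied out and divided by `p_*`, the inequality becomes `(σ - 2) p + 2 < 0`, that is, `σ
    -- < 2 - 2/p`.
    rw [div_lt_one (by linarith)]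
    nlinarith [mul_pos hpS0 hp0, mul_lt_mul_of_pos_right hσp (mul_pos hp0 hpS0),
      mul_assoc (2 / p) p pS]
  · have hp0 : 0 < p := by linarith
    have hpinv : 1 / p < 1 / pS := one_div_lt_one_div_of_lt hpS0 hp
    have hpinv0 : 0 < 1 / p := by positivity
    have hγ' : 1 / 2 ≤ γ := (le_max_right _ _).trans hγ.1
    have hγ0 := (le_max_left _ _).trans hγ.1
    have hγ1 := hγ.2
    rw [div_le_iff₀ (by linarith)] at hγ0
    set x := 1 - (2 * γ - 1) / p - (2 - 2 * γ) / pS with hx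
    -- The reciprocal of `q` interpolates between the exponents dual to `p_*`, at power `1/2`, and
    -- to `p`, at power `1`.
    have hx' : x = (2 * γ - 1) * (1 - 1 / p) + (2 - 2 * γ) * (1 - 1 / pS) := by rw [hx]; ring
    have hx0 : 1 / 2 ≤ x := by nlinarith
    have hx1 : x ≤ 1 := by nlinarith
    -- This is `γ ≥ γ₀` cleared of denominators, and it means `σ q ≤ 2`.
    have hxσ : σ ≤ 2 * x := by
      have h1 : x * (p * pS) = p * pS - (2 * γ - 1) * pS - (2 - 2 * γ) * p := by
        rw [hx]; field_simp
      have h2 : σ * (p * pS) ≤ 2 * x * (p * pS) := by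
        rw [mul_assoc 2, h1]
        linarith
      exact le_of_mul_le_mul_right h2 (by positivity)
    have hdual : DualBound A γ x⁻¹ := by
      have hK := hSob.pairingLE (holderConjugate_one_sub_inv (by linarith))
      -- Interpolation requires `γ` strictly between the end powers; the end `γ = 1/2` is the Kato
      -- case.
      rcases hγ'.eq_or_lt with h | h
      · have : x = 1 - 1 / pS := by rw [hx', ← h]; ring
        rw [this]
        exact hA.dualBound_of_half_le hV hγ' hγ.2 (inv_pos.mpr (by linarith)) hK
      · obtain ⟨a, C, c, hc, rfl⟩ := hA.exists_isCoerciveForm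
        obtain ⟨K, hK⟩ := hK
        obtain ⟨K', hK'⟩ := hdom
        refine hc.dualBound_inv hV (e₀ := 1 / 2) (e₁ := 1) (x₀ := 1 - 1 / pS) (x₁ := 1 - 1 / p)
          (by linarith) hγ.2 h hγ.2 (by linarith) (by linarith) (by rw [hx']; ring)
          (hc.adj.resolventPairing_half hK) (hc.resolventPairing_one hV (K := K') fun u => ?_)
        exact pairingLE_of_eLpNorm (holderConjugate_one_sub_inv (by linarith))
          (Lp.aestronglyMeasurable _) (hK' u)
    refine superpositionGood_of_dualBound (hadj γ) hdual hf hfin hσ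
      ((one_le_inv₀ (by linarith)).mpr hx1) le_rfl ?_ hzero
    rw [← div_eq_mul_inv, div_le_iff₀ (by linarith)]
    exact hxσ
  · rw [div_lt_iff₀ (by linarith)]
    linarith
  · have hγ' : 0 ≤ γ := (le_max_right _ _).trans hγ.1
    have hγ0 := (le_max_left _ _).trans hγ.1
    have hγ1 := hγ.2
    rw [div_le_iff₀ (by linarith)] at hγ0
    set x := 1 / 2 + γ - 2 * γ / pS with hx
    have hx' : x = (1 - 2 * γ) * (1 / 2) + 2 * γ * (1 - 1 / pS) := by rw [hx]; ring
    have hx0 : 1 / 2 ≤ x := by nlinarith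
    have hx1 : x ≤ 1 := by nlinarith
    -- Again `γ ≥ γ₀` without denominators, now meaning `σ q ≤ p_*`, since `H_{1/2} = V ⊆ L_{p_*}`.
    have hxσ : σ ≤ pS * x := by
      have h1 : pS * x = pS / 2 + γ * pS - 2 * γ := by rw [hx]; field_simp
      rw [h1]
      linarith
    have hdual : DualBound A γ x⁻¹ := by
      -- For `γ = 0` the dual bound is trivial with `q = 2`. Otherwise one interpolates between `L₂`
      -- at power `0` and `V` at power `1/2`, without using the domain of the adjoint.
      rcases hγ'.eq_or_lt with rfl | h
      · have : x⁻¹ = 2 := by rw [hx']; norm_num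
        rw [this]
        exact dualBound_zero A
      · obtain ⟨K, hK⟩ := hSob.pairingLE (holderConjugate_one_sub_inv (by linarith))
        obtain ⟨a, C, c, hc, rfl⟩ := hA.exists_isCoerciveForm
        have h2 := (hc.adj.isAccretiveResolvent (inclL2CLM V)).resolventPairing_two
        rw [← inv_inv (2 : ℝ), ← one_div (2 : ℝ)] at h2
        exact hc.dualBound_inv hV (e₀ := 0) (e₁ := 1 / 2) (x₀ := 1 / 2) (x₁ := 1 - 1 / pS)
          h (by linarith) h hγ.2 le_rfl (by linarith) (by rw [hx']; ring) h2
          (hc.adj.resolventPairing_half hK)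
    refine superpositionGood_of_dualBound (hadj γ) hdual hf hfin hσ
      ((one_le_inv₀ (by linarith)).mpr hx1) le_rfl ?_ (hA.eLpNorm_powSpace_half_le hSob)
    rw [← div_eq_mul_inv, div_le_iff₀ (by linarith)]
    exact hxσ
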